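/- **Setting.** Let $L$ be a real vector space with an anti-symmetric bilinear form $\sigma$ (possibly degenerate), and let $(T_t)_{t\in\mathbb R}$ be a one-parameter group of linear isomorphisms of $L$ preserving $\sigma$ (no continuity in $t$ is assumed). Let $\mathcal W(L,\sigma)$ be the Weyl $C^*$-algebra: the enveloping $C^*$-algebra (completion in the norm $\sup_\pi\|\pi(\cdot)\|$ over all Hilbert space representations) of the $*$-algebra spanned by the unitaries $W(f)$, $f\in L$, with $W(f)W(f')=e^{-\frac i2\sigma(f,f')}W(f+f')$ and $W(f)^*=W(-f)$. Let $\alpha_t$ be the automorphisms of $\mathcal W(L,\sigma)$ with $\alpha_t(W(f))=W(T_tf)$, and $\beta_t$ those of the commutative algebra $\mathcal W(L,0)$ with $\beta_t(W(f))=W(T_tf)$. State spaces carry the weak$^*$ topology. A *ground state* of a dynamical system is a time-invariant state $\omega$ such that the unitary group $U_t$ on its GNS space $(\pi_\omega,\mathcal H_\omega,\Omega_\omega)$, which implements the dynamics and satisfies $U_t\Omega_\omega=\Omega_\omega$, is strongly continuous, $U_t=e^{ith}$, with $h\ge 0$; it is *non-degenerate* if $\ker h=\mathbb C\,\Omega_\omega$.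 A *$\beta$-KMS state* is a state $\omega$ such that for all $A,B$ there is a bounded continuous function $F$ on $\{0\le \operatorname{Im}z\le\beta\}$, holomorphic in the interior, with $F(t)=\omega(A\alpha_t(B))$ and $F(t+i\beta)=\omega(\alpha_t(B)A)$ for all $t\in\mathbb{R}$. Denote the sets of ground and $\beta$-KMS states by $\mathscr G^0(\cdot)$ and $\mathscr G^{(\beta)}(\cdot)$. A *two-point function* is a complex bilinear form $\omega_2$ on $L\otimes\mathbb C$ with $\omega_2(\bar f,f)\ge0$ and $\omega_2(f,f')-\omega_2(f',f)=i\sigma(f,f')$ for all $f,f'\in L\otimes\mathbb{C}$, where $\sigma$ is extended complex bilinearly; a state $\omega$ on $\mathcal W(L,\sigma)$ is *quasi-free* with two-point function $\omega_2$ if $\omega(W(f))=e^{-\frac12\omega_2(f,f)}$ for all $f\in L$. The *one-particle structure associated with* $\omega_2$ is the (up to unitary equivalence unique) complex linear map $p:L\otimes\mathbb C\to\mathcal K$ with dense range in a Hilbert space $\mathcal K$ such that $\omega_2(\bar f,f')=\langle p(f),p(f')\rangle$. It is a *non-degenerate equilibrium* one-particle structure if there is a strongly continuous unitary group $\tilde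 O_t=e^{itH}$ on $\mathcal K$ with $\tilde O_tp=pT_t$ for which $0$ is not an eigenvalue of $H$. For a state $\omega'$ on $\mathcal W(L,\sigma)$ there is a unique weak$^*$-continuous affine map $\lambda_{\omega'}$ from the states of $\mathcal W(L,0)$ to the states of $\mathcal W(L,\sigma)$ such that $\lambda_{\omega'}(\rho)=\omega'\circ\eta_\rho$ for every pure state $\rho$ of $\mathcal{W}(L,0)$, where $\eta_\rho$ is the $*$-automorphism of $\mathcal W(L,\sigma)$ with $\eta_\rho(W(f))=\rho(W(f))W(f)$. **Claim.** (i) Let $\beta>0$ and let $\omega^{(\beta)}\in\mathscr G^{(\beta)}(\mathcal W(L,\sigma))$ be quasi-free with a two-point function $\omega^{(\beta)}_2$ whose associated one-particle structure is a non-degenerate equilibrium one-particle structure. Then $\lambda_{\omega^{(\beta)}}$ exists, is unique, and restricts to an affine homeomorphism from $\mathscr G^0(\mathcal W(L,0))$ onto $\mathscr G^{(\beta)}(\mathcal W(L,\sigma))$. (ii) Let $\omega^0\in\mathscr G^0(\mathcal W(L,\sigma))$ be quasi-free and non-degenerate, and suppose that the strong derivative $\partial_t\pi_{\omega^0}(\alpha_t(W(f)))\Omega_{\omega^0}|_{t=0}$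 exists for all $f\in L$. Then $\lambda_{\omega^0}$ exists, is unique, and restricts to an affine homeomorphism from $\mathscr G^0(\mathcal W(L,0))$ onto $\mathscr G^0(\mathcal W(L,\sigma))$. -/

import Mathlib

open scoped ComplexOrder InnerProductSpace TensorProduct ENNReal

universe u v

noncomputable section

/-! ### States, dynamics, ground states and KMS states of a unital C*-algebra -/

section CStar

variable {A : Type u} [CStarAlgebra A]

/-- The state space of a unital C*-algebra with its weak* topology (as a subspace of `WeakDual`):
normalised positive linear functionals. Positive functionals on a C*-algebra are automatically
continuous, so nothing is lost by working in the continuous dual. -/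
abbrev StateSpace (A : Type u) [CStarAlgebra A] : Type u :=
  {ω : WeakDual ℂ A // ω 1 = 1 ∧ ∀ a : A, 0 ≤ ω (star a * a)}

/-- A state is pure if it is not a non-trivial convex combination of states. -/
def IsPureState (ω : StateSpace A) : Prop :=
  ∀ (ω₁ ω₂ : StateSpace A) (t : ℝ), 0 < t → t < 1 →
    (∀ a, ω.1 a = (t : ℂ) * ω₁.1 a + ((1 - t : ℝ) : ℂ) * ω₂.1 a) → ω₁ = ω ∧ ω₂ = ω

/-- A one-parameter group of *-automorphisms; no continuity in `t` is required. -/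
structure AlgebraicDynamics (A : Type u) [CStarAlgebra A] where
  evol : ℝ → (A ≃⋆ₐ[ℂ] A)
  evol_zero : ∀ a, evol 0 a = a
  evol_add : ∀ s t a, evol (s + t) a = evol s (evol t a)

/-- Equilibrium (i.e. time invariant) states. -/
def IsEquilibriumState (α : AlgebraicDynamics A) (ω : StateSpace A) : Prop :=
  ∀ t a, ω.1 (α.evol t a) = ω.1 a

/-- A GNS-triple `(π, H, Ω)` of a state; it is unique up to unitary equivalence. -/
structure GNSTriple (ω : StateSpace A) where
  H : Type u
  [instNACG : NormedAddCommGroup H]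
  [instIPS : InnerProductSpace ℂ H]
  [instComplete : CompleteSpace H]
  π : A →⋆ₐ[ℂ] (H →L[ℂ] H)
  Ω : H
  cyclic : DenseRange (fun a => π a Ω)
  state_eq : ∀ a, ω.1 a = ⟪Ω, π a Ω⟫_ℂ

attribute [instance] GNSTriple.instNACG GNSTriple.instIPS GNSTriple.instComplete

/-- A one-parameter group of unitary operators on a Hilbert space. -/
structure UnitaryGroup (H : Type v) [NormedAddCommGroup H] [InnerProductSpace ℂ H] where
  U : ℝ → (H ≃ₗᵢ[ℂ] H)
  map_zero : ∀ ψ, U 0 ψ = ψ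
  map_add : ∀ s t ψ, U (s + t) ψ = U s (U t ψ)

namespace UnitaryGroup

variable {H : Type v} [NormedAddCommGroup H] [InnerProductSpace ℂ H] (V : UnitaryGroup H)

/-- Strong continuity. -/
def StronglyContinuous : Prop := ∀ ψ, Continuous fun t => V.U t ψ

/-- The graph of the generator `h`, where `U_t = e^{ith}`: the vector `ψ` is in the domain of `h`
and `h ψ = φ` if and only if `t ↦ U_t ψ` has derivative `i φ` at `t = 0` (Stone's theorem). -/
def GeneratorGraph (ψ φ : H) : Prop :=
  HasDerivAt (fun t : ℝ => V.U t ψ) (Complex.I • φ) 0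

/-- The generator satisfies `h ≥ 0`. -/
def PositiveGenerator : Prop := ∀ ψ φ, V.GeneratorGraph ψ φ → 0 ≤ ⟪ψ, φ⟫_ℂ

end UnitaryGroup

/-- `U_t` is the unitary group in a GNS-representation which implements the dynamics and leaves
the GNS-vector invariant. These properties determine it uniquely. -/
def GNSTriple.Implements {ω : StateSpace A} (τ : GNSTriple ω) (α : AlgebraicDynamics A)
    (V : UnitaryGroup τ.H) : Prop :=
  (∀ t, V.U t τ.Ω = τ.Ω) ∧ ∀ t a ψ, τ.π (α.evol t a) (V.U t ψ) = V.U t (τ.π a ψ)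

/-- Ground states: equilibrium states for which the implementing unitary group in the
GNS-representation is strongly continuous with a Hamiltonian `h ≥ 0`. By uniqueness of the
GNS-triple up to unitary equivalence, it does not matter which triple is used. -/
def groundStates (α : AlgebraicDynamics A) : Set (StateSpace A) :=
  {ω | IsEquilibriumState α ω ∧ ∃ (τ : GNSTriple ω) (V : UnitaryGroup τ.H),
    τ.Implements α V ∧ V.StronglyContinuous ∧ V.PositiveGenerator}

/-- Non-degeneracy of a ground state: `h ψ = 0` implies `ψ ∈ ℂ Ω`. -/
def IsNondegenerateGroundState (α : AlgebraicDynamics A) (ω : StateSpace A) : Prop :=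
  IsEquilibriumState α ω ∧ ∃ (τ : GNSTriple ω) (V : UnitaryGroup τ.H),
    τ.Implements α V ∧ V.StronglyContinuous ∧ V.PositiveGenerator ∧
      ∀ ψ, V.GeneratorGraph ψ 0 → ∃ c : ℂ, ψ = c • τ.Ω

/-- The KMS-condition at inverse temperature `β`. -/
def kmsStates (α : AlgebraicDynamics A) (β : ℝ) : Set (StateSpace A) :=
  {ω | ∀ a b : A, ∃ F : ℂ → ℂ,
    DifferentiableOn ℂ F {z | 0 < z.im ∧ z.im < β} ∧
    ContinuousOn F {z | 0 ≤ z.im ∧ z.im ≤ β} ∧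
    (∃ C : ℝ, ∀ z : ℂ, 0 ≤ z.im → z.im ≤ β → ‖F z‖ ≤ C) ∧
    ∀ t : ℝ, F t = ω.1 (a * α.evol t b) ∧ F (t + β * Complex.I) = ω.1 (α.evol t b * a)}

end CStar

/-- Affine maps between state spaces. -/
def IsAffineOnStates {A B : Type u} [CStarAlgebra A] [CStarAlgebra B] (S : Set (StateSpace A))
    (lam : StateSpace A → StateSpace B) : Prop :=
  ∀ ρ ∈ S, ∀ ρ₁ ∈ S, ∀ ρ₂ ∈ S, ∀ t : ℝ, 0 ≤ t → t ≤ 1 →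
    (∀ a, ρ.1 a = (t : ℂ) * ρ₁.1 a + ((1 - t : ℝ) : ℂ) * ρ₂.1 a) →
    ∀ b, (lam ρ).1 b = (t : ℂ) * (lam ρ₁).1 b + ((1 - t : ℝ) : ℂ) * (lam ρ₂).1 b

/-- `lam` restricts to an affine homeomorphism from `S` onto `S'` (weak* topologies). -/
def RestrictsToAffineHomeomorph {A B : Type u} [CStarAlgebra A] [CStarAlgebra B]
    (lam : StateSpace A → StateSpace B) (S : Set (StateSpace A)) (S' : Set (StateSpace B)) :
    Prop :=
  IsAffineOnStates S lam ∧ ∃ e : S ≃ₜ S', ∀ ρ : S, (e ρ : StateSpace B) = lam ρ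

/-! ### The Weyl C*-algebra of a pre-symplectic space -/

section Weyl

variable {L : Type u} [AddCommGroup L] [Module ℝ L]

/-- A Weyl system over `(L, σ)`: a representation of the Weyl relations by unitary operators on a
non-zero Hilbert space. No regularity is assumed. -/
structure WeylSystem (σ : LinearMap.BilinForm ℝ L) : Type (u + 1) where
  H : Type u
  [instNACG : NormedAddCommGroup H]
  [instIPS : InnerProductSpace ℂ H]
  [instComplete : CompleteSpace H]
  [instNontrivial : Nontrivial H]
  W : L → unitary (H →L[ℂ] H)
  W_mul : ∀ f g, (W f : H →L[ℂ] H) * W g =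
    Complex.exp (-Complex.I / 2 * (σ f g : ℂ)) • (W (f + g) : H →L[ℂ] H)
  W_star : ∀ f, star (W f : H →L[ℂ] H) = W (-f)

attribute [instance] WeylSystem.instNACG WeylSystem.instIPS WeylSystem.instComplete
  WeylSystem.instNontrivial

/-- The C*-algebra of bounded families of operators, indexed by all Weyl systems. -/
abbrev WeylAmbient (σ : LinearMap.BilinForm ℝ L) : Type (u + 1) :=
  lp (fun i : WeylSystem σ => i.H →L[ℂ] i.H) ∞

instance (σ : LinearMap.BilinForm ℝ L) : CStarAlgebra (WeylAmbient σ) where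

/-- The Weyl operator `W(f)` in the universal representation. -/
def weylAmbientGen (σ : LinearMap.BilinForm ℝ L) (f : L) : WeylAmbient σ :=
  ⟨fun i => (i.W f : i.H →L[ℂ] i.H), memℓp_infty ⟨1, by
    rintro _ ⟨i, rfl⟩
    exact CStarRing.norm_coe_unitary (i.W f) |>.le⟩⟩

/-- The norm-closed *-algebra generated by the Weyl operators in the universal representation. -/
def weylSubalgebra (σ : LinearMap.BilinForm ℝ L) : StarSubalgebra ℂ (WeylAmbient σ) :=
  (StarAlgebra.adjoin ℂ (Set.range (weylAmbientGen σ))).topologicalClosure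

instance (σ : LinearMap.BilinForm ℝ L) : IsClosed (weylSubalgebra σ : Set (WeylAmbient σ)) :=
  StarSubalgebra.isClosed_topologicalClosure _

/-- The Weyl C*-algebra `𝒲(L, σ)`: the completion of the *-algebra spanned by the Weyl operators
in the norm `sup ‖π(a)‖` over all representations `π` of the Weyl relations, i.e. its enveloping
C*-algebra. Every cyclic representation lives on a Hilbert space in the universe of `L`
(a completion of a quotient of `L →₀ ℂ`), so no representation is missed. -/
def WeylAlgebra (σ : LinearMap.BilinForm ℝ L) : Type (u + 1) := weylSubalgebra σ

instance (σ : LinearMap.BilinForm ℝ L) : CStarAlgebra (WeylAlgebra σ) :=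
  inferInstanceAs (CStarAlgebra (weylSubalgebra σ))

/-- The generators `W(f)` of the Weyl C*-algebra. -/
def weyl (σ : LinearMap.BilinForm ℝ L) (f : L) : WeylAlgebra σ :=
  ⟨weylAmbientGen σ f, StarSubalgebra.le_topologicalClosure _
    (StarAlgebra.subset_adjoin ℂ _ ⟨f, rfl⟩)⟩

/-- The first Weyl relation holds in the Weyl C*-algebra. -/
theorem weyl_mul (σ : LinearMap.BilinForm ℝ L) (f g : L) :
    weyl σ f * weyl σ g = Complex.exp (-Complex.I / 2 * (σ f g : ℂ)) • weyl σ (f + g) := by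
  apply Subtype.ext
  apply lp.ext
  funext i
  exact i.W_mul f g

/-- The second Weyl relation holds in the Weyl C*-algebra. -/
theorem star_weyl (σ : LinearMap.BilinForm ℝ L) (f : L) : star (weyl σ f) = weyl σ (-f) := by
  apply Subtype.ext
  apply lp.ext
  funext i
  exact i.W_star f

/-- A *-homomorphism out of the Weyl C*-algebra is determined by its values on the `W(f)`. -/
theorem weylHom_ext {σ : LinearMap.BilinForm ℝ L} {B : Type v} [CStarAlgebra B]
    {φ ψ : WeylAlgebra σ →⋆ₐ[ℂ] B} (h : ∀ f, φ (weyl σ f) = ψ (weyl σ f)) : φ = ψ := by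
  have hφ : Continuous φ := AddMonoidHomClass.continuous_of_bound φ 1
    fun a => by simpa using NonUnitalStarAlgHom.norm_apply_le φ a
  have hψ : Continuous ψ := AddMonoidHomClass.continuous_of_bound ψ 1
    fun a => by simpa using NonUnitalStarAlgHom.norm_apply_le ψ a
  refine StarAlgHom.ext_topologicalClosure (S := StarAlgebra.adjoin ℂ
    (Set.range (weylAmbientGen σ))) (φ := φ) (ψ := ψ) hφ hψ ?_
  refine StarAlgHom.ext_adjoin ?_
  rintro ⟨_, hx⟩ ⟨f, rfl⟩
  exact h f

/-- A one-particle dynamical system: a one-parameter group of pre-symplectic isomorphisms. -/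
structure OneParticleDynamics (σ : LinearMap.BilinForm ℝ L) where
  T : ℝ → (L ≃ₗ[ℝ] L)
  T_zero : ∀ f, T 0 f = f
  T_add : ∀ s t f, T (s + t) f = T s (T t f)
  preserves : ∀ t f g, σ (T t f) (T t g) = σ f g

/-- The same one-parameter group, seen as acting on `(L, 0)`. -/
def OneParticleDynamics.classical {σ : LinearMap.BilinForm ℝ L} (D : OneParticleDynamics σ) :
    OneParticleDynamics (0 : LinearMap.BilinForm ℝ L) where
  T := D.T
  T_zero := D.T_zero
  T_add := D.T_add
  preserves _ _ _ := rfl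

/-- Pulling back a Weyl system along a linear map which preserves `σ`. -/
def WeylSystem.pullback {σ : LinearMap.BilinForm ℝ L} (i : WeylSystem σ) (S : L →ₗ[ℝ] L)
    (hS : ∀ f g, σ (S f) (S g) = σ f g) : WeylSystem σ where
  H := i.H
  W f := i.W (S f)
  W_mul f g := by rw [i.W_mul, hS, map_add]
  W_star f := by rw [i.W_star, map_neg]

/-- The endomorphism of the ambient algebra which replaces each Weyl system by its pull-back. -/
def weylAmbientMap (σ : LinearMap.BilinForm ℝ L) (S : L →ₗ[ℝ] L)
    (hS : ∀ f g, σ (S f) (S g) = σ f g) : WeylAmbient σ →⋆ₐ[ℂ] WeylAmbient σ where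
  toFun a := ⟨fun i => a (i.pullback S hS), memℓp_infty ⟨‖a‖, by
    rintro _ ⟨i, rfl⟩
    exact lp.norm_apply_le_norm ENNReal.top_ne_zero a (i.pullback S hS)⟩⟩
  map_one' := rfl
  map_mul' _ _ := rfl
  map_zero' := rfl
  map_add' _ _ := rfl
  commutes' _ := rfl
  map_star' _ := rfl

theorem weylAmbientMap_mem (σ : LinearMap.BilinForm ℝ L) (S : L →ₗ[ℝ] L)
    (hS : ∀ f g, σ (S f) (S g) = σ f g) {a : WeylAmbient σ} (ha : a ∈ weylSubalgebra σ) :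
    weylAmbientMap σ S hS a ∈ weylSubalgebra σ := by
  have hc : Continuous (weylAmbientMap σ S hS) :=
    AddMonoidHomClass.continuous_of_bound (weylAmbientMap σ S hS) 1
    fun a => by simpa using NonUnitalStarAlgHom.norm_apply_le (weylAmbientMap σ S hS) a
  have hle : weylSubalgebra σ ≤ (weylSubalgebra σ).comap (weylAmbientMap σ S hS) := by
    refine StarSubalgebra.topologicalClosure_minimal (StarAlgebra.adjoin_le ?_) ?_
    · rintro _ ⟨f, rfl⟩
      exact (weyl σ (S f)).2
    · exact (StarSubalgebra.isClosed_topologicalClosure _).preimage hc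
  exact hle ha

/-- The *-endomorphism of the Weyl C*-algebra with `W(f) ↦ W(S f)`. -/
def weylMap (σ : LinearMap.BilinForm ℝ L) (S : L →ₗ[ℝ] L)
    (hS : ∀ f g, σ (S f) (S g) = σ f g) : WeylAlgebra σ →⋆ₐ[ℂ] WeylAlgebra σ where
  toFun a := ⟨weylAmbientMap σ S hS a.1, weylAmbientMap_mem σ S hS a.2⟩
  map_one' := rfl
  map_mul' _ _ := rfl
  map_zero' := rfl
  map_add' _ _ := rfl
  commutes' _ := rfl
  map_star' _ := rfl

theorem weylMap_weyl (σ : LinearMap.BilinForm ℝ L) (S : L →ₗ[ℝ] L)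
    (hS : ∀ f g, σ (S f) (S g) = σ f g) (f : L) :
    weylMap σ S hS (weyl σ f) = weyl σ (S f) := rfl

theorem weylMap_comp (σ : LinearMap.BilinForm ℝ L) {S S' S'' : L →ₗ[ℝ] L}
    (hS : ∀ f g, σ (S f) (S g) = σ f g) (hS' : ∀ f g, σ (S' f) (S' g) = σ f g)
    (hS'' : ∀ f g, σ (S'' f) (S'' g) = σ f g) (h : ∀ f, S (S' f) = S'' f) (a : WeylAlgebra σ) :
    weylMap σ S hS (weylMap σ S' hS' a) = weylMap σ S'' hS'' a := by
  have : (weylMap σ S hS).comp (weylMap σ S' hS') = weylMap σ S'' hS'' :=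
    weylHom_ext fun f => by
      rw [StarAlgHom.comp_apply, weylMap_weyl, weylMap_weyl, weylMap_weyl, h]
  exact congrArg (fun φ : WeylAlgebra σ →⋆ₐ[ℂ] WeylAlgebra σ => φ a) this

theorem weylMap_id (σ : LinearMap.BilinForm ℝ L) {S : L →ₗ[ℝ] L}
    (hS : ∀ f g, σ (S f) (S g) = σ f g) (h : ∀ f, S f = f) (a : WeylAlgebra σ) :
    weylMap σ S hS a = a := by
  have : weylMap σ S hS = StarAlgHom.id ℂ (WeylAlgebra σ) :=
    weylHom_ext fun f => by rw [weylMap_weyl, h]; rfl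
  exact congrArg (fun φ : WeylAlgebra σ →⋆ₐ[ℂ] WeylAlgebra σ => φ a) this

/-- The quasi-free dynamics `α_t` on the Weyl C*-algebra, determined by `α_t(W(f)) = W(T_t f)`. -/
def quasiFreeDynamics {σ : LinearMap.BilinForm ℝ L} (D : OneParticleDynamics σ) :
    AlgebraicDynamics (WeylAlgebra σ) where
  evol t := StarAlgEquiv.ofStarAlgHom (weylMap σ (D.T t) (D.preserves t))
    (weylMap σ (D.T (-t)) (D.preserves (-t)))
    (by
      ext a
      refine (weylMap_comp σ _ _ (S'' := LinearMap.id) (fun _ _ => rfl) (fun f => ?_) a).trans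
        (weylMap_id σ _ (fun _ => rfl) a)
      have := D.T_add (-t) t f
      rw [neg_add_cancel, D.T_zero] at this
      exact this.symm)
    (by
      ext a
      refine (weylMap_comp σ _ _ (S'' := LinearMap.id) (fun _ _ => rfl) (fun f => ?_) a).trans
        (weylMap_id σ _ (fun _ => rfl) a)
      have := D.T_add t (-t) f
      rw [add_neg_cancel, D.T_zero] at this
      exact this.symm)
  evol_zero a := weylMap_id σ _ (fun f => D.T_zero f) a
  evol_add s t a :=
    (weylMap_comp σ (D.preserves s) (D.preserves t) _ (fun f => (D.T_add s t f).symm) a).symm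

theorem quasiFreeDynamics_weyl {σ : LinearMap.BilinForm ℝ L} (D : OneParticleDynamics σ)
    (t : ℝ) (f : L) : (quasiFreeDynamics D).evol t (weyl σ f) = weyl σ (D.T t f) := rfl

/-- The map `λ_{ω'}` from the states of `𝒲(L, 0)` to the states of `𝒲(L, σ)`: it is
weak*-continuous and affine, and on a pure state `ρ` it is `η_ρ^* ω'`, where `η_ρ` is the
*-automorphism (gauge transformation of the second kind) with `η_ρ(W(f)) = ρ(W(f)) W(f)`. -/
structure IsLambdaMap {σ : LinearMap.BilinForm ℝ L} (ω' : StateSpace (WeylAlgebra σ))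
    (lam : StateSpace (WeylAlgebra (0 : LinearMap.BilinForm ℝ L)) → StateSpace (WeylAlgebra σ)) :
    Prop where
  continuous : Continuous lam
  affine : IsAffineOnStates Set.univ lam
  pure : ∀ ρ, IsPureState ρ → ∃ η : WeylAlgebra σ ≃⋆ₐ[ℂ] WeylAlgebra σ,
    (∀ f, η (weyl σ f) = ρ.1 (weyl 0 f) • weyl σ f) ∧ ∀ a, (lam ρ).1 a = ω'.1 (η a)

/-! ### Two-point functions, quasi-free states and one-particle structures -/

/-- The complexification of `L`. -/
abbrev Complexification (L : Type u) [AddCommGroup L] [Module ℝ L] : Type u := ℂ ⊗[ℝ] L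

/-- Complex conjugation on the complexification, `z ⊗ f ↦ z̄ ⊗ f`. -/
def conjC (f : Complexification L) : Complexification L :=
  TensorProduct.map Complex.conjAe.toLinearMap LinearMap.id f

/-- Two-point functions on `(L, σ)`, as complex bilinear forms on the complexification:
`ω₂(f̄, f) ≥ 0` and `ω₂(f, f') - ω₂(f', f) = i σ(f, f')`. -/
structure IsTwoPointFunction (σ : LinearMap.BilinForm ℝ L)
    (ω₂ : LinearMap.BilinForm ℂ (Complexification L)) : Prop where
  positive : ∀ f, 0 ≤ ω₂ (conjC f) f
  commutator : ∀ f f', ω₂ f f' - ω₂ f' f = Complex.I * σ.baseChange ℂ f f'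

/-- `ω` is the quasi-free state with two-point function `ω₂`. -/
def IsQuasiFreeWith {σ : LinearMap.BilinForm ℝ L} (ω : StateSpace (WeylAlgebra σ))
    (ω₂ : LinearMap.BilinForm ℂ (Complexification L)) : Prop :=
  IsTwoPointFunction σ ω₂ ∧
    ∀ f : L, ω.1 (weyl σ f) = Complex.exp (-(1 / 2) * ω₂ (1 ⊗ₜ[ℝ] f) (1 ⊗ₜ[ℝ] f))

/-- Quasi-free states. -/
def IsQuasiFree {σ : LinearMap.BilinForm ℝ L} (ω : StateSpace (WeylAlgebra σ)) : Prop :=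
  ∃ ω₂, IsQuasiFreeWith ω ω₂

/-- One-particle structures on `(L, σ)` with values in the Hilbert space `K`. -/
structure OneParticleStructure (σ : LinearMap.BilinForm ℝ L) (K : Type v)
    [NormedAddCommGroup K] [InnerProductSpace ℂ K] where
  p : Complexification L →ₗ[ℂ] K
  dense : DenseRange p
  commutator : ∀ f f', ⟪p (conjC f), p f'⟫_ℂ - ⟪p (conjC f'), p f⟫_ℂ =
    Complex.I * σ.baseChange ℂ f f'

namespace OneParticleStructure

variable {σ : LinearMap.BilinForm ℝ L} {K : Type v} [NormedAddCommGroup K]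
  [InnerProductSpace ℂ K]

/-- `(p, K)` is the one-particle structure associated with `ω₂` (unique up to unitary
equivalence). -/
def IsAssociatedWith (P : OneParticleStructure σ K)
    (ω₂ : LinearMap.BilinForm ℂ (Complexification L)) : Prop :=
  ∀ f f', ω₂ (conjC f) f' = ⟪P.p f, P.p f'⟫_ℂ

/-- A non-degenerate equilibrium one-particle structure: there is a unitary group with
`O_t p = p T_t`, it is strongly continuous, and 0 is not an eigenvalue of its generator. The
unitary group is unique because `p` has dense range. -/
def IsNondegenerateEquilibrium (P : OneParticleStructure σ K) (D : OneParticleDynamics σ) : Prop :=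
  ∃ O : UnitaryGroup K,
    (∀ t f, O.U t (P.p f) = P.p ((D.T t : L →ₗ[ℝ] L).baseChange ℂ f)) ∧
    O.StronglyContinuous ∧ ∀ ψ, O.GeneratorGraph ψ 0 → ψ = 0

end OneParticleStructure

/-- The strong derivative `∂_t π_ω(α_t(W(f))) Ω_ω |_{t = 0}` exists for all `f ∈ L`, in the
GNS-representation of `ω`. -/
def HasStrongDerivatives {σ : LinearMap.BilinForm ℝ L} (D : OneParticleDynamics σ)
    (ω : StateSpace (WeylAlgebra σ)) : Prop :=
  ∃ τ : GNSTriple ω, ∀ f : L,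
    DifferentiableAt ℝ (fun t : ℝ => τ.π ((quasiFreeDynamics D).evol t (weyl σ f)) τ.Ω) 0

end Weyl

end

/-! ### Boundary values of bounded holomorphic functions -/

/-! A state of the Weyl algebra is determined by its generating function `f ↦ ω(W(f))`, and the
functions that occur are the normalised ones whose kernel `weylKernel` is positive semidefinite
(`exists_weylState`). On generating functions `λ_ω` is multiplication: `(λ_ω ρ)(W(f)) = ρ(W(f))
ω(W(f))`. The Schur product theorem makes the product a state, characters give the prescribed values
on pure states, and Krein–Milman gives uniqueness (`exists_isLambdaMap`). When `ω` is quasi-free,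
its generating function is a Gaussian `exp(-Q/2)`. This never vanishes, so the inverse of `λ_ω` has
to be division by the Gaussian, and everything reduces to deciding which quotients occur.

The classical ground states are exactly the states whose generating function satisfies `ρ(W(f + T_t
g)) = ρ(W(f + g))`: the function of `t` and its complex conjugate both extend boundedly to the upper
half plane, so Liouville applies. Multiplying the correlation functions of `ω` by such constants
preserves the ground state or KMS condition, which settles one direction.

Conversely, let `ω'` satisfy the same condition as `ω` and put `q(f) = ω'(W(f)) exp(Q(f)/2)`. The
correlation functions of `ω` on Weyl operators are exponentials whose exponent is quadratic in `(f,
g)`. Scaling `f, g` by `s` and letting `s` tend to zero shows that the exponent itself, and not only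
its exponential, is a boundary value of a bounded holomorphic function. Its negative can then be
exponentiated, and the Gaussian together with the commutation phase cancels
(`isBoundaryValue_quotient`). What remains is `q(f + T_t g)`, which carries no ordering of the
factors. In the half plane it is constant by reflection and Liouville
(`IsBoundaryValue.eq_of_upperHalfPlane`). In the strip both edges carry the same values, so there is
a bounded periodic entire extension (`IsBoundaryValue.eq_of_openStrip`).

It remains to see that `q` is of positive type for `σ = 0`. Being constant along orbits, `q` does
not change when vectors are replaced by averages over their orbits. Non-degeneracy lets these
averages have arbitrarily small `Q`. This is a mean ergodic argument with minimizers of `Q` on the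
convex hull of an orbit (`exists_tendsto_invariant`), run in the one-particle space for KMS states
and with the vectors `W(f)Ω` for ground states. Along such averages both the phase and the Gaussian
tend to one, so the kernel of `ω'` converges to that of `q` (`posSemidef_quotient`). The two cases
share `exists_lambdaMap_restricts`. -/

section BoundaryValues

open Set Filter Topology Complex

/-- An open subset of `ℂ` in which bounded holomorphic functions satisfy the maximum principle. -/
structure HasMaxPrinciple (R : Set ℂ) : Prop where
  isOpen : IsOpen R
  norm_le : ∀ (F : ℂ → ℂ) (C : ℝ), DiffContOnCl ℂ F R → (∃ B, ∀ z ∈ closure R, ‖F z‖ ≤ B) →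
    (∀ z ∈ frontier R, ‖F z‖ ≤ C) → ∀ z ∈ closure R, ‖F z‖ ≤ C

/-- On the boundary of `R`, the function `u` coincides with a bounded continuous function on the
closure of `R` which is holomorphic in `R`. -/
def IsBoundaryValue (R : Set ℂ) (u : ℂ → ℂ) : Prop :=
  ∃ F : ℂ → ℂ, DiffContOnCl ℂ F R ∧ (∃ B, ∀ z ∈ closure R, ‖F z‖ ≤ B) ∧
    ∀ z ∈ frontier R, F z = u z

namespace IsBoundaryValue

variable {R : Set ℂ} {u v : ℂ → ℂ}

theorem congr (hu : IsBoundaryValue R u) (h : ∀ z ∈ frontier R, u z = v z) :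
    IsBoundaryValue R v := by
  obtain ⟨F, hF, hB, hu⟩ := hu
  exact ⟨F, hF, hB, fun z hz => (hu z hz).trans (h z hz)⟩

theorem const (R : Set ℂ) (c : ℂ) : IsBoundaryValue R fun _ => c :=
  ⟨fun _ => c, diffContOnCl_const, ⟨‖c‖, fun _ _ => le_rfl⟩, fun _ _ => rfl⟩

theorem add (hu : IsBoundaryValue R u) (hv : IsBoundaryValue R v) :
    IsBoundaryValue R fun z => u z + v z := by
  obtain ⟨F, hF, ⟨B, hB⟩, hu⟩ := hu
  obtain ⟨G, hG, ⟨C, hC⟩, hv⟩ := hv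
  refine ⟨fun z => F z + G z, hF.add hG, ⟨B + C, fun z hz => ?_⟩, fun z hz => ?_⟩
  · exact (norm_add_le _ _).trans (add_le_add (hB z hz) (hC z hz))
  · simp only [hu z hz, hv z hz]

theorem mul (hu : IsBoundaryValue R u) (hv : IsBoundaryValue R v) :
    IsBoundaryValue R fun z => u z * v z := by
  obtain ⟨F, hF, ⟨B, hB⟩, hu⟩ := hu
  obtain ⟨G, hG, ⟨C, hC⟩, hv⟩ := hv
  refine ⟨fun z => F z * G z, hF.smul hG, ⟨B * C, fun z hz => ?_⟩, fun z hz => ?_⟩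
  · rw [norm_mul]
    exact mul_le_mul (hB z hz) (hC z hz) (norm_nonneg _) ((norm_nonneg _).trans (hB z hz))
  · simp only [hu z hz, hv z hz]

theorem const_mul (c : ℂ) (hu : IsBoundaryValue R u) : IsBoundaryValue R fun z => c * u z :=
  (const R c).mul hu

theorem exp (hu : IsBoundaryValue R u) : IsBoundaryValue R fun z => Complex.exp (u z) := by
  obtain ⟨F, hF, ⟨B, hB⟩, hu⟩ := hu
  refine ⟨fun z => Complex.exp (F z), Complex.differentiable_exp.comp_diffContOnCl hF,
    ⟨Real.exp B, fun z hz => ?_⟩, fun z hz => by simp only [hu z hz]⟩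
  rw [Complex.norm_exp]
  exact Real.exp_le_exp.2 ((Complex.re_le_norm _).trans (hB z hz))

/-- The maximum principle turns closeness on the frontier into closeness on the whole closure, so
the extensions of the approximants form a uniform Cauchy sequence. Their limit is continuous on the
closure and holomorphic inside. -/
theorem of_forall_approx (hR : HasMaxPrinciple R)
    (h : ∀ ε > 0, ∃ u', IsBoundaryValue R u' ∧ ∀ z ∈ frontier R, ‖u z - u' z‖ ≤ ε) :
    IsBoundaryValue R u := by
  have hpos (n : ℕ) : (0 : ℝ) < (1 / 2) ^ n := by positivity
  choose w hw hwu using fun n : ℕ => h ((1 / 2) ^ n) (hpos n)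
  choose F hF hB hFw using hw
  have hdiff (n m : ℕ) (hnm : n ≤ m) (z) (hz : z ∈ closure R) :
      ‖F n z - F m z‖ ≤ 2 * (1 / 2) ^ n := by
    obtain ⟨B, hB'⟩ := hB n
    obtain ⟨C, hC'⟩ := hB m
    refine hR.norm_le (fun z => F n z - F m z) _ ((hF n).sub (hF m))
      ⟨B + C, fun z hz => (norm_sub_le _ _).trans (add_le_add (hB' z hz) (hC' z hz))⟩
      (fun z hz => ?_) z hz
    have h1 := hwu n z hz
    have h2 := hwu m z hz
    have h3 : ((1 : ℝ) / 2) ^ m ≤ (1 / 2) ^ n :=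
      pow_le_pow_of_le_one (by norm_num) (by norm_num) hnm
    rw [hFw n z hz, hFw m z hz, ← sub_sub_sub_cancel_left (w m z) (w n z) (u z)]
    exact (norm_sub_le _ _).trans (by linarith)
  have hlim : Tendsto (fun n : ℕ => (2 : ℝ) * (1 / 2) ^ n) atTop (𝓝 0) := by
    simpa using (tendsto_pow_atTop_nhds_zero_of_lt_one (r := (1 / 2 : ℝ)) (by norm_num)
      (by norm_num)).const_mul 2
  have hcauchy (z) (hz : z ∈ closure R) : ∃ l, Tendsto (fun n => F n z) atTop (𝓝 l) := by
    refine cauchySeq_tendsto_of_complete (cauchySeq_of_le_tendsto_0' _ (fun n m hnm => ?_) hlim)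
    rw [dist_eq_norm]
    exact hdiff n m hnm z hz
  choose! G hG using hcauchy
  have hbound (n : ℕ) (z) (hz : z ∈ closure R) : ‖F n z - G z‖ ≤ 2 * (1 / 2) ^ n := by
    refine le_of_tendsto ((tendsto_const_nhds.sub (hG z hz)).norm) ?_
    filter_upwards [eventually_ge_atTop n] with m hm using hdiff n m hm z hz
  have hunif : TendstoUniformlyOn F G atTop (closure R) := by
    rw [Metric.tendstoUniformlyOn_iff]
    intro ε hε
    filter_upwards [hlim.eventually (gt_mem_nhds hε)] with n hn z hz
    rw [dist_comm, dist_eq_norm]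
    exact (hbound n z hz).trans_lt hn
  refine ⟨G, ⟨?_, ?_⟩, ?_, fun z hz => ?_⟩
  · exact (hunif.mono subset_closure).tendstoLocallyUniformlyOn.differentiableOn
      (Eventually.of_forall fun n => (hF n).differentiableOn) hR.isOpen
  · exact hunif.continuousOn (Eventually.of_forall fun n => (hF n).continuousOn).frequently
  · obtain ⟨B, hB'⟩ := hB 0
    refine ⟨B + 2, fun z hz => ?_⟩
    have h1 := hbound 0 z hz
    have h2 := hB' z hz
    have h3 := norm_sub_norm_le (G z) (F 0 z)
    rw [norm_sub_rev] at h3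
    simp only [pow_zero, mul_one] at h1
    linarith
  · refine tendsto_nhds_unique (hG z (frontier_subset_closure hz)) ?_
    refine tendsto_iff_norm_sub_tendsto_zero.2 (squeeze_zero (fun _ => norm_nonneg _) (fun n => ?_)
      (tendsto_pow_atTop_nhds_zero_of_lt_one (r := (1 / 2 : ℝ)) (by norm_num) (by norm_num)))
    rw [hFw n z hz, norm_sub_rev]
    exact hwu n z hz

/-- If the functions `exp (- s² k)` are boundary values, then so is the bounded function `k`. -/
theorem of_exp_neg_sq_mul (hR : HasMaxPrinciple R) {k : ℂ → ℂ} {M : ℝ}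
    (hk : ∀ z ∈ frontier R, ‖k z‖ ≤ M)
    (h : ∀ s : ℝ, IsBoundaryValue R fun z => Complex.exp (-((s : ℂ) ^ 2 * k z))) :
    IsBoundaryValue R k := by
  refine of_forall_approx hR fun ε hε => ?_
  set N : ℝ := |M| + 1 with hN
  have hNpos : 0 < N := by positivity
  -- The first bound puts `s² k` in the range of the second-order estimate for `exp`; the second
  -- bounds the remainder `(s² N)²` after division by `s²`.
  obtain ⟨s, hs0, hs1, hs2⟩ : ∃ s : ℝ, 0 < s ∧ s ^ 2 * N ≤ 1 ∧ s ^ 2 * N ^ 2 ≤ ε := by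
    have hm : 0 < min (1 / N) (ε / N ^ 2) := by positivity
    refine ⟨Real.sqrt (min (1 / N) (ε / N ^ 2)), Real.sqrt_pos.2 hm, ?_, ?_⟩
    · rw [Real.sq_sqrt hm.le]
      calc _ ≤ 1 / N * N := by gcongr; exact min_le_left _ _
        _ = 1 := by field_simp
    · rw [Real.sq_sqrt hm.le]
      calc _ ≤ ε / N ^ 2 * N ^ 2 := by gcongr; exact min_le_right _ _
        _ = ε := by field_simp
  -- The approximant is the difference quotient `(1 - exp(-s² k)) / s²`, which recovers `k` as `s →
  -- 0`.
  refine ⟨fun z => ((s : ℂ) ^ 2)⁻¹ * (1 + (-1) * Complex.exp (-((s : ℂ) ^ 2 * k z))),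
    ((const R 1).add ((h s).const_mul (-1))).const_mul _, fun z hz => ?_⟩
  have hkN : ‖k z‖ ≤ N := (hk z hz).trans (by rw [hN]; linarith [le_abs_self M])
  have hsC : (s : ℂ) ^ 2 ≠ 0 := by exact_mod_cast (pow_pos hs0 2).ne'
  have hx : ‖-((s : ℂ) ^ 2 * k z)‖ ≤ s ^ 2 * N := by
    rw [norm_neg, norm_mul, norm_pow, Complex.norm_real, Real.norm_of_nonneg hs0.le]
    gcongr
  have key := Complex.norm_exp_sub_one_sub_id_le (hx.trans hs1)
  have : k z - ((s : ℂ) ^ 2)⁻¹ * (1 + (-1) * Complex.exp (-((s : ℂ) ^ 2 * k z))) =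
      ((s : ℂ) ^ 2)⁻¹ * (Complex.exp (-((s : ℂ) ^ 2 * k z)) - 1 - -((s : ℂ) ^ 2 * k z)) := by
    field_simp
    ring
  rw [this, norm_mul, norm_inv, norm_pow, Complex.norm_real, Real.norm_of_nonneg hs0.le]
  calc (s ^ 2)⁻¹ * _ ≤ (s ^ 2)⁻¹ * (s ^ 2 * N) ^ 2 := by
        gcongr
        exact key.trans (by gcongr)
    _ = s ^ 2 * N ^ 2 := by field_simp
    _ ≤ ε := hs2

end IsBoundaryValue

/-! ### Maximum principles for the strip and the half plane -/

/-- The open strip `0 < Im z < β`. -/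
def openStrip (β : ℝ) : Set ℂ := im ⁻¹' Ioo 0 β

theorem closure_openStrip {β : ℝ} (hβ : 0 < β) : closure (openStrip β) = im ⁻¹' Icc 0 β := by
  rw [openStrip, Complex.closure_preimage_im, closure_Ioo hβ.ne]

theorem frontier_openStrip {β : ℝ} (hβ : 0 < β) :
    frontier (openStrip β) = {z | z.im = 0 ∨ z.im = β} := by
  rw [openStrip, Complex.frontier_preimage_im, frontier_Ioo hβ]
  rfl

theorem hasMaxPrinciple_openStrip {β : ℝ} (hβ : 0 < β) : HasMaxPrinciple (openStrip β) where
  isOpen := isOpen_Ioo.preimage Complex.continuous_im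
  norm_le F C hF hB hC z hz := by
    obtain ⟨B, hB⟩ := hB
    rw [closure_openStrip hβ] at hz hB
    rw [frontier_openStrip hβ] at hC
    -- With both growth parameters zero, the Phragmén–Lindelöf growth condition is just boundedness.
    refine PhragmenLindelof.horizontal_strip (a := 0) (b := β) hF
      ⟨0, by positivity, 0, ?_⟩ (fun z hz => hC z (Or.inl hz))
      (fun z hz => hC z (Or.inr hz)) hz.1 hz.2
    refine Asymptotics.IsBigO.of_bound B ?_
    refine Eventually.filter_mono inf_le_right (mem_principal.2 fun w hw => ?_)
    simpa using hB w ⟨hw.1.le, hw.2.le⟩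

/-- The open upper half plane. -/
def openUpperHalfPlane : Set ℂ := {z | 0 < z.im}

theorem closure_openUpperHalfPlane : closure openUpperHalfPlane = {z | 0 ≤ z.im} :=
  Complex.closure_setOfPred_lt_im 0

theorem frontier_openUpperHalfPlane : frontier openUpperHalfPlane = {z | z.im = 0} :=
  Complex.frontier_setOfPred_lt_im 0

theorem hasMaxPrinciple_openUpperHalfPlane : HasMaxPrinciple openUpperHalfPlane where
  isOpen := isOpen_lt continuous_const Complex.continuous_im
  norm_le F C hF hB hC z hz := by
    obtain ⟨B, hB⟩ := hB
    rw [closure_openUpperHalfPlane] at hz hB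
    rw [frontier_openUpperHalfPlane] at hC
    -- Multiplication by `I` carries the right half plane, where Phragmén–Lindelöf is applied, onto
    -- the upper one.
    have hG : DiffContOnCl ℂ (fun w : ℂ => F (I * w)) {w | 0 < w.re} :=
      hF.comp (g := fun w : ℂ => I * w) (Differentiable.diffContOnCl (by fun_prop))
        fun w hw => by simpa [openUpperHalfPlane] using hw
    have := PhragmenLindelof.right_half_plane_of_bounded_on_real (f := fun w : ℂ => F (I * w))
      (C := C) (z := -I * z) hG ⟨0, by norm_num, 0, ?_⟩ ?_ ?_ (by simpa using hz)
    · simpa [← mul_assoc] using this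
    · refine Asymptotics.IsBigO.of_bound B ?_
      refine Eventually.filter_mono inf_le_right (mem_principal.2 fun w hw => ?_)
      have hw' : 0 < w.re := hw
      simpa using hB (I * w) (by simpa using hw'.le)
    · refine ⟨B, eventually_map.2 ?_⟩
      filter_upwards [eventually_ge_atTop (0 : ℝ)] with x hx
      exact hB (I * x) (by simpa using hx)
    · intro x
      exact hC _ (by simp)

/-- Cauchy's theorem needs holomorphy only in the interior of a rectangle, and continuity up to its
boundary. A rectangle crossing the line is cut along it into two such rectangles, and the two
integrals over the cut cancel. Morera's theorem then removes the line. -/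
theorem isConservativeOn_of_differentiableOn_off_line {f : ℂ → ℂ} {U : Set ℂ} {c : ℝ}
    (hf : ContinuousOn f U)
    (hd : ∀ z ∈ U, z.im ≠ c → DifferentiableAt ℂ f z) : IsConservativeOn f U := by
  have key (z w : ℂ) (hzw : Rectangle z w ⊆ U) (hc : c ∉ Ioo (min z.im w.im) (max z.im w.im)) :
      wedgeIntegral z w f + wedgeIntegral w z f = 0 := by
    rw [wedgeIntegral_add_wedgeIntegral_eq]
    refine integral_boundary_rect_eq_zero_of_continuousOn_of_differentiableOn f z w
      (hf.mono hzw) fun x hx => (hd x (hzw ?_) ?_).differentiableWithinAt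
    · exact ⟨Ioo_subset_Icc_self hx.1, Ioo_subset_Icc_self hx.2⟩
    · rintro rfl
      exact hc hx.2
  intro z w hzw
  rw [← add_eq_zero_iff_eq_neg]
  by_cases hc : c ∈ Ioo (min z.im w.im) (max z.im w.im)
  swap
  · exact key z w hzw hc
  have hcm : c ∈ uIcc z.im w.im := Ioo_subset_Icc_self hc
  have h1 := key z (w.re + c * I) (fun x hx => hzw ?_) (by simp +contextual [le_of_lt])
  have h2 := key (z.re + c * I) w (fun x hx => hzw ?_) (by simp +contextual [le_of_lt])
  · rw [wedgeIntegral_add_wedgeIntegral_eq] at h1 h2 ⊢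
    have hint (x : ℝ) (hx : x ∈ uIcc z.re w.re) (a b : ℝ) (ha : a ∈ uIcc z.im w.im)
        (hb : b ∈ uIcc z.im w.im) :
        IntervalIntegrable (fun y : ℝ => f (x + y * I)) MeasureTheory.volume a b := by
      refine ContinuousOn.intervalIntegrable ((hf.mono hzw).comp (by fun_prop) fun y hy => ?_)
      refine ⟨by simpa using hx, ?_⟩
      have := uIcc_subset_uIcc ha hb hy
      simpa using this
    have hz : z.im ∈ uIcc z.im w.im := left_mem_uIcc
    have hw : w.im ∈ uIcc z.im w.im := right_mem_uIcc
    have e1 := intervalIntegral.integral_add_adjacent_intervals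
      (hint w.re right_mem_uIcc _ _ hz hcm) (hint w.re right_mem_uIcc _ _ hcm hw)
    have e2 := intervalIntegral.integral_add_adjacent_intervals
      (hint z.re left_mem_uIcc _ _ hz hcm) (hint z.re left_mem_uIcc _ _ hcm hw)
    simp only [add_re, ofReal_re, mul_re, I_re, mul_zero, ofReal_im, I_im, mul_one, sub_self,
      add_zero, add_im, mul_im, zero_add] at h1 h2
    rw [← e1, ← e2, smul_add, smul_add]
    linear_combination h1 + h2
  · refine ⟨by simpa using hx.1, ?_⟩
    have := hx.2
    simp only [mem_preimage, add_im, ofReal_im, mul_im, ofReal_re, I_im, mul_one, I_re, mul_zero, add_zero,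
      zero_add] at this
    exact uIcc_subset_uIcc hcm right_mem_uIcc this
  · refine ⟨by simpa using hx.1, ?_⟩
    have := hx.2
    simp only [mem_preimage, add_im, ofReal_im, mul_im, ofReal_re, I_im, mul_one, I_re, mul_zero, add_zero,
      zero_add] at this
    exact uIcc_subset_uIcc left_mem_uIcc hcm this

/-- A continuous function which is holomorphic off a horizontal line is holomorphic. -/
theorem differentiableOn_of_differentiableAt_off_line {f : ℂ → ℂ} {U : Set ℂ} {c : ℝ}
    (hf : ContinuousOn f U) (hU : IsOpen U)
    (hd : ∀ z ∈ U, z.im ≠ c → DifferentiableAt ℂ f z) : DifferentiableOn ℂ f U :=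
  (isConservativeOn_and_continuousOn_iff_isDifferentiableOn hU).1
    ⟨isConservativeOn_of_differentiableOn_off_line hf hd, hf⟩

/-- Functions on the closed upper and lower half planes which coincide on the real line glue to
an entire function. -/
theorem differentiable_glue {F G : ℂ → ℂ} (hF : DiffContOnCl ℂ F {z | 0 < z.im})
    (hG : DiffContOnCl ℂ G {z | z.im < 0}) (h : ∀ t : ℝ, F t = G t) :
    Differentiable ℂ fun z => if 0 ≤ z.im then F z else G z := by
  have hF' := hF.continuousOn
  have hG' := hG.continuousOn
  rw [Complex.closure_setOfPred_lt_im] at hF'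
  rw [Complex.closure_setOfPred_im_lt] at hG'
  refine fun z => (differentiableOn_of_differentiableAt_off_line (U := univ) (c := 0) ?_ isOpen_univ
    ?_).differentiableAt univ_mem
  · refine Continuous.continuousOn ?_
    refine continuous_if_le continuous_const Complex.continuous_im hF' hG' fun z hz => ?_
    have : z = (z.re : ℝ) := Complex.ext rfl (by simpa using hz.symm)
    rw [this, h]
  · intro z _ hz
    rcases lt_or_gt_of_ne hz with hz | hz
    · have ho : IsOpen {z : ℂ | z.im < 0} := isOpen_lt Complex.continuous_im continuous_const
      refine (hG.differentiableAt ho hz).congr_of_eventuallyEq ?_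
      filter_upwards [ho.mem_nhds hz] with w hw
      exact if_neg (not_le.2 hw)
    · have ho : IsOpen {z : ℂ | 0 < z.im} := isOpen_lt continuous_const Complex.continuous_im
      refine (hF.differentiableAt ho hz).congr_of_eventuallyEq ?_
      filter_upwards [ho.mem_nhds hz] with w hw
      exact if_pos (le_of_lt hw)

/-- Two functions which are holomorphic in the upper half plane and coincide on the real line
coincide. -/
theorem eqOn_upperHalfPlane {F G : ℂ → ℂ} (hF : DiffContOnCl ℂ F {z | 0 < z.im})
    (hG : DiffContOnCl ℂ G {z | 0 < z.im}) (h : ∀ t : ℝ, F t = G t) (z : ℂ) (hz : 0 ≤ z.im) :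
    F z = G z := by
  -- Extended by zero to the lower half plane, `F - G` is entire, and the identity theorem applies.
  have hd := differentiable_glue (hF.sub hG) (diffContOnCl_const (c := (0 : ℂ)))
    fun t => sub_eq_zero.2 (h t)
  have han : AnalyticOnNhd ℂ (fun z : ℂ => if 0 ≤ z.im then (F - G) z else 0) univ :=
    fun z _ => hd.analyticAt z
  have ho : IsOpen {z : ℂ | z.im < 0} := isOpen_lt Complex.continuous_im continuous_const
  have h0 := han.eqOn_zero_of_preconnected_of_eventuallyEq_zero isPreconnected_univ
    (mem_univ (-I)) (by
      filter_upwards [ho.mem_nhds (show (-I : ℂ).im < 0 by simp)] with w hw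
      exact if_neg (not_le.2 hw)) (mem_univ z)
  simp only [if_pos hz, Pi.sub_apply, Pi.zero_apply] at h0
  exact sub_eq_zero.1 h0

/-- If `u` and its complex conjugate are boundary values of bounded holomorphic functions in the
upper half plane, then `u` is constant. -/
theorem IsBoundaryValue.eq_of_upperHalfPlane {u v : ℝ → ℂ}
    (hu : IsBoundaryValue openUpperHalfPlane fun z => u z.re)
    (hv : IsBoundaryValue openUpperHalfPlane fun z => v z.re)
    (h : ∀ t, v t = (starRingEnd ℂ) (u t)) (s t : ℝ) : u s = u t := by
  obtain ⟨F, hF, ⟨B, hB⟩, hu⟩ := hu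
  obtain ⟨G, hG, ⟨C, hC⟩, hv⟩ := hv
  rw [closure_openUpperHalfPlane] at hB hC
  rw [frontier_openUpperHalfPlane] at hu hv
  -- Schwarz reflection of `G`: it lives in the lower half plane and has boundary values `conj v =
  -- u`, the same as `F`. The glued function is bounded and entire.
  have hG' : DiffContOnCl ℂ (fun z => (starRingEnd ℂ) (G ((starRingEnd ℂ) z))) {z | z.im < 0} := by
    constructor
    · intro z hz
      have hz' : (starRingEnd ℂ) z ∈ openUpperHalfPlane := by
        simpa [openUpperHalfPlane] using hz
      have := (hG.differentiableAt hasMaxPrinciple_openUpperHalfPlane.isOpen hz').star_star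
      simp only [starRingEnd_apply, star_star] at this ⊢
      exact this.differentiableWithinAt
    · have hGc := hG.continuousOn
      rw [closure_openUpperHalfPlane] at hGc
      rw [Complex.closure_setOfPred_im_lt]
      refine Complex.continuous_conj.comp_continuousOn (hGc.comp
        Complex.continuous_conj.continuousOn fun z hz => ?_)
      simpa using hz
  have hd := differentiable_glue hF hG' fun t => by
    rw [hu t (by simp), Complex.conj_ofReal, hv t (by simp)]
    simp [h]
  have hb : Bornology.IsBounded (range fun z : ℂ =>
      if 0 ≤ z.im then F z else (starRingEnd ℂ) (G ((starRingEnd ℂ) z))) := by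
    refine isBounded_iff_forall_norm_le.2 ⟨max B C, ?_⟩
    rintro _ ⟨z, rfl⟩
    by_cases hz : 0 ≤ z.im
    · simp only [if_pos hz]
      exact (hB z hz).trans (le_max_left _ _)
    · simp only [if_neg hz]
      rw [RCLike.norm_conj]
      exact (hC _ (by simpa using (not_le.1 hz).le)).trans (le_max_right _ _)
  have := hd.apply_eq_apply_of_bounded hb s t
  simpa [hu s (by simp), hu t (by simp)] using this

/-- A function on the real line is constant if it is the boundary value, on both sides of a strip,
of a bounded holomorphic function. -/
theorem IsBoundaryValue.eq_of_openStrip {β : ℝ} (hβ : 0 < β) {u : ℝ → ℂ}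
    (hu : IsBoundaryValue (openStrip β) fun z => u z.re) (s t : ℝ) : u s = u t := by
  obtain ⟨F, hF, ⟨B, hB⟩, hu⟩ := hu
  rw [frontier_openStrip hβ] at hu
  rw [closure_openStrip hβ] at hB
  have hFc := hF.continuousOn
  rw [closure_openStrip hβ] at hFc
  -- Clamping the imaginary part to `[0, β]` gives a function continuous on all of `ℂ`, which serves
  -- to check continuity across the seams.
  set Fc : ℂ → ℂ := fun z => F (z.re + (max 0 (min β z.im) : ℝ) * I) with hFcdef
  have hFcc : Continuous Fc := by
    refine hFc.comp_continuous (by fun_prop) fun z => ?_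
    simp [hβ.le]
  have hFcF (z : ℂ) (h0 : 0 ≤ z.im) (h1 : z.im ≤ β) : Fc z = F z := by
    simp only [hFcdef]
    rw [min_eq_right h1, max_eq_right h0, Complex.re_add_im]
  -- The extension of `F` with period `β I`. It is continuous across the lines `Im z = n β` because
  -- `F` takes the same values `u` on both edges of the strip.
  set Q : ℂ → ℂ := fun z => F (z - ⌊z.im / β⌋ * β * I) with hQ
  have him (z : ℂ) (n : ℤ) : (z - n * β * I).im = z.im - n * β := by simp
  have hfl (z : ℂ) : 0 ≤ (z - ⌊z.im / β⌋ * β * I).im ∧ (z - ⌊z.im / β⌋ * β * I).im < β := by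
    rw [him]
    have h1 := Int.floor_le (z.im / β)
    have h2 := Int.lt_floor_add_one (z.im / β)
    rw [le_div_iff₀ hβ] at h1
    rw [div_lt_iff₀ hβ] at h2
    constructor <;> linarith
  have hQn (z : ℂ) (n : ℤ) (h0 : 0 ≤ z.im - n * β) (h1 : z.im - n * β < β) :
      Q z = F (z - n * β * I) := by
    have : ⌊z.im / β⌋ = n := by
      rw [Int.floor_eq_iff, le_div_iff₀ hβ, div_lt_iff₀ hβ]
      constructor <;> linarith
    rw [hQ, ← this]
  have hopen : IsOpen (openStrip β) := (hasMaxPrinciple_openStrip hβ).isOpen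
  have hdiff (z : ℂ) (n : ℤ) (h0 : 0 < z.im - n * β) (h1 : z.im - n * β < β) :
      DifferentiableAt ℂ Q z := by
    have hmem : z - n * β * I ∈ openStrip β := by
      rw [openStrip, mem_preimage, him]
      exact ⟨h0, h1⟩
    have hd : DifferentiableAt ℂ (fun w : ℂ => F (w - n * β * I)) z :=
      (hF.differentiableAt hopen hmem).comp z (by fun_prop)
    refine hd.congr_of_eventuallyEq ?_
    have : IsOpen ((fun w : ℂ => w - n * β * I) ⁻¹' openStrip β) := hopen.preimage (by fun_prop)
    filter_upwards [this.mem_nhds hmem] with w hw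
    rw [mem_preimage, openStrip, mem_preimage, him] at hw
    exact hQn w n hw.1.le hw.2
  have hd : Differentiable ℂ Q := by
    intro z
    set n := ⌊z.im / β⌋ with hn
    have hz := hfl z
    rw [← hn, him] at hz
    -- The two periods adjacent to the line `Im z = n β`. This is the only seam inside `U`, so it is
    -- the only line to be removed.
    set U : Set ℂ := im ⁻¹' Ioo ((n - 1) * β) ((n + 1) * β) with hU
    have hUo : IsOpen U := isOpen_Ioo.preimage Complex.continuous_im
    have hzU : z ∈ U := ⟨by nlinarith, by nlinarith⟩
    refine (differentiableOn_of_differentiableAt_off_line (c := n * β) ?_ hUo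
      ?_).differentiableAt (hUo.mem_nhds hzU)
    · have hcont : Continuous fun w : ℂ => if n * β ≤ w.im then Fc (w - n * β * I) else
          Fc (w - ((n - 1 : ℤ) : ℂ) * β * I) := by
        refine Continuous.if_le (hFcc.comp (by fun_prop)) (hFcc.comp (by fun_prop))
          continuous_const Complex.continuous_im fun w hw => ?_
        have h1 : (w - n * β * I).im = 0 := by rw [him]; linarith
        have h2 : (w - ((n - 1 : ℤ) : ℂ) * β * I).im = β := by rw [him]; push_cast; linarith
        rw [hFcF _ (by rw [h1]) (by rw [h1]; exact hβ.le), hFcF _ (by rw [h2]; exact hβ.le)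
          (by rw [h2]), hu _ (Or.inl h1), hu _ (Or.inr h2)]
        simp
      refine hcont.continuousOn.congr fun w hw => ?_
      dsimp only
      by_cases hnw : n * β ≤ w.im
      · have hw2 := hw.2
        rw [if_pos hnw, hQn w n (by linarith) (by linarith), hFcF _ (by rw [him]; linarith)
          (by rw [him]; linarith)]
      · have hw1 := hw.1
        rw [not_le] at hnw
        have e : ((n - 1 : ℤ) : ℝ) * β = n * β - β := by push_cast; ring
        rw [if_neg (not_le.2 hnw), hQn w (n - 1) (by linarith) (by linarith),
          hFcF _ (by rw [him]; linarith) (by rw [him]; linarith)]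
    · intro w hw hwn
      rcases lt_or_gt_of_ne hwn with hlt | hlt
      · have hw1 := hw.1
        have e : ((n - 1 : ℤ) : ℝ) * β = n * β - β := by push_cast; ring
        exact hdiff w (n - 1) (by linarith) (by linarith)
      · have hw2 := hw.2
        exact hdiff w n (by linarith) (by linarith)
  have hb : Bornology.IsBounded (range Q) := by
    refine isBounded_iff_forall_norm_le.2 ⟨B, ?_⟩
    rintro _ ⟨z, rfl⟩
    exact hB _ ⟨(hfl z).1, (hfl z).2.le⟩
  have := hd.apply_eq_apply_of_bounded hb s t
  rw [hQn s 0 (by simp) (by simpa), hQn t 0 (by simp) (by simpa)] at this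
  simpa [hu s (Or.inl (by simp)), hu t (Or.inl (by simp))] using this

end BoundaryValues

/-! ### Unitary groups with positive generator -/

namespace UnitaryGroup

open Set Filter Topology MeasureTheory

variable {H : Type v} [NormedAddCommGroup H] [InnerProductSpace ℂ H]

theorem integrable_exp_mul_sub_sq (a : ℝ) :
    Integrable fun t : ℝ => Real.exp (a * |t| - t ^ 2) := by
  have h : Integrable fun t : ℝ => Real.exp (a ^ 2) * Real.exp (-(1 / 2) * t ^ 2) :=
    (integrable_exp_neg_mul_sq (by norm_num)).const_mul _
  refine h.mono' (by fun_prop) (Eventually.of_forall fun t => ?_)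
  rw [Real.norm_of_nonneg (Real.exp_nonneg _), ← Real.exp_add]
  refine Real.exp_le_exp.2 ?_
  have h1 := sq_abs t
  nlinarith [sq_nonneg (|t| - a), sq_nonneg a]

theorem norm_cexp_le {R : ℝ} {z : ℂ} (hz : ‖z‖ ≤ R) (t : ℝ) :
    ‖Complex.exp (2 * t * z - t ^ 2)‖ ≤ Real.exp (2 * R * |t| - t ^ 2) := by
  rw [Complex.norm_exp]
  refine Real.exp_le_exp.2 ?_
  have : (2 * t * z - t ^ 2 : ℂ).re = 2 * (t * z.re) - t ^ 2 := by
    simp [pow_two, mul_assoc]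
  rw [this]
  have h1 : t * z.re ≤ |t| * R := (le_abs_self _).trans (by
    rw [abs_mul]
    exact mul_le_mul_of_nonneg_left ((Complex.abs_re_le_norm z).trans hz) (abs_nonneg t))
  linarith

/-- Gaussian transforms of bounded continuous functions are entire. -/
theorem differentiable_integral_cexp_smul [CompleteSpace H] {w : ℝ → H} (hw : Continuous w) {C : ℝ}
    (hC : ∀ t, ‖w t‖ ≤ C) :
    Differentiable ℂ fun z : ℂ => ∫ t : ℝ, Complex.exp (2 * t * z - t ^ 2) • w t := by
  intro z₀
  have hC0 : 0 ≤ C := (norm_nonneg _).trans (hC 0)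
  have hint (z : ℂ) : Integrable fun t : ℝ => Complex.exp (2 * t * z - t ^ 2) • w t := by
    refine ((integrable_exp_mul_sub_sq (2 * ‖z‖)).mul_const C).mono' (by fun_prop)
      (Eventually.of_forall fun t => ?_)
    rw [norm_smul]
    exact mul_le_mul (norm_cexp_le le_rfl t) (hC t) (norm_nonneg _) (Real.exp_nonneg _)
  refine (hasDerivAt_integral_of_dominated_loc_of_deriv_le
    (F := fun (z : ℂ) (t : ℝ) => Complex.exp (2 * t * z - t ^ 2) • w t)
    (F' := fun (z : ℂ) (t : ℝ) => (Complex.exp (2 * t * z - t ^ 2) * (2 * t)) • w t)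
    (bound := fun t => Real.exp ((2 * (‖z₀‖ + 1) + 2) * |t| - t ^ 2) * C)
    (Metric.ball_mem_nhds z₀ one_pos) (Eventually.of_forall fun z => (hint z).1) (hint z₀)
    (by fun_prop) (Eventually.of_forall fun t z hz => ?_)
    ((integrable_exp_mul_sub_sq _).mul_const C)
    (Eventually.of_forall fun t z _ => ?_)).2.differentiableAt
  · have hz' : ‖z‖ ≤ ‖z₀‖ + 1 := by
      have h1 := mem_ball_iff_norm.1 hz
      have h2 := norm_sub_norm_le z z₀
      linarith
    rw [norm_smul, norm_mul]
    refine mul_le_mul ?_ (hC t) (norm_nonneg _) (Real.exp_nonneg _)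
    -- The factor `2 t` produced by differentiation is absorbed in `exp(2|t|)`; this is the summand
    -- `2` in the dominating exponent.
    have h2 : ‖(2 * t : ℂ)‖ ≤ Real.exp (2 * |t|) := by
      rw [norm_mul, Complex.norm_ofNat, Complex.norm_real, Real.norm_eq_abs]
      linarith [Real.add_one_le_exp (2 * |t|)]
    calc _ ≤ Real.exp (2 * (‖z₀‖ + 1) * |t| - t ^ 2) * Real.exp (2 * |t|) :=
          mul_le_mul (norm_cexp_le hz' t) h2 (norm_nonneg _) (Real.exp_nonneg _)
      _ = _ := by rw [← Real.exp_add]; ring_nf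
  · refine HasDerivAt.smul_const ?_ _
    refine HasDerivAt.cexp ?_
    simpa using ((hasDerivAt_id z).const_mul (2 * t : ℂ)).sub_const ((t : ℂ) ^ 2)

variable (V : UnitaryGroup H)

theorem norm_U (t : ℝ) (ψ : H) : ‖V.U t ψ‖ = ‖ψ‖ := (V.U t).norm_map ψ

theorem inner_U (t : ℝ) (φ ψ : H) : ⟪V.U t φ, V.U t ψ⟫_ℂ = ⟪φ, ψ⟫_ℂ :=
  (V.U t).inner_map_map φ ψ

/-- Smoothing by Gaussians provides entire orbits of a strongly continuous unitary group. -/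
theorem exists_entire_smoothing [CompleteSpace H] (hV : V.StronglyContinuous) :
    ∃ G : ℝ → H →L[ℂ] H, (∀ ε s ψ, V.U s (G ε ψ) = G ε (V.U s ψ)) ∧
      (∀ ψ, Tendsto (fun ε => G ε ψ) (𝓝 0) (𝓝 ψ)) ∧
      ∀ ε, 0 < ε → ∀ ψ, ∃ Φ : ℂ → H, Differentiable ℂ Φ ∧ Φ 0 = G ε ψ ∧
        ∀ (z : ℂ) (s : ℝ), Φ (z + s) = V.U s (Φ z) := by
  -- Normalises the Gaussian weight, so that `G ε ψ` is an average of `V.U (ε t) ψ` tending to `ψ`.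
  set c : ℂ := ((Real.sqrt Real.pi : ℝ) : ℂ)⁻¹ with hc
  have hγ : Integrable fun t : ℝ => Real.exp (-t ^ 2) := by
    simpa using integrable_exp_neg_mul_sq (b := 1) one_pos
  have hγi : ∫ t : ℝ, Real.exp (-t ^ 2) = Real.sqrt Real.pi := by
    simpa using integral_gaussian 1
  have hcont (ε : ℝ) (ψ : H) : Continuous fun t : ℝ => V.U (ε * t) ψ :=
    (hV ψ).comp (continuous_const.mul continuous_id)
  have hint (ε : ℝ) (ψ : H) : Integrable fun t : ℝ => (Real.exp (-t ^ 2) : ℂ) • V.U (ε * t) ψ := by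
    refine (hγ.mul_const ‖ψ‖).mono' ?_ (Eventually.of_forall fun t => ?_)
    · exact (Continuous.smul (by fun_prop) (hcont ε ψ)).aestronglyMeasurable
    · rw [norm_smul, V.norm_U, Complex.norm_real, Real.norm_of_nonneg (Real.exp_nonneg _)]
  set G₀ : ℝ → H →ₗ[ℂ] H := fun ε =>
    { toFun := fun ψ => c • ∫ t : ℝ, (Real.exp (-t ^ 2) : ℂ) • V.U (ε * t) ψ
      map_add' := fun φ ψ => by
        have h (t : ℝ) : (Real.exp (-t ^ 2) : ℂ) • V.U (ε * t) (φ + ψ) =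
            (Real.exp (-t ^ 2) : ℂ) • V.U (ε * t) φ + (Real.exp (-t ^ 2) : ℂ) • V.U (ε * t) ψ := by
          rw [_root_.map_add, smul_add]
        rw [integral_congr_ae (Eventually.of_forall h), integral_add (hint ε φ) (hint ε ψ), smul_add]
      map_smul' := fun a ψ => by
        have h (t : ℝ) : (Real.exp (-t ^ 2) : ℂ) • V.U (ε * t) (a • ψ) =
            a • (Real.exp (-t ^ 2) : ℂ) • V.U (ε * t) ψ := by
          rw [map_smul, smul_comm]
        rw [integral_congr_ae (Eventually.of_forall h), integral_smul, smul_comm,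
          RingHom.id_apply] } with hG₀
  have hbound (ε : ℝ) (ψ : H) : ‖G₀ ε ψ‖ ≤ 1 * ‖ψ‖ := by
    have h1 : ‖∫ t : ℝ, (Real.exp (-t ^ 2) : ℂ) • V.U (ε * t) ψ‖ ≤ Real.sqrt Real.pi * ‖ψ‖ := by
      rw [← hγi, ← integral_mul_const]
      refine norm_integral_le_of_norm_le (hγ.mul_const ‖ψ‖) (Eventually.of_forall fun t => ?_)
      rw [norm_smul, V.norm_U, Complex.norm_real, Real.norm_of_nonneg (Real.exp_nonneg _)]
    have hpi : 0 < Real.sqrt Real.pi := Real.sqrt_pos.2 Real.pi_pos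
    change ‖c • ∫ t : ℝ, (Real.exp (-t ^ 2) : ℂ) • V.U (ε * t) ψ‖ ≤ _
    rw [norm_smul, hc, norm_inv, Complex.norm_real, Real.norm_of_nonneg hpi.le, one_mul,
      inv_mul_le_iff₀ hpi]
    exact h1
  have hG (ε : ℝ) (ψ : H) : (G₀ ε).mkContinuous 1 (hbound ε) ψ =
      c • ∫ t : ℝ, (Real.exp (-t ^ 2) : ℂ) • V.U (ε * t) ψ := rfl
  have hUint (s : ℝ) (g : ℝ → H) : V.U s (∫ t, g t) = ∫ t, V.U s (g t) :=
    ((V.U s).toContinuousLinearEquiv.integral_comp_comm g).symm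
  refine ⟨fun ε => (G₀ ε).mkContinuous 1 (hbound ε), fun ε s ψ => ?_, fun ψ => ?_,
    fun ε hε ψ => ?_⟩
  · rw [hG, hG, map_smul, hUint]
    simp only [map_smul]
    simp only [← V.map_add, add_comm s]
  · simp only [hG]
    have hlim : c • ∫ t : ℝ, (Real.exp (-t ^ 2) : ℂ) • ψ = ψ := by
      rw [integral_smul_const, integral_complex_ofReal, hγi, smul_smul, hc, inv_mul_cancel₀, one_smul]
      exact_mod_cast (Real.sqrt_pos.2 Real.pi_pos).ne'
    conv => rhs; rw [← hlim]
    refine Tendsto.const_smul ?_ _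
    refine tendsto_integral_filter_of_dominated_convergence (fun t => Real.exp (-t ^ 2) * ‖ψ‖)
      (Eventually.of_forall fun ε => (hint ε ψ).1) (Eventually.of_forall fun ε =>
        Eventually.of_forall fun t => ?_) (hγ.mul_const _) (Eventually.of_forall fun t => ?_)
    · rw [norm_smul, V.norm_U, Complex.norm_real, Real.norm_of_nonneg (Real.exp_nonneg _)]
    · refine Tendsto.const_smul ?_ _
      have : Continuous fun ε : ℝ => V.U (ε * t) ψ := (hV ψ).comp (by fun_prop)
      simpa [V.map_zero] using this.tendsto 0
  · have hE (z : ℂ) : (∫ t : ℝ, Complex.exp (-(t - z) ^ 2) • V.U (ε * t) ψ) =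
        Complex.exp (-z ^ 2) • ∫ t : ℝ, Complex.exp (2 * t * z - t ^ 2) • V.U (ε * t) ψ := by
      rw [← integral_smul]
      congr 1
      ext t
      rw [smul_smul, ← Complex.exp_add]
      ring_nf
    have hd := differentiable_integral_cexp_smul (hcont ε ψ) fun t => (V.norm_U (ε * t) ψ).le
    -- Translating the Gaussian by a real `s / ε` amounts to applying `V.U s`. Letting the
    -- translation parameter be complex gives the entire orbit.
    refine ⟨fun z => c • ∫ t : ℝ, Complex.exp (-(t - z / ε) ^ 2) • V.U (ε * t) ψ, ?_, ?_, ?_⟩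
    · simp only [hE]
      refine Differentiable.const_smul (Differentiable.smul (by fun_prop) ?_) _
      exact hd.comp (by fun_prop : Differentiable ℂ fun z : ℂ => z / ε)
    · rw [hG]
      simp
    · intro z s
      rw [map_smul, hUint]
      simp only [map_smul]
      rw [← integral_add_right_eq_self _ (s / ε)]
      have h1 (t : ℝ) : ((t + s / ε : ℝ) : ℂ) - (z + s) / ε = t - z / ε := by push_cast; ring
      have h2 (t : ℝ) : V.U (ε * (t + s / ε)) ψ = V.U s (V.U (ε * t) ψ) := by
        rw [← V.map_add]
        congr 2
        field_simp
        ring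
      simp only [h1, h2]

/-- Along an entire orbit, the derivative is `i` times the generator. -/
theorem generatorGraph_of_entire {Φ : ℂ → H} (hΦ : Differentiable ℂ Φ)
    (h : ∀ (z : ℂ) (s : ℝ), Φ (z + s) = V.U s (Φ z)) (z : ℂ) :
    V.GeneratorGraph (Φ z) (-Complex.I • deriv Φ z) := by
  have h1 : HasDerivAt (fun s : ℝ => Φ (z + s)) (deriv Φ z) 0 := by
    have h2 : HasDerivAt (fun s : ℝ => z + (s : ℂ)) 1 0 :=
      ((hasDerivAt_id (0 : ℝ)).ofReal_comp).const_add z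
    simpa [Function.comp_def] using (hΦ (z + ((0 : ℝ) : ℂ))).hasDerivAt.scomp (0 : ℝ) h2
  rw [GeneratorGraph, smul_smul]
  simpa [h] using h1

/-- If the generator is positive, the matrix elements `⟪φ, U_t ψ⟫` are boundary values of bounded
holomorphic functions in the upper half plane. -/
theorem PositiveGenerator.isBoundaryValue [CompleteSpace H] {V : UnitaryGroup H}
    (hV : V.StronglyContinuous) (hpos : V.PositiveGenerator) (φ ψ : H) :
    IsBoundaryValue openUpperHalfPlane fun z => ⟪φ, V.U z.re ψ⟫_ℂ := by
  obtain ⟨G, hGU, hG, hE⟩ := V.exists_entire_smoothing hV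
  refine IsBoundaryValue.of_forall_approx hasMaxPrinciple_openUpperHalfPlane fun ε hε => ?_
  obtain ⟨δ, hδ, hGδ⟩ : ∃ δ > 0, ‖ψ - G δ ψ‖ * ‖φ‖ ≤ ε := by
    have h1 : Tendsto (fun δ => ‖ψ - G δ ψ‖ * ‖φ‖) (𝓝[>] 0) (𝓝 0) := by
      have := ((tendsto_const_nhds (x := ψ)).sub (hG ψ)).norm.mul_const ‖φ‖
      simp only [sub_self, norm_zero, zero_mul] at this
      exact this.mono_left nhdsWithin_le_nhds
    obtain ⟨δ, h2, h3⟩ := ((h1.eventually (gt_mem_nhds hε)).and self_mem_nhdsWithin).exists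
    exact ⟨δ, h3, h2.le⟩
  obtain ⟨Φ, hΦ, hΦ0, hΦU⟩ := hE δ hδ ψ
  have hreal (s : ℝ) : Φ s = V.U s (G δ ψ) := by
    have := hΦU 0 s
    rwa [zero_add, hΦ0] at this
  -- With `U_t = e^{ith}` one has `Φ' = i h Φ`, so `d/dy ‖Φ(x + iy)‖² = -2 ⟪Φ, hΦ⟫ ≤ 0`.
  -- Monotonicity supplies the bound on the upper half plane.
  have hanti (x : ℝ) : Antitone fun y : ℝ => ‖Φ (x + y * Complex.I)‖ ^ 2 := by
    have hder (y : ℝ) : HasDerivAt (fun y : ℝ => Φ (x + y * Complex.I))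
        (Complex.I • deriv Φ (x + y * Complex.I)) y := by
      have h1 : HasDerivAt (fun y : ℝ => (x : ℂ) + y * Complex.I) Complex.I y := by
        simpa using (((hasDerivAt_id y).ofReal_comp).mul_const Complex.I).const_add (x : ℂ)
      exact (hΦ (x + y * Complex.I)).hasDerivAt.scomp y h1
    refine antitone_of_hasDerivAt_nonpos
      (f' := fun y => 2 * RCLike.re ⟪Φ (x + y * Complex.I),
        Complex.I • deriv Φ (x + y * Complex.I)⟫_ℂ) (fun y => ?_) fun y => ?_
    · have h1 := (hder y).inner ℂ (hder y)
      have h2 := Complex.reCLM.hasFDerivAt.comp_hasDerivAt y h1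
      refine (h2.congr_deriv ?_).congr_of_eventuallyEq (Eventually.of_forall fun t => ?_)
      · simp only [Complex.reCLM_apply, Complex.add_re]
        rw [← inner_conj_symm (Complex.I • _), Complex.conj_re]
        simp only [RCLike.re_to_complex]
        ring
      · exact (inner_self_eq_norm_sq (𝕜 := ℂ) _).symm
    · have h1 := hpos _ _ (V.generatorGraph_of_entire hΦ hΦU (x + y * Complex.I))
      have h2 := (Complex.nonneg_iff.1 h1).1
      rw [neg_smul, inner_neg_right, Complex.neg_re] at h2
      simp only [RCLike.re_to_complex]
      simp only [Pi.zero_apply]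
      linarith
  have hbd (z : ℂ) (hz : 0 ≤ z.im) : ‖Φ z‖ ≤ ‖G δ ψ‖ := by
    have h1 := hanti z.re hz
    simp only [Complex.re_add_im, Complex.ofReal_zero, zero_mul, add_zero] at h1
    rw [hreal, V.norm_U] at h1
    exact le_of_sq_le_sq h1 (norm_nonneg _)
  refine ⟨fun z => ⟪φ, V.U z.re (G δ ψ)⟫_ℂ, ⟨fun z => ⟪φ, Φ z⟫_ℂ, ?_, ⟨‖φ‖ * ‖G δ ψ‖, ?_⟩, ?_⟩, ?_⟩
  · exact ((innerSL ℂ φ).differentiable.comp hΦ).diffContOnCl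
  · intro z hz
    rw [closure_openUpperHalfPlane] at hz
    exact (norm_inner_le_norm _ _).trans (mul_le_mul_of_nonneg_left (hbd z hz) (norm_nonneg _))
  · intro z hz
    rw [frontier_openUpperHalfPlane] at hz
    have : z = (z.re : ℝ) := Complex.ext rfl (by simpa using hz)
    change ⟪φ, Φ z⟫_ℂ = ⟪φ, V.U z.re (G δ ψ)⟫_ℂ
    rw [← hreal, ← this]
  · intro z _
    rw [← inner_sub_right, ← map_sub]
    refine (norm_inner_le_norm _ _).trans ?_
    rwa [V.norm_U, mul_comm]

/-- If the matrix elements `⟪ψ, U_t ψ⟫` are boundary values of bounded holomorphic functions in the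
upper half plane, then the generator is positive. -/
theorem positiveGenerator_of_isBoundaryValue [CompleteSpace H] (hV : V.StronglyContinuous)
    (h : ∀ ψ, IsBoundaryValue openUpperHalfPlane fun z => ⟪ψ, V.U z.re ψ⟫_ℂ) :
    V.PositiveGenerator := by
  obtain ⟨G, hGU, hG, hE⟩ := V.exists_entire_smoothing hV
  intro ψ φ hψφ
  -- The generator is symmetric: differentiate the constant `⟪U_t ψ, U_t ψ⟫` at `t = 0`.
  have him : (⟪ψ, φ⟫_ℂ).im = 0 := by
    have h1 := hψφ.inner ℂ hψφ
    simp only [V.inner_U, V.map_zero] at h1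
    have h2 := h1.unique (hasDerivAt_const (0 : ℝ) ⟪ψ, ψ⟫_ℂ)
    rw [inner_smul_left, inner_smul_right, ← inner_conj_symm φ ψ] at h2
    have h3 := congrArg Complex.re h2
    rw [← inner_conj_symm ψ φ] at h3 ⊢
    simp only [Complex.conj_I, Complex.conj_conj, Complex.add_re, Complex.mul_re, Complex.I_re,
      Complex.I_im, Complex.neg_re, Complex.neg_im, Complex.conj_im, Complex.zero_re] at h3 ⊢
    linarith
  -- By the maximum principle `Re ⟪Gψ, Φ(iy)⟫` is at most `‖Gψ‖²` for `y ≥ 0`, with equality at `y =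
  -- 0`. Its derivative there is `-Re ⟪Gψ, Gφ⟫`, so a negative real part would violate the bound for
  -- small `y > 0`.
  have hsmooth (ε : ℝ) (hε : 0 < ε) : 0 ≤ (⟪G ε ψ, G ε φ⟫_ℂ).re := by
    obtain ⟨Φ, hΦ, hΦ0, hΦU⟩ := hE ε hε ψ
    have hreal (s : ℝ) : Φ s = V.U s (G ε ψ) := by
      have := hΦU 0 s
      rwa [zero_add, hΦ0] at this
    have hgen : HasDerivAt (fun t : ℝ => V.U t (G ε ψ)) (Complex.I • G ε φ) 0 := by
      have := ((G ε).restrictScalars ℝ).hasFDerivAt.comp_hasDerivAt (0 : ℝ) hψφ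
      simpa [Function.comp_def, ← hGU] using this
    have hgen' := V.generatorGraph_of_entire hΦ hΦU 0
    rw [hΦ0, GeneratorGraph, smul_smul] at hgen'
    have hderiv : deriv Φ 0 = Complex.I • G ε φ := by
      simpa using hgen'.unique hgen
    obtain ⟨F, hF, hB, hFu⟩ := h (G ε ψ)
    have hFΦ (z : ℂ) (hz : 0 ≤ z.im) : F z = ⟪G ε ψ, Φ z⟫_ℂ := by
      refine eqOn_upperHalfPlane hF (G := fun z => ⟪G ε ψ, Φ z⟫_ℂ)
        ((innerSL ℂ (G ε ψ)).differentiable.comp hΦ).diffContOnCl (fun t => ?_) z hz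
      rw [hFu t (by rw [frontier_openUpperHalfPlane]; simp), hreal]
      simp
    have hle (y : ℝ) (hy : 0 ≤ y) : (⟪G ε ψ, Φ (y * Complex.I)⟫_ℂ).re ≤ ‖G ε ψ‖ ^ 2 := by
      have h0 : 0 ≤ ((y : ℂ) * Complex.I).im := by simpa using hy
      rw [← hFΦ _ h0]
      refine (Complex.re_le_norm _).trans (hasMaxPrinciple_openUpperHalfPlane.norm_le F _ hF hB
        (fun z hz => ?_) _ (by rw [closure_openUpperHalfPlane]; exact h0))
      rw [hFu z hz, pow_two]
      exact (norm_inner_le_norm _ _).trans (by rw [V.norm_U])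
    have hder : HasDerivAt (fun y : ℝ => (⟪G ε ψ, Φ (y * Complex.I)⟫_ℂ).re)
        (-(⟪G ε ψ, G ε φ⟫_ℂ).re) 0 := by
      have h1 : HasDerivAt (fun y : ℝ => (y : ℂ) * Complex.I) Complex.I 0 := by
        simpa using ((hasDerivAt_id (0 : ℝ)).ofReal_comp).mul_const Complex.I
      have h2 : HasDerivAt (fun y : ℝ => Φ (y * Complex.I)) (Complex.I • deriv Φ 0) 0 := by
        have := (hΦ (((0 : ℝ) : ℂ) * Complex.I)).hasDerivAt.scomp (0 : ℝ) h1
        simpa [Function.comp_def] using this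
      have h3 := Complex.reCLM.hasFDerivAt.comp_hasDerivAt (0 : ℝ)
        (((innerSL ℂ (G ε ψ)).restrictScalars ℝ).hasFDerivAt.comp_hasDerivAt (0 : ℝ) h2)
      refine h3.congr_deriv ?_
      rw [hderiv, smul_smul, Complex.I_mul_I]
      simp
    by_contra hneg
    have hlt : 0 < -(⟪G ε ψ, G ε φ⟫_ℂ).re := by linarith
    have hmax : ∀ᶠ y : ℝ in 𝓝[>] 0, 0 < slope
        (fun y : ℝ => (⟪G ε ψ, Φ (y * Complex.I)⟫_ℂ).re) 0 y :=
      ((hasDerivAt_iff_tendsto_slope.1 hder).mono_left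
        (nhdsWithin_mono _ fun y hy => ne_of_gt hy)).eventually (lt_mem_nhds hlt)
    obtain ⟨y, hy, hy0⟩ := (hmax.and self_mem_nhdsWithin).exists
    have hy0 : 0 < y := hy0
    rw [slope_def_field, sub_zero, div_pos_iff_of_pos_right hy0] at hy
    have h4 := hle y hy0.le
    have h5 : (⟪G ε ψ, Φ (((0 : ℝ) : ℂ) * Complex.I)⟫_ℂ).re = ‖G ε ψ‖ ^ 2 := by
      simp only [Complex.ofReal_zero, zero_mul, hΦ0]
      exact inner_self_eq_norm_sq (𝕜 := ℂ) _
    linarith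
  refine Complex.nonneg_iff.2 ⟨?_, him.symm⟩
  have hlim : Tendsto (fun ε => (⟪G ε ψ, G ε φ⟫_ℂ).re) (𝓝[>] 0) (𝓝 (⟪ψ, φ⟫_ℂ).re) :=
    ((Complex.continuous_re.tendsto _).comp ((hG ψ).inner (hG φ))).mono_left nhdsWithin_le_nhds
  exact ge_of_tendsto hlim (by filter_upwards [self_mem_nhdsWithin] with ε hε using hsmooth ε hε)

/-- A unitary group is strongly continuous if it is weakly continuous. -/
theorem stronglyContinuous_of_weaklyContinuous
    (h : ∀ φ ψ, Continuous fun t => ⟪φ, V.U t ψ⟫_ℂ) : V.StronglyContinuous := by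
  intro ψ
  refine continuous_iff_continuousAt.2 fun t => ?_
  have hsq (s : ℝ) : ‖V.U s ψ - V.U t ψ‖ ^ 2 = 2 * ‖ψ‖ ^ 2 - 2 * (⟪V.U t ψ, V.U s ψ⟫_ℂ).re := by
    rw [@norm_sub_sq ℂ, V.norm_U, V.norm_U, ← inner_conj_symm, RCLike.conj_re,
      RCLike.re_to_complex]
    ring
  have hlim : Tendsto (fun s => ‖V.U s ψ - V.U t ψ‖ ^ 2) (𝓝 t) (𝓝 0) := by
    simp only [hsq]
    have h1 : Continuous fun s => 2 * ‖ψ‖ ^ 2 - 2 * (⟪V.U t ψ, V.U s ψ⟫_ℂ).re := by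
      have := h (V.U t ψ) ψ
      fun_prop
    convert h1.tendsto t using 2
    rw [← hsq]
    simp
  refine tendsto_iff_norm_sub_tendsto_zero.2 ?_
  simpa using hlim.sqrt

end UnitaryGroup

/-! ### States and their GNS-representations -/

section States

open Set Filter Topology

/-- Two total families of vectors with the same Gram matrix are related by a unitary operator. -/
theorem exists_linearIsometryEquiv_of_inner_eq {X : Type*} {H : Type v} [NormedAddCommGroup H]
    [InnerProductSpace ℂ H] [CompleteSpace H] {v w : X → H}
    (hv : DenseRange (Finsupp.linearCombination ℂ v))
    (hw : DenseRange (Finsupp.linearCombination ℂ w))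
    (h : ∀ x y, ⟪w x, w y⟫_ℂ = ⟪v x, v y⟫_ℂ) : ∃ U : H ≃ₗᵢ[ℂ] H, ∀ x, U (v x) = w x := by
  have hin (c d : X →₀ ℂ) : ⟪Finsupp.linearCombination ℂ w c, Finsupp.linearCombination ℂ w d⟫_ℂ =
      ⟪Finsupp.linearCombination ℂ v c, Finsupp.linearCombination ℂ v d⟫_ℂ := by
    simp only [Finsupp.linearCombination_apply, Finsupp.sum_inner, Finsupp.inner_sum,
      inner_smul_left, inner_smul_right, h]
  have hnorm (c : X →₀ ℂ) : ‖Finsupp.linearCombination ℂ w (LinearEquiv.refl ℂ _ c)‖ =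
      ‖Finsupp.linearCombination ℂ v c‖ := by
    rw [@norm_eq_sqrt_re_inner ℂ, @norm_eq_sqrt_re_inner ℂ, LinearEquiv.refl_apply, hin]
  refine ⟨LinearEquiv.extendOfIsometry (LinearEquiv.refl ℂ (X →₀ ℂ)) _ _ hv hw hnorm, fun x => ?_⟩
  have := LinearEquiv.extendOfIsometry_eq (LinearEquiv.refl ℂ (X →₀ ℂ)) _ _ hv hw hnorm
    (Finsupp.single x 1)
  simpa using this

variable {A : Type u} [CStarAlgebra A]

/-- Every state has a GNS-triple. -/
theorem nonempty_gnsTriple (ω : StateSpace A) : Nonempty (GNSTriple ω) := by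
  let _ : PartialOrder A := CStarAlgebra.spectralOrder A
  have _ : StarOrderedRing A := CStarAlgebra.spectralOrderedRing A
  have hnn (a : A) (ha : 0 ≤ a) : 0 ≤ ω.1 a := by
    obtain ⟨b, rfl⟩ := CStarAlgebra.nonneg_iff_eq_star_mul_self.1 ha
    exact ω.2.2 b
  let f : A →ₚ[ℂ] ℂ := PositiveLinearMap.mk₀ (ω.1 : A →L[ℂ] ℂ).toLinearMap hnn
  have hf (a : A) : f a = ω.1 a := rfl
  refine ⟨{ H := f.GNS, π := f.gnsStarAlgHom, Ω := ((f.toPreGNS 1 : f.PreGNS) : f.GNS),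
            cyclic := ?_, state_eq := fun a => ?_ }⟩
  · have h (a : A) : f.gnsStarAlgHom a ((f.toPreGNS 1 : f.PreGNS) : f.GNS) =
        ((f.toPreGNS a : f.PreGNS) : f.GNS) := by
      change f.gnsNonUnitalStarAlgHom a _ = _
      rw [PositiveLinearMap.gnsNonUnitalStarAlgHom_apply_coe]
      simp
    simp only [h]
    exact UniformSpace.Completion.denseRange_coe.comp
      f.toPreGNS.surjective.denseRange (UniformSpace.Completion.continuous_coe _)
  · have h : f.gnsStarAlgHom a ((f.toPreGNS 1 : f.PreGNS) : f.GNS) =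
        ((f.toPreGNS a : f.PreGNS) : f.GNS) := by
      change f.gnsNonUnitalStarAlgHom a _ = _
      rw [PositiveLinearMap.gnsNonUnitalStarAlgHom_apply_coe]
      simp
    rw [h, UniformSpace.Completion.inner_coe, PositiveLinearMap.preGNS_inner_def]
    simp [hf]

namespace GNSTriple

variable {ω : StateSpace A} (τ : GNSTriple ω)

theorem inner_π (a b : A) : ⟪τ.π a τ.Ω, τ.π b τ.Ω⟫_ℂ = ω.1 (star a * b) := by
  rw [τ.state_eq, map_mul, map_star, mul_apply_eq_comp,
    ContinuousLinearMap.star_eq_adjoint, ContinuousLinearMap.adjoint_inner_right]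

theorem π_one_Ω : τ.π 1 τ.Ω = τ.Ω := by simp

theorem norm_Ω : ‖τ.Ω‖ = 1 := by
  have h := τ.inner_π 1 1
  rw [π_one_Ω, star_one, one_mul, ω.2.1, inner_self_eq_norm_sq_to_K] at h
  have h' : ‖τ.Ω‖ ^ 2 = 1 := by
    have := congrArg Complex.re h
    simpa [← Complex.ofReal_pow] using this
  nlinarith [norm_nonneg τ.Ω]

end GNSTriple

theorem StateSpace.norm_apply_le (ω : StateSpace A) (a : A) : ‖ω.1 a‖ ≤ ‖a‖ := by
  obtain ⟨τ⟩ := nonempty_gnsTriple ω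
  rw [τ.state_eq]
  refine (norm_inner_le_norm _ _).trans ?_
  rw [τ.norm_Ω, one_mul]
  refine ((τ.π a).le_opNorm _).trans ?_
  rw [τ.norm_Ω, mul_one]
  exact NonUnitalStarAlgHom.norm_apply_le τ.π a

theorem StateSpace.apply_star (ω : StateSpace A) (a : A) :
    ω.1 (star a) = (starRingEnd ℂ) (ω.1 a) := by
  obtain ⟨τ⟩ := nonempty_gnsTriple ω
  have h1 := τ.inner_π a 1
  have h2 := τ.inner_π 1 a
  rw [mul_one] at h1
  rw [star_one, one_mul] at h2
  rw [← h1, ← h2, inner_conj_symm]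

theorem StateSpace.ext {ω₁ ω₂ : StateSpace A} (h : ∀ a, ω₁.1 a = ω₂.1 a) : ω₁ = ω₂ :=
  Subtype.ext (ContinuousLinearMap.ext h)

theorem StateSpace.continuous_apply (a : A) : Continuous fun ω : StateSpace A => ω.1 a :=
  (WeakDual.eval_continuous a).comp continuous_subtype_val

theorem norm_evol (α : AlgebraicDynamics A) (t : ℝ) (a : A) : ‖α.evol t a‖ ≤ ‖a‖ :=
  NonUnitalStarAlgHom.norm_apply_le (α.evol t) a

/-- An invariant state has a unitary implementation of the dynamics in its GNS-representation. -/
theorem GNSTriple.exists_implements {ω : StateSpace A} (τ : GNSTriple ω) (α : AlgebraicDynamics A)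
    (hω : IsEquilibriumState α ω) :
    ∃ V : UnitaryGroup τ.H, τ.Implements α V ∧
      ∀ t a, V.U t (τ.π a τ.Ω) = τ.π (α.evol t a) τ.Ω := by
  have hsurj (t : ℝ) : Function.Surjective (α.evol t) := (α.evol t).surjective
  have hlc (v : A → τ.H) (hv : DenseRange v) : DenseRange (Finsupp.linearCombination ℂ v) := by
    refine hv.mono ?_
    rintro _ ⟨a, rfl⟩
    exact ⟨Finsupp.single a 1, by simp⟩
  have hU (t : ℝ) : ∃ U : τ.H ≃ₗᵢ[ℂ] τ.H, ∀ a, U (τ.π a τ.Ω) = τ.π (α.evol t a) τ.Ω := by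
    refine exists_linearIsometryEquiv_of_inner_eq (v := fun a => τ.π a τ.Ω)
      (w := fun a => τ.π (α.evol t a) τ.Ω) (hlc _ τ.cyclic) (hlc _ ?_) fun a b => ?_
    · have := τ.cyclic
      rw [DenseRange, ← (hsurj t).range_comp] at this
      exact this
    · rw [τ.inner_π, τ.inner_π, ← map_star, ← map_mul, hω]
  choose U hU using hU
  have hext {f g : τ.H → τ.H} (hf : Continuous f) (hg : Continuous g)
      (h : ∀ a, f (τ.π a τ.Ω) = g (τ.π a τ.Ω)) (ψ : τ.H) : f ψ = g ψ :=
    congrFun (τ.cyclic.equalizer hf hg (funext h)) ψ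
  refine ⟨⟨U, ?_, ?_⟩, ⟨fun t => ?_, fun t a ψ => ?_⟩, hU⟩
  · exact hext (U 0).continuous continuous_id fun a => by rw [hU, α.evol_zero]
  · intro s t
    exact hext (U (s + t)).continuous ((U s).continuous.comp (U t).continuous) fun a => by
      rw [hU, hU, hU, α.evol_add]
  · change U t τ.Ω = τ.Ω
    have := hU t 1
    rwa [τ.π_one_Ω, map_one, τ.π_one_Ω] at this
  · refine hext ((τ.π (α.evol t a)).continuous.comp (U t).continuous)
      ((U t).continuous.comp (τ.π a).continuous) (fun b => ?_) ψ
    change τ.π (α.evol t a) (U t (τ.π b τ.Ω)) = U t (τ.π a (τ.π b τ.Ω))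
    rw [hU, ← mul_apply_eq_comp, ← mul_apply_eq_comp, ← map_mul,
      ← map_mul, ← map_mul, hU]

theorem GNSTriple.Implements.U_π {ω : StateSpace A} {τ : GNSTriple ω} {α : AlgebraicDynamics A}
    {V : UnitaryGroup τ.H} (h : τ.Implements α V) (t : ℝ) (a : A) :
    V.U t (τ.π a τ.Ω) = τ.π (α.evol t a) τ.Ω := by
  rw [← h.2, h.1]

/-- In a ground state, the correlation functions are boundary values of bounded holomorphic
functions in the upper half plane. -/
theorem isBoundaryValue_of_mem_groundStates {α : AlgebraicDynamics A} {ω : StateSpace A}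
    (hω : ω ∈ groundStates α) (a b : A) :
    IsBoundaryValue openUpperHalfPlane fun z => ω.1 (a * α.evol z.re b) := by
  obtain ⟨-, τ, V, hV, hc, hpos⟩ := hω
  refine (UnitaryGroup.PositiveGenerator.isBoundaryValue hc hpos (τ.π (star a) τ.Ω)
    (τ.π b τ.Ω)).congr fun z _ => ?_
  rw [hV.U_π, τ.inner_π, star_star]

/-- An invariant state is a ground state if its correlation functions are boundary values of bounded
holomorphic functions in the upper half plane. -/
theorem mem_groundStates_of_isBoundaryValue {α : AlgebraicDynamics A} {ω : StateSpace A}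
    (hω : IsEquilibriumState α ω)
    (h : ∀ a b, IsBoundaryValue openUpperHalfPlane fun z => ω.1 (a * α.evol z.re b)) :
    ω ∈ groundStates α := by
  obtain ⟨τ⟩ := nonempty_gnsTriple ω
  obtain ⟨V, hV, hU⟩ := τ.exists_implements α hω
  have hbv (φ ψ : τ.H) : IsBoundaryValue openUpperHalfPlane fun z => ⟪φ, V.U z.re ψ⟫_ℂ := by
    refine IsBoundaryValue.of_forall_approx hasMaxPrinciple_openUpperHalfPlane fun ε hε => ?_
    obtain ⟨a, b, hab⟩ : ∃ a b, ‖φ - τ.π a τ.Ω‖ * ‖ψ‖ + ‖τ.π a τ.Ω‖ * ‖ψ - τ.π b τ.Ω‖ ≤ ε := by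
      obtain ⟨a, ha⟩ := Metric.denseRange_iff.1 τ.cyclic φ (ε / 2 / (‖ψ‖ + 1)) (by positivity)
      obtain ⟨b, hb⟩ := Metric.denseRange_iff.1 τ.cyclic ψ (ε / 2 / (‖τ.π a τ.Ω‖ + 1))
        (by positivity)
      rw [dist_eq_norm] at ha hb
      refine ⟨a, b, ?_⟩
      have hψ := norm_nonneg ψ
      have hφ := norm_nonneg (τ.π a τ.Ω)
      rw [lt_div_iff₀ (by positivity)] at ha hb
      nlinarith [norm_nonneg (φ - τ.π a τ.Ω), norm_nonneg (ψ - τ.π b τ.Ω)]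
    refine ⟨_, h (star a) b, fun z _ => ?_⟩
    have e : ω.1 (star a * α.evol z.re b) = ⟪τ.π a τ.Ω, V.U z.re (τ.π b τ.Ω)⟫_ℂ := by
      rw [hU, τ.inner_π]
    have e' : ⟪φ, V.U z.re ψ⟫_ℂ - ⟪τ.π a τ.Ω, V.U z.re (τ.π b τ.Ω)⟫_ℂ =
        ⟪φ - τ.π a τ.Ω, V.U z.re ψ⟫_ℂ + ⟪τ.π a τ.Ω, V.U z.re (ψ - τ.π b τ.Ω)⟫_ℂ := by
      rw [map_sub, inner_sub_left, inner_sub_right]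
      ring
    rw [e, e']
    refine ((norm_add_le _ _).trans (add_le_add (norm_inner_le_norm _ _)
      (norm_inner_le_norm _ _))).trans ?_
    rwa [V.norm_U, V.norm_U]
  -- No continuity of the dynamics is assumed: weak continuity is read off from the continuous
  -- extension of the matrix elements to the real axis, and unitarity makes it strong.
  have hcont : V.StronglyContinuous := by
    refine V.stronglyContinuous_of_weaklyContinuous fun φ ψ => ?_
    obtain ⟨F, hF, -, hFu⟩ := hbv φ ψ
    have hFc := hF.continuousOn
    rw [closure_openUpperHalfPlane] at hFc
    rw [frontier_openUpperHalfPlane] at hFu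
    have := hFc.comp_continuous Complex.continuous_ofReal fun t => by simp
    refine this.congr fun t => ?_
    simpa using hFu t (by simp)
  exact ⟨hω, τ, V, hV, hcont, V.positiveGenerator_of_isBoundaryValue hcont fun ψ => hbv ψ ψ⟩

/-- The pair of functions `t ↦ ω (a α_t(b))` and `t ↦ ω (α_t(b) a)`, as a function on the boundary
of a strip. -/
noncomputable def kmsBoundary (α : AlgebraicDynamics A) (ω : StateSpace A) (a b : A) (z : ℂ) : ℂ :=
  open Classical in
  if z.im = 0 then ω.1 (a * α.evol z.re b) else ω.1 (α.evol z.re b * a)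

/-- Both KMS boundary conditions become one function on the frontier of the strip. This is
consistent because `β > 0` keeps the two edges apart. Ground and KMS states can then be handled by
the same arguments. -/
theorem mem_kmsStates_iff {α : AlgebraicDynamics A} {β : ℝ} (hβ : 0 < β) {ω : StateSpace A} :
    ω ∈ kmsStates α β ↔ ∀ a b, IsBoundaryValue (openStrip β) (kmsBoundary α ω a b) := by
  have hset : {z : ℂ | 0 ≤ z.im ∧ z.im ≤ β} = closure (openStrip β) :=
    (closure_openStrip hβ).symm
  refine forall₂_congr fun a b => exists_congr fun F => ?_
  rw [hset]
  constructor
  · rintro ⟨hd, hc, ⟨C, hC⟩, hF⟩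
    refine ⟨⟨hd, hc⟩, ⟨C, fun z hz => ?_⟩, fun z hz => ?_⟩
    · rw [← hset] at hz
      exact hC z hz.1 hz.2
    · rw [frontier_openStrip hβ] at hz
      rw [kmsBoundary]
      rcases hz with hz | hz
      · rw [if_pos hz, ← (hF z.re).1]
        congr 1
        exact Complex.ext rfl (by simpa using hz)
      · rw [if_neg (by rw [hz]; exact hβ.ne'), ← (hF z.re).2]
        congr 1
        exact Complex.ext (by simp) (by simpa using hz)
  · rintro ⟨hd, ⟨C, hC⟩, hF⟩
    refine ⟨hd.differentiableOn, hd.continuousOn, ⟨C, fun z h0 h1 => hC z ?_⟩, fun t => ⟨?_, ?_⟩⟩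
    · rw [← hset]
      exact ⟨h0, h1⟩
    · rw [hF _ (by rw [frontier_openStrip hβ]; simp), kmsBoundary]
      simp
    · rw [hF _ (by rw [frontier_openStrip hβ]; simp), kmsBoundary]
      simp [hβ.ne']

/-- An equivalence of bilinear boundary conditions extends from total sets to the whole algebra. -/
theorem isBoundaryValue_of_dense_span {R : Set ℂ} (hR : HasMaxPrinciple R) {S : Set A}
    (hS : Dense (Submodule.span ℂ S : Set A)) {u : A → A → ℂ → ℂ}
    (hadd₁ : ∀ a a' b z, u (a + a') b z = u a b z + u a' b z)
    (hsmul₁ : ∀ (c : ℂ) a b z, u (c • a) b z = c * u a b z)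
    (hadd₂ : ∀ a b b' z, u a (b + b') z = u a b z + u a b' z)
    (hsmul₂ : ∀ (c : ℂ) a b z, u a (c • b) z = c * u a b z)
    (hnorm : ∀ a b z, ‖u a b z‖ ≤ ‖a‖ * ‖b‖)
    (h : ∀ a ∈ S, ∀ b ∈ S, IsBoundaryValue R (u a b)) (a b : A) : IsBoundaryValue R (u a b) := by
  have hz₁ (b z) : u 0 b z = 0 := by simpa using hsmul₁ 0 0 b z
  have hz₂ (a z) : u a 0 z = 0 := by simpa using hsmul₂ 0 a 0 z
  have h1 (a) (ha : a ∈ S) (b) (hb : b ∈ Submodule.span ℂ S) : IsBoundaryValue R (u a b) := by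
    induction hb using Submodule.span_induction with
    | mem b hb => exact h a ha b hb
    | zero => exact (IsBoundaryValue.const R 0).congr fun z _ => (hz₂ a z).symm
    | add b b' _ _ hb hb' => exact (hb.add hb').congr fun z _ => (hadd₂ a b b' z).symm
    | smul c b _ hb => exact (hb.const_mul c).congr fun z _ => (hsmul₂ c a b z).symm
  have h2 (a) (ha : a ∈ Submodule.span ℂ S) (b) (hb : b ∈ Submodule.span ℂ S) :
      IsBoundaryValue R (u a b) := by
    induction ha using Submodule.span_induction with
    | mem a ha => exact h1 a ha b hb
    | zero => exact (IsBoundaryValue.const R 0).congr fun z _ => (hz₁ b z).symm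
    | add a a' _ _ ha ha' => exact (ha.add ha').congr fun z _ => (hadd₁ a a' b z).symm
    | smul c a _ ha => exact (ha.const_mul c).congr fun z _ => (hsmul₁ c a b z).symm
  refine IsBoundaryValue.of_forall_approx hR fun ε hε => ?_
  obtain ⟨a', ha', hab⟩ := Metric.dense_iff.1 hS a (ε / 2 / (‖b‖ + 1)) (by positivity)
  obtain ⟨b', hb', hbb⟩ := Metric.dense_iff.1 hS b (ε / 2 / (‖a'‖ + 1)) (by positivity)
  refine ⟨u a' b', h2 a' hab b' hbb, fun z _ => ?_⟩
  have e₁ : u a b z = u (a - a') b z + u a' b z := by rw [← hadd₁, sub_add_cancel]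
  have e₂ : u a' b z = u a' (b - b') z + u a' b' z := by rw [← hadd₂, sub_add_cancel]
  have e : u a b z - u a' b' z = u (a - a') b z + u a' (b - b') z := by rw [e₁, e₂]; ring
  rw [e]
  refine ((norm_add_le _ _).trans (add_le_add (hnorm _ _ _) (hnorm _ _ _))).trans ?_
  rw [Metric.mem_ball, dist_comm, dist_eq_norm, lt_div_iff₀ (by positivity)] at ha' hb'
  nlinarith [norm_nonneg (a - a'), norm_nonneg (b - b'), norm_nonneg a', norm_nonneg b]

theorem mem_kmsStates_of_dense_span {α : AlgebraicDynamics A} {β : ℝ} (hβ : 0 < β)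
    {ω : StateSpace A} {S : Set A} (hS : Dense (Submodule.span ℂ S : Set A))
    (h : ∀ a ∈ S, ∀ b ∈ S, IsBoundaryValue (openStrip β) (kmsBoundary α ω a b)) :
    ω ∈ kmsStates α β := by
  rw [mem_kmsStates_iff hβ]
  refine isBoundaryValue_of_dense_span (hasMaxPrinciple_openStrip hβ) hS ?_ ?_ ?_ ?_ ?_ h
  · intro a a' b z
    by_cases hz : z.im = 0 <;> simp [kmsBoundary, hz, add_mul, mul_add]
  · intro c a b z
    by_cases hz : z.im = 0 <;> simp [kmsBoundary, hz]
  · intro a b b' z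
    by_cases hz : z.im = 0 <;> simp [kmsBoundary, hz, add_mul, mul_add]
  · intro c a b z
    by_cases hz : z.im = 0 <;> simp [kmsBoundary, hz]
  · intro a b z
    have h1 := mul_le_mul_of_nonneg_left (norm_evol α z.re b) (norm_nonneg a)
    by_cases hz : z.im = 0
    · rw [kmsBoundary, if_pos hz]
      exact ((ω.norm_apply_le _).trans (norm_mul_le _ _)).trans h1
    · rw [kmsBoundary, if_neg hz]
      exact ((ω.norm_apply_le _).trans (norm_mul_le _ _)).trans ((mul_comm _ _).trans_le h1)

theorem mem_groundStates_of_dense_span {α : AlgebraicDynamics A} {ω : StateSpace A} {S : Set A}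
    (hω : IsEquilibriumState α ω) (hS : Dense (Submodule.span ℂ S : Set A))
    (h : ∀ a ∈ S, ∀ b ∈ S,
      IsBoundaryValue openUpperHalfPlane fun z => ω.1 (a * α.evol z.re b)) :
    ω ∈ groundStates α := by
  refine mem_groundStates_of_isBoundaryValue hω ?_
  refine isBoundaryValue_of_dense_span (u := fun a b z => ω.1 (a * α.evol z.re b))
    hasMaxPrinciple_openUpperHalfPlane hS ?_ ?_ ?_ ?_ ?_ h
  · intro a a' b z
    simp [add_mul]
  · intro c a b z
    simp
  · intro a b b' z
    simp [mul_add]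
  · intro c a b z
    simp
  · intro a b z
    exact ((ω.norm_apply_le _).trans (norm_mul_le _ _)).trans
      (mul_le_mul_of_nonneg_left (norm_evol α z.re b) (norm_nonneg a))

end States

/-! ### States of the Weyl C*-algebra -/

section WeylStates

open Set Filter Topology

variable {L : Type u} [AddCommGroup L] [Module ℝ L]

theorem WeylSystem.W_zero {σ : LinearMap.BilinForm ℝ L} (i : WeylSystem σ) :
    (i.W 0 : i.H →L[ℂ] i.H) = 1 := by
  have h := i.W_mul 0 0
  simp only [map_zero, Complex.ofReal_zero, mul_zero, Complex.exp_zero, one_smul, add_zero] at h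
  calc (i.W 0 : i.H →L[ℂ] i.H) = star (i.W 0 : i.H →L[ℂ] i.H) * (i.W 0 * i.W 0) := by
        rw [← mul_assoc, Unitary.coe_star_mul_self, one_mul]
    _ = 1 := by rw [h, Unitary.coe_star_mul_self]

theorem weyl_zero (σ : LinearMap.BilinForm ℝ L) : weyl σ 0 = 1 := by
  apply Subtype.ext
  apply lp.ext
  funext i
  exact i.W_zero

theorem star_weyl_mul_weyl {σ : LinearMap.BilinForm ℝ L} (f g : L) :
    star (weyl σ f) * weyl σ g =
      Complex.exp (Complex.I / 2 * (σ f g : ℂ)) • weyl σ (g - f) := by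
  rw [star_weyl, weyl_mul, neg_add_eq_sub, map_neg, LinearMap.neg_apply, Complex.ofReal_neg]
  ring_nf

/-- The Weyl operators span a dense subspace of the Weyl C*-algebra. -/
theorem dense_span_weyl (σ : LinearMap.BilinForm ℝ L) :
    Dense (Submodule.span ℂ (range (weyl σ)) : Set (WeylAlgebra σ)) := by
  -- By the Weyl relations this span already contains `1` and is closed under products and adjoints,
  -- so it contains the generated *-algebra.
  set M := Submodule.span ℂ (range (weylAmbientGen σ)) with hM
  have hgen_mul (f g : L) : weylAmbientGen σ f * weylAmbientGen σ g ∈ M := by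
    have h : weylAmbientGen σ f * weylAmbientGen σ g =
        Complex.exp (-Complex.I / 2 * (σ f g : ℂ)) • weylAmbientGen σ (f + g) :=
      congrArg Subtype.val (weyl_mul σ f g)
    rw [h]
    exact M.smul_mem _ (Submodule.subset_span ⟨_, rfl⟩)
  have hone : (1 : WeylAmbient σ) ∈ M := by
    have h : weylAmbientGen σ 0 = 1 := congrArg Subtype.val (weyl_zero σ)
    rw [← h]
    exact Submodule.subset_span ⟨_, rfl⟩
  have hmul (a b : WeylAmbient σ) (ha : a ∈ M) (hb : b ∈ M) : a * b ∈ M := by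
    induction ha, hb using Submodule.span_induction₂ with
    | mem_mem x y hx hy =>
      obtain ⟨f, rfl⟩ := hx
      obtain ⟨g, rfl⟩ := hy
      exact hgen_mul f g
    | zero_left y hy => simp
    | zero_right x hx => simp
    | add_left x y z _ _ _ h1 h2 => rw [add_mul]; exact M.add_mem h1 h2
    | add_right x y z _ _ _ h1 h2 => rw [mul_add]; exact M.add_mem h1 h2
    | smul_left r x y _ _ h => rw [smul_mul_assoc]; exact M.smul_mem _ h
    | smul_right r x y _ _ h => rw [mul_smul_comm]; exact M.smul_mem _ h
  have hstar (a : WeylAmbient σ) (ha : a ∈ M) : star a ∈ M := by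
    induction ha using Submodule.span_induction with
    | mem x hx =>
      obtain ⟨f, rfl⟩ := hx
      have h : star (weylAmbientGen σ f) = weylAmbientGen σ (-f) :=
        congrArg Subtype.val (star_weyl σ f)
      rw [h]
      exact Submodule.subset_span ⟨_, rfl⟩
    | zero => simp
    | add x y _ _ hx hy => rw [star_add]; exact M.add_mem hx hy
    | smul c x _ hx => rw [star_smul]; exact M.smul_mem _ hx
  have hadj (a : WeylAmbient σ) (ha : a ∈ StarAlgebra.adjoin ℂ (range (weylAmbientGen σ))) :
      a ∈ M := by
    induction ha using StarAlgebra.adjoin_induction with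
    | mem x hx => exact Submodule.subset_span hx
    | algebraMap r => rw [Algebra.algebraMap_eq_smul_one]; exact M.smul_mem _ hone
    | add x y _ _ hx hy => exact M.add_mem hx hy
    | mul x y _ _ hx hy => exact hmul x y hx hy
    | star x _ hx => exact hstar x hx
  intro a
  have himg (b : WeylAmbient σ) (hb : b ∈ M) :
      ∃ x ∈ Submodule.span ℂ (range (weyl σ)), x.1 = b := by
    induction hb using Submodule.span_induction with
    | mem x hx =>
      obtain ⟨f, rfl⟩ := hx
      exact ⟨weyl σ f, Submodule.subset_span ⟨f, rfl⟩, rfl⟩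
    | zero => exact ⟨0, Submodule.zero_mem _, rfl⟩
    | add x y _ _ hx hy =>
      obtain ⟨x, hx, rfl⟩ := hx
      obtain ⟨y, hy, rfl⟩ := hy
      exact ⟨x + y, Submodule.add_mem _ hx hy, rfl⟩
    | smul c x _ hx =>
      obtain ⟨x, hx, rfl⟩ := hx
      exact ⟨c • x, Submodule.smul_mem _ c hx, rfl⟩
  let S : Set (weylSubalgebra σ) :=
    (Submodule.span ℂ (range (weyl σ)) : Set (WeylAlgebra σ))
  have h : (a.1 : WeylAmbient σ) ∈ closure (Subtype.val '' S) :=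
    closure_mono (fun b hb => himg b (hadj b hb)) a.2
  exact closure_subtype.2 h

/-- A closed condition on elements of the Weyl C*-algebra follows from the case of Weyl
operators. -/
theorem weyl_induction {σ : LinearMap.BilinForm ℝ L} {p : WeylAlgebra σ → Prop}
    (weyl : ∀ f, p (weyl σ f)) (add : ∀ a b, p a → p b → p (a + b))
    (smul : ∀ (c : ℂ) a, p a → p (c • a)) (closed : IsClosed {a | p a}) (a : WeylAlgebra σ) :
    p a := by
  refine (dense_span_weyl σ).induction (fun a ha => ?_) closed a
  induction ha using Submodule.span_induction with
  | mem x hx =>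
    obtain ⟨f, rfl⟩ := hx
    exact weyl f
  | zero => simpa using smul 0 _ (weyl 0)
  | add x y _ _ hx hy => exact add x y hx hy
  | smul c x _ hx => exact smul c x hx

section

variable {σ : LinearMap.BilinForm ℝ L}

theorem weylState_ext {ω₁ ω₂ : StateSpace (WeylAlgebra σ)}
    (h : ∀ f, ω₁.1 (weyl σ f) = ω₂.1 (weyl σ f)) : ω₁ = ω₂ := by
  refine StateSpace.ext (weyl_induction h (fun a b ha hb => ?_) (fun c a ha => ?_) ?_)
  · rw [map_add, map_add, ha, hb]
  · rw [map_smul, map_smul, ha]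
  · exact isClosed_eq (ω₁.1 : WeylAlgebra σ →L[ℂ] ℂ).continuous
      (ω₂.1 : WeylAlgebra σ →L[ℂ] ℂ).continuous

/-- Weak*-continuity of a family of states can be tested on Weyl operators. -/
theorem continuous_weylState {X : Type*} [TopologicalSpace X]
    {s : X → StateSpace (WeylAlgebra σ)} (h : ∀ f, Continuous fun x => (s x).1 (weyl σ f)) :
    Continuous s := by
  refine Continuous.subtype_mk (WeakDual.continuous_of_continuous_eval fun a => ?_) _
  have key : ∀ a : WeylAlgebra σ, Continuous fun x => (s x).1 a := by
    refine weyl_induction h (fun a b ha hb => ?_) (fun c a ha => ?_) ?_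
    · simp only [map_add]
      exact ha.add hb
    · simp only [map_smul]
      exact ha.const_smul c
    · refine isClosed_of_closure_subset fun a ha => ?_
      -- States are contractive, so approximating `a` in norm approximates its expectation values
      -- uniformly in `x`.
      refine continuous_of_uniform_approx_of_continuous fun V hV => ?_
      obtain ⟨ε, hε, hεV⟩ := Metric.mem_uniformity_dist.1 hV
      obtain ⟨b, hb, hab⟩ := Metric.mem_closure_iff.1 ha ε hε
      refine ⟨fun x => (s x).1 b, hb, fun x => hεV ?_⟩
      rw [dist_eq_norm, ← map_sub]
      rw [dist_eq_norm] at hab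
      exact ((s x).norm_apply_le _).trans_lt hab
  exact key a

theorem affine_of_weyl {ω ω₁ ω₂ : StateSpace (WeylAlgebra σ)} {t : ℂ} {r : ℂ}
    (h : ∀ f, ω.1 (weyl σ f) = t * ω₁.1 (weyl σ f) + r * ω₂.1 (weyl σ f))
    (a : WeylAlgebra σ) : ω.1 a = t * ω₁.1 a + r * ω₂.1 a := by
  refine weyl_induction (p := fun a => ω.1 a = t * ω₁.1 a + r * ω₂.1 a) h (fun a b ha hb => ?_)
    (fun c a ha => ?_) ?_ a
  · simp only [map_add, ha, hb]
    ring
  · simp only [map_smul, ha, smul_eq_mul]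
    ring
  · have h0 := (ω.1 : WeylAlgebra σ →L[ℂ] ℂ).continuous
    have h1 := (ω₁.1 : WeylAlgebra σ →L[ℂ] ℂ).continuous
    have h2 := (ω₂.1 : WeylAlgebra σ →L[ℂ] ℂ).continuous
    exact isClosed_eq h0 ((continuous_const.mul h1).add (continuous_const.mul h2))

/-- The kernel `ω(W(f)* W(g))` of a functional with `ω(W(f)) = χ(f)`. -/
noncomputable def weylKernel (σ : LinearMap.BilinForm ℝ L) (χ : L → ℂ) : Matrix L L ℂ :=
  Matrix.of fun f g => Complex.exp (Complex.I / 2 * (σ f g : ℂ)) * χ (g - f)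

theorem weylKernel_apply (χ : L → ℂ) (f g : L) :
    weylKernel σ χ f g = Complex.exp (Complex.I / 2 * (σ f g : ℂ)) * χ (g - f) := rfl

theorem apply_star_weyl_mul_weyl (ω : StateSpace (WeylAlgebra σ)) (f g : L) :
    ω.1 (star (weyl σ f) * weyl σ g) = weylKernel σ (fun f => ω.1 (weyl σ f)) f g := by
  rw [star_weyl_mul_weyl, map_smul, smul_eq_mul, weylKernel_apply]

/-- The quadratic form of the kernel at `x` is `ω(a* a)` with `a = ∑ x_f W(f)`. -/
theorem posSemidef_weylKernel (ω : StateSpace (WeylAlgebra σ)) :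
    (weylKernel σ fun f => ω.1 (weyl σ f)).PosSemidef := by
  refine ⟨Matrix.ext fun f g => ?_, fun x => ?_⟩
  · rw [Matrix.conjTranspose_apply, ← apply_star_weyl_mul_weyl, ← apply_star_weyl_mul_weyl,
      ← starRingEnd_apply, ← ω.apply_star, star_mul, star_star]
  · have h := ω.2.2 (x.sum fun f a => a • weyl σ f)
    have e : ω.1 (star (x.sum fun f a => a • weyl σ f) * x.sum fun f a => a • weyl σ f) =
        x.sum fun f a => x.sum fun g b =>
          star a * weylKernel σ (fun f => ω.1 (weyl σ f)) f g * b := by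
      simp only [Finsupp.sum, star_sum, Finset.sum_mul_sum, map_sum]
      refine Finset.sum_congr rfl fun f _ => Finset.sum_congr rfl fun g _ => ?_
      rw [star_smul, smul_mul_smul_comm, map_smul, apply_star_weyl_mul_weyl, smul_eq_mul]
      ring
    rwa [e] at h

theorem apply_weyl_neg (ω : StateSpace (WeylAlgebra σ)) (f : L) :
    ω.1 (weyl σ (-f)) = (starRingEnd ℂ) (ω.1 (weyl σ f)) := by
  rw [← star_weyl, ω.apply_star]

theorem apply_weyl_zero (ω : StateSpace (WeylAlgebra σ)) : ω.1 (weyl σ 0) = 1 := by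
  rw [weyl_zero, ω.2.1]

/-- A positive semidefinite kernel is the Gram matrix of a total family in a Hilbert space. -/
theorem exists_inner_eq_of_posSemidef {X : Type u} {k : Matrix X X ℂ} (hk : k.PosSemidef) :
    ∃ (H : Type u) (_ : NormedAddCommGroup H) (_ : InnerProductSpace ℂ H) (_ : CompleteSpace H)
      (v : X → H), DenseRange (Finsupp.linearCombination ℂ v) ∧ ∀ x y, ⟪v x, v y⟫_ℂ = k x y := by
  let core : PreInnerProductSpace.Core ℂ (X →₀ ℂ) :=
    { inner := fun c d => c.sum fun x a => d.sum fun y b => star a * k x y * b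
      conj_inner_symm := fun c d => by
        simp only [Finsupp.sum, map_sum]
        rw [Finset.sum_comm]
        refine Finset.sum_congr rfl fun x _ => Finset.sum_congr rfl fun y _ => ?_
        rw [map_mul, map_mul, ← starRingEnd_apply, ← starRingEnd_apply, Complex.conj_conj,
          starRingEnd_apply (k y x), hk.1.apply]
        ring
      re_inner_nonneg := fun c => (RCLike.nonneg_iff.1 (hk.2 c)).1
      add_left := fun c d e => by
        rw [Finsupp.sum_add_index' (by simp)]
        intro x a b
        simp only [star_add, add_mul, Finsupp.sum_add]
      smul_left := fun c d r => by
        rw [Finsupp.sum_smul_index' (by simp), Finsupp.mul_sum]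
        refine Finsupp.sum_congr fun x _ => ?_
        rw [Finsupp.mul_sum]
        refine Finsupp.sum_congr fun y _ => ?_
        simp only [smul_eq_mul, star_mul, starRingEnd_apply]
        ring }
  let _ : SeminormedAddCommGroup (X →₀ ℂ) := InnerProductSpace.Core.toSeminormedAddCommGroup (c := core)
  let _ : InnerProductSpace ℂ (X →₀ ℂ) := InnerProductSpace.ofCore core
  -- Completing the seminormed space also divides out the null vectors of the kernel.
  refine ⟨UniformSpace.Completion (X →₀ ℂ), inferInstance, inferInstance, inferInstance,
    fun x => ((Finsupp.single x 1 : X →₀ ℂ) : UniformSpace.Completion (X →₀ ℂ)), ?_, fun x y => ?_⟩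
  · have h : ⇑(Finsupp.linearCombination ℂ fun x : X =>
        ((Finsupp.single x 1 : X →₀ ℂ) : UniformSpace.Completion (X →₀ ℂ))) =
        fun c => ((c : X →₀ ℂ) : UniformSpace.Completion (X →₀ ℂ)) := by
      have h' : Finsupp.linearCombination ℂ (fun x : X =>
          ((Finsupp.single x 1 : X →₀ ℂ) : UniformSpace.Completion (X →₀ ℂ))) =
          (UniformSpace.Completion.toComplL (𝕜 := ℂ) (E := X →₀ ℂ)).toLinearMap :=
        Finsupp.lhom_ext' fun x => LinearMap.ext_ring (by simp)
      rw [h']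
      rfl
    rw [h]
    exact UniformSpace.Completion.denseRange_coe
  · rw [UniformSpace.Completion.inner_coe]
    change (Finsupp.single x (1 : ℂ)).sum (fun x a => (Finsupp.single y (1 : ℂ)).sum
      fun y b => star a * k x y * b) = _
    simp

/-- The representation of the Weyl C*-algebra defined by a Weyl system. -/
def WeylSystem.rep (i : WeylSystem σ) : WeylAlgebra σ →⋆ₐ[ℂ] (i.H →L[ℂ] i.H) where
  toFun a := a.1 i
  map_one' := rfl
  map_mul' _ _ := rfl
  map_zero' := rfl
  map_add' _ _ := rfl
  commutes' _ := rfl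
  map_star' _ := rfl

/-- Vector states of the representation defined by a Weyl system. -/
theorem WeylSystem.exists_vectorState (i : WeylSystem σ) (Ω : i.H) (hΩ : ‖Ω‖ = 1) :
    ∃ ω : StateSpace (WeylAlgebra σ), ∀ f,
      ω.1 (weyl σ f) = ⟪Ω, (i.W f : i.H →L[ℂ] i.H) Ω⟫_ℂ := by
  let ℓ : WeylAlgebra σ →ₗ[ℂ] ℂ :=
    { toFun := fun a => ⟪Ω, i.rep a Ω⟫_ℂ
      map_add' := fun a b => by rw [map_add, add_apply, inner_add_right]
      map_smul' := fun c a => by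
        rw [map_smul, smul_apply, inner_smul_right]; rfl }
  have hℓ (a : WeylAlgebra σ) : ‖ℓ a‖ ≤ 1 * ‖a‖ := by
    refine (norm_inner_le_norm _ _).trans ?_
    rw [hΩ]
    refine mul_le_mul_of_nonneg_left (((i.rep a).le_opNorm _).trans ?_) zero_le_one
    rw [hΩ, mul_one]
    exact NonUnitalStarAlgHom.norm_apply_le i.rep a
  refine ⟨⟨StrongDual.toWeakDual (ℓ.mkContinuous 1 hℓ), ?_, fun a => ?_⟩, fun f => rfl⟩
  · change ⟪Ω, i.rep 1 Ω⟫_ℂ = 1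
    rw [map_one, one_apply_eq_self, inner_self_eq_norm_sq_to_K, hΩ]
    simp
  · change 0 ≤ ⟪Ω, i.rep (star a * a) Ω⟫_ℂ
    rw [map_mul, map_star, mul_apply_eq_comp, ContinuousLinearMap.star_eq_adjoint,
      ContinuousLinearMap.adjoint_inner_right, inner_self_eq_norm_sq_to_K]
    have h := Complex.zero_le_real.2 (sq_nonneg ‖i.rep a Ω‖)
    rwa [Complex.ofReal_pow] at h

/-- A normalised function on `L` whose Weyl kernel is positive semidefinite defines a state. -/
theorem exists_weylState (hσ : σ.IsAlt) {χ : L → ℂ} (h0 : χ 0 = 1)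
    (hχ : (weylKernel σ χ).PosSemidef) :
    ∃ ω : StateSpace (WeylAlgebra σ), ∀ f, ω.1 (weyl σ f) = χ f := by
  obtain ⟨H, _, _, _, v, hv, hvk⟩ := exists_inner_eq_of_posSemidef hχ
  have hanti (f g : L) : σ g f = -σ f g := (hσ.neg_eq f g).symm
  -- If `v g` is to be `W(g)Ω`, the Weyl relations force `W(f) v g = w f g`. The Gram matrix of `w
  -- f` agrees with that of `v`, so this prescription defines a unitary.
  set w : L → L → H := fun f g => Complex.exp (-Complex.I / 2 * (σ f g : ℂ)) • v (f + g) with hw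
  have hww (f f' g : L) : Complex.exp (-Complex.I / 2 * (σ f' g : ℂ)) • w f (f' + g) =
      Complex.exp (-Complex.I / 2 * (σ f f' : ℂ)) • w (f + f') g := by
    simp only [hw, smul_smul, ← Complex.exp_add, map_add, LinearMap.add_apply, Complex.ofReal_add,
      add_assoc]
    ring_nf
  have hinner (f g g' : L) : ⟪w f g, w f g'⟫_ℂ = ⟪v g, v g'⟫_ℂ := by
    simp only [hw, inner_smul_left, inner_smul_right, hvk, weylKernel_apply, ← Complex.exp_conj,
      ← mul_assoc, ← Complex.exp_add, add_sub_add_left_eq_sub, map_add, LinearMap.add_apply,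
      hanti f g, hσ f, map_mul, map_div₀, map_neg, Complex.conj_I, Complex.conj_ofReal, map_ofNat]
    congr 2
    push_cast
    ring
  have hwdense (f : L) : DenseRange (Finsupp.linearCombination ℂ (w f)) := by
    refine hv.mono ?_
    rintro _ ⟨c, rfl⟩
    induction c using Finsupp.induction_linear with
    | zero => exact ⟨0, by simp⟩
    | add c d hc hd =>
      obtain ⟨c', hc⟩ := hc
      obtain ⟨d', hd⟩ := hd
      exact ⟨c' + d', by rw [map_add, map_add, hc, hd]⟩
    | single g a =>
      -- `w f (g - f)` equals `v g` up to a phase, which the coefficient undoes.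
      refine ⟨Finsupp.single (g - f) (a * Complex.exp (Complex.I / 2 * (σ f (g - f) : ℂ))), ?_⟩
      rw [Finsupp.linearCombination_single, Finsupp.linearCombination_single]
      simp only [hw]
      rw [smul_smul, mul_assoc, ← Complex.exp_add, add_sub_cancel]
      ring_nf
      simp
  choose U hU using fun f => exists_linearIsometryEquiv_of_inner_eq hv (hwdense f) (hinner f)
  have hext {S T : H →L[ℂ] H} (h : ∀ g, S (v g) = T (v g)) : S = T := by
    refine ContinuousLinearMap.ext fun ψ => congrFun (hv.equalizer S.continuous T.continuous ?_) ψ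
    funext c
    simp only [Function.comp_apply, Finsupp.linearCombination_apply, Finsupp.sum, map_sum, map_smul,
      h]
  have hmul (f f' : L) : ((U f).toContinuousLinearEquiv : H →L[ℂ] H) *
      ((U f').toContinuousLinearEquiv : H →L[ℂ] H) =
      Complex.exp (-Complex.I / 2 * (σ f f' : ℂ)) •
        ((U (f + f')).toContinuousLinearEquiv : H →L[ℂ] H) := by
    refine hext fun g => ?_
    change U f (U f' (v g)) = Complex.exp (-Complex.I / 2 * (σ f f' : ℂ)) • U (f + f') (v g)
    rw [hU, hU]
    simp only [hw]
    rw [map_smul, hU]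
    exact hww f f' g
  have hzero : ((U 0).toContinuousLinearEquiv : H →L[ℂ] H) = 1 := by
    refine hext fun g => ?_
    change U 0 (v g) = v g
    rw [hU]
    simp [hw]
  have hadj (f : L) : star ((U f).toContinuousLinearEquiv : H →L[ℂ] H) =
      ((U (-f)).toContinuousLinearEquiv : H →L[ℂ] H) := by
    have h1 : star ((U f).toContinuousLinearEquiv : H →L[ℂ] H) *
        ((U f).toContinuousLinearEquiv : H →L[ℂ] H) = 1 := by
      refine ContinuousLinearMap.ext fun ψ => ext_inner_left ℂ fun φ => ?_
      rw [mul_apply_eq_comp, ContinuousLinearMap.star_eq_adjoint,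
        ContinuousLinearMap.adjoint_inner_right]
      exact (U f).inner_map_map φ ψ
    have h2 : ((U f).toContinuousLinearEquiv : H →L[ℂ] H) *
        ((U (-f)).toContinuousLinearEquiv : H →L[ℂ] H) = 1 := by
      rw [hmul, map_neg, hσ f, add_neg_cancel, hzero]
      simp
    exact left_inv_eq_right_inv h1 h2
  have hunit (f : L) : ((U f).toContinuousLinearEquiv : H →L[ℂ] H) ∈ unitary (H →L[ℂ] H) := by
    rw [Unitary.mem_iff, hadj, hmul, hmul, neg_add_cancel, add_neg_cancel, hzero, map_neg,
      map_neg, LinearMap.neg_apply, hσ f]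
    simp
  have hnorm : ‖v 0‖ = 1 := by
    have h1 := hvk 0 0
    rw [weylKernel_apply, sub_zero, h0, inner_self_eq_norm_sq_to_K] at h1
    have h2 := congrArg Complex.re h1
    simp only [map_zero, Complex.ofReal_zero, mul_zero, Complex.exp_zero, one_mul,
      Complex.one_re] at h2
    have h3 : ‖v 0‖ ^ 2 = 1 := by simpa [← Complex.ofReal_pow] using h2
    nlinarith [norm_nonneg (v 0)]
  have hnt : Nontrivial H := ⟨⟨v 0, 0, fun h => by simp [h] at hnorm⟩⟩
  let i : WeylSystem σ :=
    { H := H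
      W := fun f => ⟨_, hunit f⟩
      W_mul := hmul
      W_star := hadj }
  obtain ⟨ω, hω⟩ := i.exists_vectorState (v 0) hnorm
  refine ⟨ω, fun f => (hω f).trans ?_⟩
  change ⟪v 0, U f (v 0)⟫_ℂ = χ f
  rw [hU]
  simp only [hw]
  rw [inner_smul_right, hvk, weylKernel_apply]
  simp

/-! ### Gauge transformations -/

/-- Multiplying the Weyl operators by a character. -/
noncomputable def WeylSystem.twist (i : WeylSystem σ) (χ : AddChar L Circle) : WeylSystem σ where
  H := i.H
  W f := ⟨(χ f : ℂ) • (i.W f : i.H →L[ℂ] i.H), by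
    have h : star (χ f : ℂ) * (χ f : ℂ) = 1 := by
      rw [← starRingEnd_apply, ← Circle.coe_inv_eq_conj, ← Circle.coe_mul, inv_mul_cancel,
        Circle.coe_one]
    rw [Unitary.mem_iff, star_smul, smul_mul_smul_comm, smul_mul_smul_comm,
      mul_comm (χ f : ℂ), h, one_smul, one_smul]
    exact Unitary.mem_iff.1 (i.W f).2⟩
  W_mul f g := by
    change ((χ f : ℂ) • (i.W f : i.H →L[ℂ] i.H)) * ((χ g : ℂ) • (i.W g : i.H →L[ℂ] i.H)) =
      _ • (χ (f + g) : ℂ) • (i.W (f + g) : i.H →L[ℂ] i.H)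
    rw [smul_mul_smul_comm, i.W_mul, AddChar.map_add_eq_mul, Circle.coe_mul, smul_comm]
  W_star f := by
    change star ((χ f : ℂ) • (i.W f : i.H →L[ℂ] i.H)) =
      (χ (-f) : ℂ) • (i.W (-f) : i.H →L[ℂ] i.H)
    rw [star_smul, i.W_star, AddChar.map_neg_eq_inv, Circle.coe_inv_eq_conj, starRingEnd_apply]

/-- The endomorphism of the ambient algebra which replaces each Weyl system by its twist. -/
noncomputable def weylAmbientGauge (σ : LinearMap.BilinForm ℝ L) (χ : AddChar L Circle) :
    WeylAmbient σ →⋆ₐ[ℂ] WeylAmbient σ where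
  toFun a := ⟨fun i => a (i.twist χ), memℓp_infty ⟨‖a‖, by
    rintro _ ⟨i, rfl⟩
    exact lp.norm_apply_le_norm ENNReal.top_ne_zero a (i.twist χ)⟩⟩
  map_one' := rfl
  map_mul' _ _ := rfl
  map_zero' := rfl
  map_add' _ _ := rfl
  commutes' _ := rfl
  map_star' _ := rfl

theorem weylAmbientGauge_mem (χ : AddChar L Circle) {a : WeylAmbient σ}
    (ha : a ∈ weylSubalgebra σ) : weylAmbientGauge σ χ a ∈ weylSubalgebra σ := by
  have hc : Continuous (weylAmbientGauge σ χ) :=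
    AddMonoidHomClass.continuous_of_bound (weylAmbientGauge σ χ) 1
    fun a => by simpa using NonUnitalStarAlgHom.norm_apply_le (weylAmbientGauge σ χ) a
  have hle : weylSubalgebra σ ≤ (weylSubalgebra σ).comap (weylAmbientGauge σ χ) := by
    refine StarSubalgebra.topologicalClosure_minimal (StarAlgebra.adjoin_le ?_) ?_
    · rintro _ ⟨f, rfl⟩
      exact ((χ f : ℂ) • weyl σ f).2
    · exact (StarSubalgebra.isClosed_topologicalClosure _).preimage hc
  exact hle ha

/-- The *-endomorphism of the Weyl C*-algebra with `W(f) ↦ χ(f) W(f)`. -/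
noncomputable def weylGauge (σ : LinearMap.BilinForm ℝ L) (χ : AddChar L Circle) :
    WeylAlgebra σ →⋆ₐ[ℂ] WeylAlgebra σ where
  toFun a := ⟨weylAmbientGauge σ χ a.1, weylAmbientGauge_mem χ a.2⟩
  map_one' := rfl
  map_mul' _ _ := rfl
  map_zero' := rfl
  map_add' _ _ := rfl
  commutes' _ := rfl
  map_star' _ := rfl

theorem weylGauge_weyl (χ : AddChar L Circle) (f : L) :
    weylGauge σ χ (weyl σ f) = (χ f : ℂ) • weyl σ f := rfl

theorem weylGauge_comp_of_mul_eq_one {χ χ' : AddChar L Circle} (h : ∀ f, χ f * χ' f = 1) :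
    (weylGauge σ χ).comp (weylGauge σ χ') = StarAlgHom.id ℂ (WeylAlgebra σ) :=
  weylHom_ext fun f => by
    rw [StarAlgHom.comp_apply, weylGauge_weyl, map_smul, weylGauge_weyl, smul_smul,
      ← Circle.coe_mul, mul_comm, h]
    simp

/-- The gauge transformation of the second kind defined by a character. -/
noncomputable def weylGaugeEquiv (σ : LinearMap.BilinForm ℝ L) (χ : AddChar L Circle) :
    WeylAlgebra σ ≃⋆ₐ[ℂ] WeylAlgebra σ :=
  StarAlgEquiv.ofStarAlgHom (weylGauge σ χ) (weylGauge σ χ⁻¹)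
    (weylGauge_comp_of_mul_eq_one fun f => by rw [AddChar.inv_apply', inv_mul_cancel])
    (weylGauge_comp_of_mul_eq_one fun f => by rw [AddChar.inv_apply', mul_inv_cancel])

theorem weylGaugeEquiv_weyl (χ : AddChar L Circle) (f : L) :
    weylGaugeEquiv σ χ (weyl σ f) = (χ f : ℂ) • weyl σ f := rfl

end

end WeylStates

/-! ### Pure states and the map `λ` -/

section PureStates

open Set Filter Topology

variable {A : Type u} [CStarAlgebra A]

/-- A weak*-closed subset of the dual unit ball, hence compact by Banach–Alaoglu. Compactness serves
Krein–Milman and also makes the set where two continuous maps agree closed in the dual. -/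
theorem StateSpace.isCompact_range_val :
    IsCompact {ω : WeakDual ℂ A | ω 1 = 1 ∧ ∀ a : A, 0 ≤ ω (star a * a)} := by
  refine (WeakDual.isCompact_closedBall (𝕜 := ℂ) (0 : StrongDual ℂ A) 1).of_isClosed_subset ?_ ?_
  · have h (a : A) : Continuous fun ω : WeakDual ℂ A => ω a := WeakDual.eval_continuous a
    have : {ω : WeakDual ℂ A | ω 1 = 1 ∧ ∀ a : A, 0 ≤ ω (star a * a)} =
        {ω | ω 1 = 1} ∩ ⋂ a : A, {ω | 0 ≤ ω (star a * a)} := by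
      ext ω
      simp
    rw [this]
    exact (isClosed_eq (h 1) continuous_const).inter
      (isClosed_iInter fun a => isClosed_le continuous_const (h _))
  · intro ω hω
    rw [mem_preimage, mem_closedBall_zero_iff]
    refine ContinuousLinearMap.opNorm_le_bound _ zero_le_one fun a => ?_
    rw [one_mul]
    exact StateSpace.norm_apply_le ⟨ω, hω⟩ a

instance : CompactSpace (StateSpace A) :=
  isCompact_iff_compactSpace.1 StateSpace.isCompact_range_val

theorem weakDual_real_smul_apply (r : ℝ) (ω : WeakDual ℂ A) (a : A) : (r • ω) a = (r : ℂ) * ω a := by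
  rw [← Complex.real_smul]
  rfl

theorem locallyConvexSpace_weakDual : LocallyConvexSpace ℝ (WeakDual ℂ A) := by
  let e : WeakDual ℂ A →ₗ[ℝ] (A → ℂ) :=
    { toFun := fun ω a => ω a
      map_add' := fun _ _ => rfl
      map_smul' := fun _ _ => rfl }
  exact LocallyConvexSpace.induced e

/-- Two weak*-continuous affine maps on a state space which agree on pure states are equal. -/
theorem eq_of_eq_on_pureStates {B : Type u} [CStarAlgebra B] {l l' : StateSpace A → StateSpace B}
    (hl : Continuous l) (hl' : Continuous l') (ha : IsAffineOnStates univ l)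
    (ha' : IsAffineOnStates univ l') (h : ∀ ρ, IsPureState ρ → l ρ = l' ρ) : l = l' := by
  set S : Set (WeakDual ℂ A) := {ω | ω 1 = 1 ∧ ∀ a : A, 0 ≤ ω (star a * a)} with hS
  have hcomb {x x₁ x₂ : WeakDual ℂ A} {r s : ℝ} (hrs : r + s = 1) (hx : r • x₁ + s • x₂ = x)
      (a : A) : x a = (r : ℂ) * x₁ a + ((1 - r : ℝ) : ℂ) * x₂ a := by
    rw [← hx, ← hrs, add_sub_cancel_left, ← weakDual_real_smul_apply, ← weakDual_real_smul_apply]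
    rfl
  have hconv : Convex ℝ S := by
    intro x hx y hy r s hr hs hrs
    have hc := hcomb hrs (rfl : r • x + s • y = _)
    refine ⟨?_, fun a => ?_⟩
    · rw [hc, hx.1, hy.1]
      simp
    · rw [hc]
      have hs' : 1 - r = s := by linarith
      rw [hs']
      exact add_nonneg (mul_nonneg (Complex.zero_le_real.2 hr) (hx.2 a))
        (mul_nonneg (Complex.zero_le_real.2 hs) (hy.2 a))
  -- The set of agreement is closed and convex and contains the extreme points, which are pure
  -- states. By Krein–Milman it is everything.
  set E : Set (StateSpace A) := {ρ | l ρ = l' ρ} with hE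
  have hEc : IsClosed (Subtype.val '' E : Set (WeakDual ℂ A)) :=
    ((isClosed_eq hl hl').isCompact.image continuous_subtype_val).isClosed
  have hEconv : Convex ℝ (Subtype.val '' E : Set (WeakDual ℂ A)) := by
    rintro _ ⟨x, hx, rfl⟩ _ ⟨y, hy, rfl⟩ r s hr hs hrs
    have hmem := hconv x.2 y.2 hr hs hrs
    refine ⟨⟨_, hmem⟩, StateSpace.ext fun b => ?_, rfl⟩
    have hc := hcomb hrs (rfl : r • x.1 + s • y.1 = _)
    have hr1 : r ≤ 1 := by linarith
    rw [ha ⟨_, hmem⟩ trivial x trivial y trivial r hr hr1 hc b,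
      ha' ⟨_, hmem⟩ trivial x trivial y trivial r hr hr1 hc b, hx, hy]
  have hext : S.extremePoints ℝ ⊆ Subtype.val '' E := by
    intro x hx
    rw [mem_extremePoints] at hx
    refine ⟨⟨x, hx.1⟩, h _ fun ω₁ ω₂ t ht ht1 hc => ?_, rfl⟩
    obtain ⟨h1, h2⟩ := hx.2 ω₁.1 ω₁.2 ω₂.1 ω₂.2 ⟨t, 1 - t, ht, by linarith, by ring, by
      refine ContinuousLinearMap.ext fun a => ?_
      change (t • ω₁.1) a + ((1 - t) • ω₂.1) a = x a
      rw [weakDual_real_smul_apply, weakDual_real_smul_apply]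
      exact (hc a).symm⟩
    exact ⟨Subtype.ext h1, Subtype.ext h2⟩
  have hsub : S ⊆ Subtype.val '' E := by
    have hsmul : ContinuousSMul ℝ (WeakDual ℂ A) :=
      inferInstanceAs (ContinuousSMul ℝ (WeakDual ℂ A))
    have hKM : closure (convexHull ℝ (S.extremePoints ℝ)) = S :=
      @closure_convexHull_extremePoints (WeakDual ℂ A) _ _ _ _ _ hsmul locallyConvexSpace_weakDual S
        StateSpace.isCompact_range_val hconv
    rw [← hKM]
    exact closure_minimal (convexHull_min hext hEconv) hEc
  funext ρ
  obtain ⟨ρ', hρ', he⟩ := hsub ρ.2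
  rwa [← Subtype.ext he]

/-- In the GNS-representation the hypothesis says `π(b)Ω = 0`. -/
theorem StateSpace.apply_conjugate_eq_zero (ω : StateSpace A) {b : A} (hb : ω.1 (star b * b) = 0)
    (a : A) : ω.1 (star b * a * b) = 0 := by
  obtain ⟨τ⟩ := nonempty_gnsTriple ω
  rw [← τ.inner_π, inner_self_eq_zero] at hb
  rw [mul_assoc, ← τ.inner_π, hb, inner_zero_left]

theorem StateSpace.exists_conjugate (ω : StateSpace A) {b : A} {n : ℝ}
    (hb : ω.1 (star b * b) = n) (hn : 0 < n) :
    ∃ ω' : StateSpace A, ∀ a, ω'.1 a = (n : ℂ)⁻¹ * ω.1 (star b * a * b) := by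
  have hn' : (n : ℂ) ≠ 0 := by exact_mod_cast hn.ne'
  let ℓ : A →L[ℂ] ℂ := (n : ℂ)⁻¹ • (ω.1 : A →L[ℂ] ℂ).comp
    (ContinuousLinearMap.mulLeftRight ℂ A (star b) b)
  have hℓ (a : A) : ℓ a = (n : ℂ)⁻¹ * ω.1 (star b * a * b) := rfl
  refine ⟨⟨StrongDual.toWeakDual ℓ, ?_, fun a => ?_⟩, hℓ⟩
  · change ℓ 1 = 1
    rw [hℓ, mul_one, hb, inv_mul_cancel₀ hn']
  · change 0 ≤ ℓ (star a * a)
    rw [hℓ]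
    have h := ω.2.2 (a * b)
    rw [star_mul, mul_assoc, ← mul_assoc (star a), ← mul_assoc] at h
    refine mul_nonneg ?_ h
    rw [← Complex.ofReal_inv]
    exact Complex.zero_le_real.2 (inv_nonneg.2 hn.le)

/-- A pure state does not change under conjugation by `b` if `b* b + c* c` is a scalar and everything
commutes. -/
theorem IsPureState.apply_conjugate {ω : StateSpace A} (hω : IsPureState ω) {b c : A} {r : ℝ}
    (hr : 0 < r) (hbc : ∀ a, star b * a * b + star c * a * c = (r : ℂ) • a) (a : A) :
    ω.1 (star b * a * b) = ω.1 (star b * b) * ω.1 a := by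
  obtain ⟨n, hn⟩ : ∃ n : ℝ, ω.1 (star b * b) = n :=
    ⟨_, Complex.ext rfl (Complex.nonneg_iff.1 (ω.2.2 b)).2.symm⟩
  obtain ⟨m, hm⟩ : ∃ m : ℝ, ω.1 (star c * c) = m :=
    ⟨_, Complex.ext rfl (Complex.nonneg_iff.1 (ω.2.2 c)).2.symm⟩
  have hn0 : 0 ≤ n := by
    have := ω.2.2 b
    rw [hn] at this
    exact Complex.zero_le_real.1 this
  have hm0 : 0 ≤ m := by
    have := ω.2.2 c
    rw [hm] at this
    exact Complex.zero_le_real.1 this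
  have hsum (a : A) : ω.1 (star b * a * b) + ω.1 (star c * a * c) = r * ω.1 a := by
    rw [← map_add, hbc, map_smul, smul_eq_mul]
  have hnm : n + m = r := by
    have := hsum 1
    rw [mul_one, mul_one, hn, hm, ω.2.1, mul_one] at this
    exact_mod_cast this
  -- If one of the weights vanishes, the corresponding functional cannot be normalised; it is then
  -- zero by `StateSpace.apply_conjugate_eq_zero`.
  rcases hn0.eq_or_lt with hn0 | hn0
  · rw [ω.apply_conjugate_eq_zero (by rw [hn, ← hn0]; simp), hn, ← hn0]
    simp
  rcases hm0.eq_or_lt with hm0 | hm0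
  · have h1 := hsum a
    rw [ω.apply_conjugate_eq_zero (b := c) (by rw [hm, ← hm0]; simp), add_zero] at h1
    rw [h1, hn, ← hnm, ← hm0, add_zero]
  obtain ⟨ω₁, h₁⟩ := ω.exists_conjugate hn hn0
  obtain ⟨ω₂, h₂⟩ := ω.exists_conjugate hm hm0
  have hnC : (n : ℂ) ≠ 0 := by exact_mod_cast hn0.ne'
  have hmC : (m : ℂ) ≠ 0 := by exact_mod_cast hm0.ne'
  have hrC : (r : ℂ) ≠ 0 := by exact_mod_cast hr.ne'
  -- `ω = (n/r) ω₁ + (m/r) ω₂` is a proper convex combination, so purity forces `ω₁ = ω`.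
  have h := (hω ω₁ ω₂ (n / r) (by positivity) (by rw [div_lt_one hr]; linarith) fun a => by
    have hm' : 1 - n / r = m / r := by rw [← hnm]; field_simp; ring
    rw [h₁, h₂, hm', Complex.ofReal_div, Complex.ofReal_div]
    have := hsum a
    field_simp
    linear_combination -this).1
  rw [hn, ← congrArg (fun ω : StateSpace A => ω.1 a) h, h₁, mul_inv_cancel_left₀ hnC]

end PureStates

/-! ### Characters of the commutative Weyl algebra and the map `λ` -/

section Lambda

open Set Filter Topology

variable {L : Type u} [AddCommGroup L] [Module ℝ L]

theorem weyl_zero_commute (f : L) (a : WeylAlgebra (0 : LinearMap.BilinForm ℝ L)) :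
    a * weyl 0 f = weyl 0 f * a := by
  refine weyl_induction (p := fun a => a * weyl 0 f = weyl 0 f * a) (fun g => ?_)
    (fun a b ha hb => ?_) (fun c a ha => ?_) (isClosed_eq (by fun_prop) (by fun_prop)) a
  · rw [weyl_mul, weyl_mul, add_comm]
    simp
  · rw [add_mul, mul_add, ha, hb]
  · rw [smul_mul_assoc, mul_smul_comm, ha]

/-- Pure states of the commutative Weyl algebra are multiplicative. -/
theorem IsPureState.apply_weyl_mul {ρ : StateSpace (WeylAlgebra (0 : LinearMap.BilinForm ℝ L))}
    (hρ : IsPureState ρ) (f : L) (a : WeylAlgebra (0 : LinearMap.BilinForm ℝ L)) :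
    ρ.1 (weyl 0 f * a) = ρ.1 (weyl 0 f) * ρ.1 a := by
  set u := weyl (0 : LinearMap.BilinForm ℝ L) f with hu
  set u' := weyl (0 : LinearMap.BilinForm ℝ L) (-f) with hu'
  have huu : u' * u = 1 := by
    rw [hu, hu', weyl_mul, neg_add_cancel, weyl_zero]
    simp
  have hexp (c : ℂ) (hc : star c * c = 1) (a : WeylAlgebra (0 : LinearMap.BilinForm ℝ L)) :
      star (1 + c • u) * a * (1 + c • u) = (2 : ℂ) • a + (c • (u * a) + star c • (u' * a)) := by
    have h1 : a * u = u * a := weyl_zero_commute f a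
    have h2 : u' * a * u = a := by rw [mul_assoc, h1, ← mul_assoc, huu, one_mul]
    rw [star_add, star_one, star_smul, hu, star_weyl, ← hu, ← hu']
    simp only [add_mul, mul_add, one_mul, mul_one, smul_mul_assoc, mul_smul_comm, h1, h2, smul_add,
      smul_smul]
    rw [mul_comm c (star c), hc, one_smul, two_smul]
    abel
  -- Purity is applied to `1 + c u` and `1 - c u`, with `|c| = 1`. In the sum of the two
  -- conjugations the terms linear in `u` and `u'` cancel and `4 a` remains, whence `r = 4`.
  have key (c : ℂ) (hc : star c * c = 1) :
      c * ρ.1 (u * a) + star c * ρ.1 (u' * a) =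
        (c * ρ.1 u + star c * ρ.1 u') * ρ.1 a := by
    have hc' : star (-c) * (-c) = 1 := by rw [star_neg, neg_mul_neg, hc]
    have h := hρ.apply_conjugate (b := 1 + c • u) (c := 1 + (-c) • u) (r := 4) (by norm_num)
      (fun a => by
        rw [hexp c hc, hexp (-c) hc', star_neg, neg_smul, neg_smul]
        push_cast
        rw [show (4 : ℂ) = 2 + 2 by norm_num, add_smul]
        abel) a
    have e := hexp c hc 1
    rw [mul_one, mul_one, mul_one] at e
    rw [hexp c hc, e] at h
    simp only [map_add, map_smul, smul_eq_mul, ρ.2.1] at h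
    linear_combination h
  -- The choices `c = 1` and `c = I` separate the contribution of `u` from that of `u' = u*`.
  have h1 := key 1 (by simp)
  have h2 := key Complex.I (by simp)
  simp only [star_one, one_mul] at h1
  simp only [Complex.star_def, Complex.conj_I] at h2
  linear_combination (1 / 2 : ℂ) * h1 - (Complex.I / 2) * h2 +
    (1 / 2) * (ρ.1 (u * a) - ρ.1 (u' * a) - (ρ.1 u - ρ.1 u') * ρ.1 a) * Complex.I_mul_I

/-- Multiplicativity makes the generating function additive-to-multiplicative, and `1 = ρ(W(f))
ρ(W(-f)) = |ρ(W(f))|²` puts its values on the circle. -/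
theorem IsPureState.exists_addChar {ρ : StateSpace (WeylAlgebra (0 : LinearMap.BilinForm ℝ L))}
    (hρ : IsPureState ρ) : ∃ χ : AddChar L Circle, ∀ f, (χ f : ℂ) = ρ.1 (weyl 0 f) := by
  have hadd (f g : L) : ρ.1 (weyl 0 (f + g)) = ρ.1 (weyl 0 f) * ρ.1 (weyl 0 g) := by
    rw [← hρ.apply_weyl_mul, weyl_mul]
    simp
  have hnorm (f : L) : ‖ρ.1 (weyl 0 f)‖ = 1 := by
    have h := hadd f (-f)
    rw [add_neg_cancel, apply_weyl_zero, apply_weyl_neg, Complex.mul_conj, Complex.normSq_eq_norm_sq]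
      at h
    have h' : ‖ρ.1 (weyl 0 f)‖ ^ 2 = 1 := by exact_mod_cast h.symm
    nlinarith [norm_nonneg (ρ.1 (weyl 0 f))]
  refine ⟨{ toFun := fun f => ⟨ρ.1 (weyl 0 f), mem_sphere_zero_iff_norm.2 (hnorm f)⟩
            map_zero_eq_one' := Subtype.ext (apply_weyl_zero ρ)
            map_add_eq_mul' := fun f g => Subtype.ext (hadd f g) }, fun f => rfl⟩

/-- The map `λ` multiplies the generating functions of states. -/
theorem exists_isLambdaMap {σ : LinearMap.BilinForm ℝ L} (hσ : σ.IsAlt)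
    (ω : StateSpace (WeylAlgebra σ)) :
    ∃ lam, IsLambdaMap ω lam ∧ (∀ lam', IsLambdaMap ω lam' → lam' = lam) ∧
      ∀ ρ f, (lam ρ).1 (weyl σ f) = ρ.1 (weyl 0 f) * ω.1 (weyl σ f) := by
  have hex (ρ : StateSpace (WeylAlgebra (0 : LinearMap.BilinForm ℝ L))) :
      ∃ ω' : StateSpace (WeylAlgebra σ), ∀ f,
        ω'.1 (weyl σ f) = ρ.1 (weyl 0 f) * ω.1 (weyl σ f) := by
    refine exists_weylState hσ (by rw [apply_weyl_zero, apply_weyl_zero, one_mul]) ?_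
    -- The whole phase of `σ` goes into the factor of `ω`, since the kernel of `ρ` has none. The
    -- Schur product theorem then applies to the entrywise product.
    have h : weylKernel σ (fun f => ρ.1 (weyl 0 f) * ω.1 (weyl σ f)) = Matrix.hadamard
        (weylKernel 0 fun f => ρ.1 (weyl 0 f)) (weylKernel σ fun f => ω.1 (weyl σ f)) := by
      refine Matrix.ext fun f g => ?_
      rw [Matrix.hadamard_apply, weylKernel_apply, weylKernel_apply, weylKernel_apply]
      simp
      ring
    rw [h]
    exact (posSemidef_weylKernel ρ).hadamard (posSemidef_weylKernel ω)
  choose lam hlam using hex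
  have hL : IsLambdaMap ω lam :=
    { continuous := continuous_weylState fun f => by
        simp only [hlam]
        exact (StateSpace.continuous_apply _).mul continuous_const
      affine := fun ρ _ ρ₁ _ ρ₂ _ t _ _ h => affine_of_weyl fun f => by
        rw [hlam, hlam, hlam, h]
        ring
      pure := fun ρ hρ => by
        obtain ⟨χ, hχ⟩ := hρ.exists_addChar
        refine ⟨weylGaugeEquiv σ χ, fun f => by rw [weylGaugeEquiv_weyl, hχ], ?_⟩
        refine weyl_induction (fun f => ?_) (fun a b ha hb => ?_) (fun c a ha => ?_) ?_
        · rw [hlam, weylGaugeEquiv_weyl, map_smul, smul_eq_mul, hχ]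
        · rw [map_add, map_add, map_add, ha, hb]
        · rw [map_smul, map_smul, map_smul, ha]
        · exact isClosed_eq ((lam ρ).1 : WeylAlgebra σ →L[ℂ] ℂ).continuous
            ((ω.1 : WeylAlgebra σ →L[ℂ] ℂ).continuous.comp
              (AddMonoidHomClass.continuous_of_bound (weylGaugeEquiv σ χ) 1 fun a => by
                simpa using NonUnitalStarAlgHom.norm_apply_le (weylGaugeEquiv σ χ) a)) }
  refine ⟨lam, hL, fun lam' hL' => ?_, hlam⟩
  refine eq_of_eq_on_pureStates hL'.continuous hL.continuous hL'.affine hL.affine fun ρ hρ => ?_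
  obtain ⟨η', h₁', h₂'⟩ := hL'.pure ρ hρ
  refine weylState_ext fun f => ?_
  rw [h₂', h₁', hlam, map_smul, smul_eq_mul]

/-- Because `ω(W(f))` never vanishes, the inverse acts on generating functions as division by it.
Weak*-continuity of the inverse can be tested on Weyl operators, where it is evident. -/
theorem restrictsToAffineHomeomorph_of_apply_weyl {σ : LinearMap.BilinForm ℝ L}
    {ω : StateSpace (WeylAlgebra σ)}
    {lam : StateSpace (WeylAlgebra (0 : LinearMap.BilinForm ℝ L)) → StateSpace (WeylAlgebra σ)}
    (hlam : IsLambdaMap ω lam)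
    (happly : ∀ ρ f, (lam ρ).1 (weyl σ f) = ρ.1 (weyl 0 f) * ω.1 (weyl σ f))
    (hω : ∀ f, ω.1 (weyl σ f) ≠ 0)
    {S : Set (StateSpace (WeylAlgebra (0 : LinearMap.BilinForm ℝ L)))}
    {S' : Set (StateSpace (WeylAlgebra σ))} (hmaps : ∀ ρ ∈ S, lam ρ ∈ S')
    (hsurj : ∀ ω' ∈ S', ∃ ρ ∈ S, ∀ f, ω'.1 (weyl σ f) = ρ.1 (weyl 0 f) * ω.1 (weyl σ f)) :
    RestrictsToAffineHomeomorph lam S S' := by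
  refine ⟨fun ρ _ ρ₁ _ ρ₂ _ => hlam.affine ρ trivial ρ₁ trivial ρ₂ trivial, ?_⟩
  let e : S ≃ S' := Equiv.ofBijective (fun ρ => ⟨lam ρ, hmaps ρ ρ.2⟩) ⟨fun ρ ρ' h => by
      refine Subtype.ext (weylState_ext fun f => mul_right_cancel₀ (hω f) ?_)
      rw [← happly, ← happly, show lam ρ = lam ρ' from congrArg Subtype.val h], fun ω' => by
      obtain ⟨ρ, hρ, h⟩ := hsurj ω'.1 ω'.2
      exact ⟨⟨ρ, hρ⟩, Subtype.ext (weylState_ext fun f => by rw [happly, h])⟩⟩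
  have he (ρ : S) : (e ρ : StateSpace (WeylAlgebra σ)) = lam ρ := rfl
  refine ⟨⟨e, ?_, ?_⟩, he⟩
  · exact (hlam.continuous.comp continuous_subtype_val).subtype_mk _
  · refine continuous_induced_rng.2 (continuous_weylState fun f => ?_)
    have h (ω' : S') : (e.symm ω' : StateSpace (WeylAlgebra (0 : LinearMap.BilinForm ℝ L))).1
        (weyl 0 f) = ω'.1.1 (weyl σ f) / ω.1 (weyl σ f) := by
      rw [eq_div_iff (hω f), ← happly, ← he, Equiv.apply_symm_apply]
    exact (((StateSpace.continuous_apply (weyl σ f)).comp continuous_subtype_val).div_const _).congr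
      fun ω' => (h ω').symm

end Lambda

/-! ### Quadratic forms dominating a pre-symplectic form -/

section QuadraticForm

open Set Filter Topology

variable {L : Type u} [AddCommGroup L] [Module ℝ L]

theorem QuadraticMap.map_sub_add_map_add (Q : QuadraticForm ℝ L) (x y : L) :
    Q (x - y) + Q (x + y) = 2 * Q x + 2 * Q y := by
  have h1 := QuadraticMap.map_add Q x y
  have h2 := QuadraticMap.map_add Q x (-y)
  rw [QuadraticMap.polar_neg_right, QuadraticMap.map_neg, ← sub_eq_add_neg] at h2
  linarith

/-- The real part of a quasi-free two-point function dominates its imaginary part. -/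
def QuadraticForm.Dominates (Q : QuadraticForm ℝ L) (σ : LinearMap.BilinForm ℝ L) : Prop :=
  ∀ f g, |σ f g| ≤ Q f + Q g

namespace QuadraticForm.Dominates

variable {Q : QuadraticForm ℝ L} {σ : LinearMap.BilinForm ℝ L}

theorem nonneg (h : Q.Dominates σ) (f : L) : 0 ≤ Q f := by
  simpa using h f 0

theorem map_add_le (h : Q.Dominates σ) (f g : L) : Q (f + g) ≤ 2 * Q f + 2 * Q g := by
  linarith [QuadraticMap.map_sub_add_map_add Q f g, h.nonneg (f - g)]

theorem map_sub_le (h : Q.Dominates σ) (f g : L) : Q (f - g) ≤ 2 * Q f + 2 * Q g := by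
  linarith [QuadraticMap.map_sub_add_map_add Q f g, h.nonneg (f + g)]

/-- The discriminant of the polynomial `x² Q(f) + x σ(f, g) + Q(g)`, which domination makes
nonnegative for all real `x`. -/
theorem sq_le (h : Q.Dominates σ) (f g : L) : σ f g ^ 2 ≤ 4 * (Q f * Q g) := by
  have hd := discrim_le_zero (a := Q f) (b := σ f g) (c := Q g) fun x => by
    have h1 := neg_le_of_abs_le (h (x • f) g)
    rw [QuadraticMap.map_smul, map_smul, LinearMap.smul_apply, smul_eq_mul, smul_eq_mul] at h1
    linarith
  rw [discrim] at hd
  linarith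

end QuadraticForm.Dominates

theorem conjC_add (x y : Complexification L) : conjC (x + y) = conjC x + conjC y :=
  _root_.map_add _ x y

theorem conjC_tmul (c : ℂ) (f : L) :
    conjC (c ⊗ₜ[ℝ] f) = (starRingEnd ℂ c) ⊗ₜ[ℝ] f := rfl

/-- The generating function of a quasi-free state is a Gaussian. -/
theorem IsQuasiFreeWith.exists_quadraticForm {σ : LinearMap.BilinForm ℝ L}
    {ω : StateSpace (WeylAlgebra σ)} {ω₂ : LinearMap.BilinForm ℂ (Complexification L)}
    (h : IsQuasiFreeWith ω ω₂) : ∃ Q : QuadraticForm ℝ L, Q.Dominates σ ∧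
      (∀ f, ω₂ (1 ⊗ₜ[ℝ] f) (1 ⊗ₜ[ℝ] f) = Q f) ∧
      ∀ f, ω.1 (weyl σ f) = Complex.exp (-(1 / 2) * Q f) := by
  obtain ⟨⟨hpos, hcomm⟩, hω⟩ := h
  have hr (r : ℝ) (f : L) : (1 : ℂ) ⊗ₜ[ℝ] (r • f) = (r : ℂ) • ((1 : ℂ) ⊗ₜ[ℝ] f) := by
    rw [TensorProduct.tmul_smul, TensorProduct.smul_tmul', TensorProduct.smul_tmul']
    simp
  let B : LinearMap.BilinForm ℝ L := LinearMap.mk₂ ℝ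
    (fun f g => (ω₂ (1 ⊗ₜ[ℝ] f) (1 ⊗ₜ[ℝ] g)).re)
    (fun f f' g => by rw [TensorProduct.tmul_add, map_add, LinearMap.add_apply, Complex.add_re])
    (fun r f g => by rw [hr, map_smul, LinearMap.smul_apply, smul_eq_mul, Complex.re_ofReal_mul,
      smul_eq_mul])
    (fun f g g' => by rw [TensorProduct.tmul_add, map_add, Complex.add_re])
    (fun r f g => by rw [hr, map_smul, smul_eq_mul, Complex.re_ofReal_mul, smul_eq_mul])
  set Q : QuadraticForm ℝ L := LinearMap.BilinMap.toQuadraticMap B with hQ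
  have hQw (f : L) : ω₂ (1 ⊗ₜ[ℝ] f) (1 ⊗ₜ[ℝ] f) = Q f := by
    have h1 := hpos (1 ⊗ₜ[ℝ] f)
    rw [conjC_tmul, map_one] at h1
    exact Complex.ext rfl (Complex.nonneg_iff.1 h1).2.symm
  have hle (f g : L) : σ f g ≤ Q f + Q g := by
    -- Positivity at `f + i g`: the cross terms are `i (ω₂(f, g) - ω₂(g, f)) = -σ(f, g)`.
    have h1 := hpos (1 ⊗ₜ[ℝ] f + Complex.I ⊗ₜ[ℝ] g)
    have hI (c : ℂ) (g : L) : c ⊗ₜ[ℝ] g = c • ((1 : ℂ) ⊗ₜ[ℝ] g) := by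
      rw [TensorProduct.smul_tmul', smul_eq_mul, mul_one]
    have h2 := hcomm (1 ⊗ₜ[ℝ] f) (1 ⊗ₜ[ℝ] g)
    rw [LinearMap.BilinForm.baseChange_tmul, mul_one, Complex.real_smul, mul_one] at h2
    rw [conjC_add, conjC_tmul, conjC_tmul, map_one, Complex.conj_I, hI Complex.I, hI (-Complex.I)]
      at h1
    simp only [map_add, map_smul, LinearMap.add_apply, LinearMap.smul_apply, smul_eq_mul, hQw]
      at h1
    have h3 := (Complex.nonneg_iff.1 h1).1
    have h4 := congrArg Complex.im h2
    simp at h3 h4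
    linarith
  refine ⟨Q, fun f g => abs_le.2 ⟨?_, hle f g⟩, hQw, fun f => by rw [hω, hQw]⟩
  have h1 := hle (-f) g
  rw [QuadraticMap.map_neg, map_neg, LinearMap.neg_apply] at h1
  linarith

end QuadraticForm

/-! ### Averaging over orbits by minimizing a quadratic form -/

section Mean

open Set Filter Topology

variable {L : Type u} [AddCommGroup L] [Module ℝ L] {Q : QuadraticForm ℝ L}
  {σ : LinearMap.BilinForm ℝ L} {D : OneParticleDynamics σ}

/-- An abstract mean ergodic theorem: minimizers of an invariant quadratic form over the convex hull
of an orbit converge to invariant vectors. -/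
theorem exists_tendsto_invariant (hQ : Q.Dominates σ) (hQT : ∀ t f, Q (D.T t f) = Q f)
    {E : Type*} [NormedAddCommGroup E] [CompleteSpace E] {Φ : L → E}
    (hΦ : ∀ f g, ‖Φ f - Φ g‖ ^ 2 ≤ Q (f - g) * (1 + Q f)) {U : ℝ → E → E}
    (hU : ∀ t, Continuous (U t)) (hUΦ : ∀ t f, U t (Φ f) = Φ (D.T t f)) (f : L) :
    ∃ d : ℝ, ∃ x : ℕ → L, (∀ n, x n ∈ convexHull ℝ (range fun t => D.T t f)) ∧
      Tendsto (fun n => Q (x n)) atTop (𝓝 d) ∧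
      ∃ η, Tendsto (fun n => Φ (x n)) atTop (𝓝 η) ∧ ∀ t, U t η = η := by
  set C := convexHull ℝ (range fun t => D.T t f) with hC
  have hne : (Q '' C).Nonempty :=
    ⟨_, D.T 0 f, subset_convexHull ℝ _ ⟨0, rfl⟩, rfl⟩
  have hbdd : BddBelow (Q '' C) := ⟨0, by
    rintro _ ⟨y, -, rfl⟩
    exact hQ.nonneg y⟩
  set d := sInf (Q '' C) with hd
  have hdle (y) (hy : y ∈ C) : d ≤ Q y := csInf_le hbdd ⟨y, hy, rfl⟩
  have hTC (t : ℝ) {y : L} (hy : y ∈ C) : D.T t y ∈ C := by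
    have h1 : ((D.T t : L →ₗ[ℝ] L) y) ∈ (D.T t : L →ₗ[ℝ] L) '' C := ⟨y, hy, rfl⟩
    rw [hC, LinearMap.image_convexHull] at h1
    refine convexHull_mono ?_ h1
    rintro _ ⟨_, ⟨s, rfl⟩, rfl⟩
    exact ⟨t + s, D.T_add t s f⟩
  -- The midpoint of `y` and `z` stays in `C`, where `Q ≥ d`. By the parallelogram law,
  -- near-minimizers are therefore `Q`-close to each other.
  have hdist {y z : L} (hy : y ∈ C) (hz : z ∈ C) : Q (y - z) ≤ 2 * (Q y - d) + 2 * (Q z - d) := by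
    have h1 := hdle _ ((convex_convexHull ℝ _) hy hz (by norm_num : (0 : ℝ) ≤ 1 / 2)
      (by norm_num : (0 : ℝ) ≤ 1 / 2) (by norm_num))
    rw [← smul_add, QuadraticMap.map_smul, smul_eq_mul] at h1
    linarith [QuadraticMap.map_sub_add_map_add Q y z]
  have hex (n : ℕ) : ∃ y ∈ C, Q y < d + 1 / ((n : ℝ) + 1) := by
    obtain ⟨_, ⟨y, hy, rfl⟩, h⟩ := exists_lt_of_csInf_lt hne
      (show sInf (Q '' C) < d + 1 / ((n : ℝ) + 1) by
        have : 0 < 1 / ((n : ℝ) + 1) := by positivity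
        linarith)
    exact ⟨y, hy, h⟩
  choose x hxC hx using hex
  have hlim : Tendsto (fun n => Q (x n)) atTop (𝓝 d) := by
    refine tendsto_of_tendsto_of_tendsto_of_le_of_le tendsto_const_nhds ?_
      (fun n => hdle _ (hxC n)) fun n => (hx n).le
    simpa using (tendsto_one_div_add_atTop_nhds_zero_nat (𝕜 := ℝ)).const_add d
  have hx1 (n : ℕ) : Q (x n) ≤ d + 1 := (hx n).le.trans (by
    have : 1 / ((n : ℝ) + 1) ≤ 1 := by
      rw [div_le_one (by positivity)]
      linarith [(Nat.cast_nonneg n : (0 : ℝ) ≤ n)]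
    linarith)
  have hd0 : 0 ≤ d := le_csInf hne fun b hb => by
    obtain ⟨y, -, rfl⟩ := hb
    exact hQ.nonneg y
  -- The estimate `hΦ` carries `Q`-closeness over to `E`; the factor `2 + d` bounds `1 + Q (x n)`.
  have hΦle {n : ℕ} {y : L} (hy : y ∈ C) : ‖Φ (x n) - Φ y‖ ≤
      Real.sqrt ((2 * (1 / ((n : ℝ) + 1)) + 2 * (Q y - d)) * (2 + d)) := by
    refine Real.le_sqrt_of_sq_le ((hΦ _ _).trans ?_)
    have h1 := hdist (hxC n) hy
    have h2 := (hx n).le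
    exact mul_le_mul (by linarith) (by linarith [hx1 n]) (by linarith [hQ.nonneg (x n)])
      ((hQ.nonneg _).trans (h1.trans (by linarith)))
  have hb : Tendsto (fun n : ℕ => Real.sqrt ((4 * (1 / ((n : ℝ) + 1))) * (2 + d))) atTop (𝓝 0) := by
    have := ((tendsto_one_div_add_atTop_nhds_zero_nat (𝕜 := ℝ)).const_mul 4).mul_const (2 + d)
    simpa using this.sqrt
  have hcauchy : CauchySeq fun n => Φ (x n) := by
    refine cauchySeq_of_le_tendsto_0 _ (fun n m N hn hm => ?_) hb
    rw [dist_eq_norm]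
    refine (hΦle (hxC m)).trans (Real.sqrt_le_sqrt (mul_le_mul_of_nonneg_right ?_ (by linarith)))
    have h1 := Nat.one_div_le_one_div (α := ℝ) hn
    have h2 := Nat.one_div_le_one_div (α := ℝ) hm
    linarith [hx m]
  obtain ⟨η, hη⟩ := cauchySeq_tendsto_of_complete hcauchy
  refine ⟨d, x, hxC, hlim, η, hη, fun t => ?_⟩
  refine tendsto_nhds_unique (((hU t).tendsto η).comp hη) ?_
  -- The translate of `x n` lies in `C` and has the same value of `Q`, so it is an equally good
  -- near-minimizer and its image has the same limit.
  have h0 : Tendsto (fun n => Φ (x n) - U t (Φ (x n))) atTop (𝓝 0) := by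
    refine squeeze_zero_norm (fun n => ?_) hb
    rw [hUΦ]
    refine (hΦle (hTC t (hxC n))).trans
      (Real.sqrt_le_sqrt (mul_le_mul_of_nonneg_right ?_ (by linarith)))
    rw [hQT]
    linarith [hx n]
  simpa [Function.comp_def] using hη.sub h0

end Mean

/-! ### Gaussian quotients of generating functions -/

section Quotient

open Set Filter Topology

variable {L : Type u} [AddCommGroup L] [Module ℝ L] {Q : QuadraticForm ℝ L}
  {σ : LinearMap.BilinForm ℝ L} {D : OneParticleDynamics σ}

theorem posSemidef_of_tendsto {X : Type*} {M : ℕ → Matrix X X ℂ} {M' : Matrix X X ℂ}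
    (h : ∀ n, (M n).PosSemidef) (hM : ∀ i j, Tendsto (fun n => M n i j) atTop (𝓝 (M' i j))) :
    M'.PosSemidef := by
  refine ⟨Matrix.ext fun i j => ?_, fun x => ?_⟩
  · rw [Matrix.conjTranspose_apply]
    have h1 : Tendsto (fun n => star (M n j i)) atTop (𝓝 (star (M' j i))) :=
      (continuous_star.tendsto _).comp (hM j i)
    have h2 (n : ℕ) : star (M n j i) = M n i j := (h n).isHermitian.apply i j
    simp only [h2] at h1
    exact tendsto_nhds_unique h1 (hM i j)
  · have h1 : Tendsto (fun n => x.sum fun i xi => x.sum fun j xj => star xi * M n i j * xj) atTop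
        (𝓝 (x.sum fun i xi => x.sum fun j xj => star xi * M' i j * xj)) := by
      simp only [Finsupp.sum]
      exact tendsto_finsetSum _ fun i _ => tendsto_finsetSum _ fun j _ =>
        ((hM i j).const_mul _).mul_const _
    exact ge_of_tendsto' h1 fun n => (h n).2 x

/-- If `χ` is of positive type relative to `σ`, and its quotient by a Gaussian is constant along
orbits, then the quotient is of positive type provided that the Gaussian becomes trivial under
averaging. -/
theorem posSemidef_quotient (hQ : Q.Dominates σ) {χ : L → ℂ} (hχ : (weylKernel σ χ).PosSemidef)
    {q : L → ℂ} (hq : ∀ f, χ f = q f * Complex.exp (-(1 / 2) * Q f))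
    (hinv : ∀ f g t, q (f + D.T t g) = q (f + g))
    (hsmall : ∀ f, ∀ ε > 0, ∃ y ∈ convexHull ℝ (range fun t => D.T t f), Q y < ε) :
    (weylKernel (0 : LinearMap.BilinForm ℝ L) q).PosSemidef := by
  -- The vectors all of whose real multiples are periods of `q`. They form a subspace containing
  -- every `f - T_t f`, hence also `f - y` for each `y` in the convex hull of the orbit.
  let M : Submodule ℝ L :=
    { carrier := {h | ∀ (r : ℝ) (g : L), q (g + r • h) = q g}
      zero_mem' := fun r g => by rw [smul_zero, add_zero]
      add_mem' := fun {a b} ha hb r g => by rw [smul_add, ← add_assoc, hb, ha]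
      smul_mem' := fun c a ha r g => by rw [smul_smul, ha] }
  have hM {h g : L} (hh : h ∈ M) : q (g + h) = q g := by simpa using hh 1 g
  have horbit (f : L) : convexHull ℝ (range fun t => D.T t f) ⊆ {y | f - y ∈ M} := by
    refine convexHull_min ?_ ?_
    · rintro _ ⟨t, rfl⟩ r g
      have h1 := hinv (g + r • f) (-(r • f)) t
      rw [add_neg_cancel_right, map_neg, map_smul] at h1
      rw [← h1, smul_sub]
      congr 1
      abel
    · intro y hy z hz a b _ _ hab
      have h1 := M.add_mem (M.smul_mem a hy) (M.smul_mem b hz)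
      have h2 : a • (f - y) + b • (f - z) = f - (a • y + b • z) := by
        have h3 : f = a • f + b • f := by rw [← add_smul, hab, one_smul]
        conv_rhs => rw [h3]
        rw [smul_sub, smul_sub]
        abel
      rwa [h2] at h1
  choose y hy hyQ using fun (n : ℕ) (f : L) =>
    hsmall f (1 / ((n : ℝ) + 1)) (by positivity)
  have hlim (c : ℝ) : Tendsto (fun n : ℕ => c * (1 / ((n : ℝ) + 1))) atTop (𝓝 0) := by
    simpa using (tendsto_one_div_add_atTop_nhds_zero_nat (𝕜 := ℝ)).const_mul c
  -- Evaluate the kernel of `χ` at the averages `y n f`. The values of `q` do not change, while `σ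
  -- (y n f) (y n g)` and `Q (y n g - y n f)` tend to zero.
  refine posSemidef_of_tendsto (fun n => hχ.submatrix (y n)) fun f g => ?_
  have hq' (n : ℕ) : q (y n g - y n f) = q (g - f) := by
    have h1 : g - f = y n g - y n f + ((g - y n g) - (f - y n f)) := by abel
    rw [h1, hM (M.sub_mem (horbit g (hy n g)) (horbit f (hy n f)))]
  have hσ : Tendsto (fun n => σ (y n f) (y n g)) atTop (𝓝 0) := by
    refine squeeze_zero_norm (fun n => ?_) (hlim 2)
    rw [Real.norm_eq_abs]
    linarith [hQ (y n f) (y n g), hyQ n f, hyQ n g]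
  have hQ0 : Tendsto (fun n => Q (y n g - y n f)) atTop (𝓝 0) := by
    refine squeeze_zero (fun n => hQ.nonneg _) (fun n => ?_) (hlim 4)
    linarith [hQ.map_sub_le (y n g) (y n f), hyQ n f, hyQ n g]
  have hcont : Continuous fun p : ℝ × ℝ => Complex.exp (Complex.I / 2 * p.1) *
      (q (g - f) * Complex.exp (-(1 / 2) * p.2)) := by fun_prop
  have h1 := (hcont.tendsto (0, 0)).comp (hσ.prodMk_nhds hQ0)
  simp only [Complex.ofReal_zero, mul_zero, Complex.exp_zero, mul_one, one_mul] at h1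
  have h2 : weylKernel (0 : LinearMap.BilinForm ℝ L) q f g = q (g - f) := by
    simp [weylKernel_apply]
  rw [h2]
  refine h1.congr fun n => ?_
  rw [Matrix.submatrix_apply, weylKernel_apply, hq, hq']
  rfl

/-- Dividing a family of boundary values by a Gaussian one. The function `e` is the sign which
distinguishes the two orderings of a product. -/
theorem isBoundaryValue_quotient {R : Set ℂ} (hR : HasMaxPrinciple R) (hQ : Q.Dominates σ)
    (hQT : ∀ t f, Q (D.T t f) = Q f) {e : ℂ → ℝ} (he : ∀ z, |e z| ≤ 1) {q : L → ℂ}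
    (h₀ : ∀ f g, IsBoundaryValue R fun z =>
      Complex.exp (-Complex.I / 2 * (e z * σ f (D.T z.re g) : ℝ)) *
      Complex.exp (-(1 / 2) * Q (f + D.T z.re g)))
    (h : ∀ f g, IsBoundaryValue R fun z =>
      Complex.exp (-Complex.I / 2 * (e z * σ f (D.T z.re g) : ℝ)) *
      (q (f + D.T z.re g) * Complex.exp (-(1 / 2) * Q (f + D.T z.re g)))) (f g : L) :
    IsBoundaryValue R fun z => q (f + D.T z.re g) := by
  -- Dividing by the Gaussian boundary value directly would require its holomorphic extension to
  -- have no zeros. Instead `k` is the exponent without its constant part `(Q f + Q g) / 2`. It is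
  -- bilinear in `(f, g)`, so `h₀` at `(s f, s g)` gives `exp(-s² k)` up to a constant factor. Hence
  -- `k` is itself a boundary value, and so is `exp k`.
  set k : ℂ → ℂ := fun z => Complex.I / 2 * (e z * σ f (D.T z.re g) : ℝ) +
    1 / 2 * (Q (f + D.T z.re g) - Q f - Q g : ℝ) with hk
  have hkb (z : ℂ) (_ : z ∈ frontier R) : ‖k z‖ ≤ 2 * (Q f + Q g) := by
    have h1 : |e z * σ f (D.T z.re g)| ≤ Q f + Q g := by
      rw [abs_mul, ← hQT z.re g]
      exact (mul_le_of_le_one_left (abs_nonneg _) (he z)).trans (hQ _ _)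
    have h2 : |Q (f + D.T z.re g) - Q f - Q g| ≤ Q f + Q g := by
      have h3 := hQ.map_add_le f (D.T z.re g)
      rw [hQT] at h3
      have h4 := hQ.nonneg (f + D.T z.re g)
      exact abs_le.2 ⟨by linarith, by linarith⟩
    refine (norm_add_le _ _).trans ?_
    rw [norm_mul, norm_mul, Complex.norm_real, Complex.norm_real, Real.norm_eq_abs, Real.norm_eq_abs]
    have h5 : ‖Complex.I / 2‖ = 1 / 2 := by simp
    have h6 : ‖(1 / 2 : ℂ)‖ = 1 / 2 := by simp
    rw [h5, h6]
    linarith [hQ.nonneg f, hQ.nonneg g]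
  have hkR : IsBoundaryValue R k := by
    refine IsBoundaryValue.of_exp_neg_sq_mul hR hkb fun s => ?_
    refine ((h₀ (s • f) (s • g)).const_mul (Complex.exp (1 / 2 * (s ^ 2 * (Q f + Q g))))).congr
      fun z _ => ?_
    rw [(D.T z.re).map_smul, ← smul_add, QuadraticMap.map_smul, map_smul, map_smul,
      LinearMap.smul_apply, ← Complex.exp_add, ← Complex.exp_add, hk]
    congr 1
    simp only [smul_eq_mul]
    push_cast
    ring
  refine ((h f g).mul ((hkR.add (IsBoundaryValue.const R (1 / 2 * (Q f + Q g)))).exp)).congr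
    fun z _ => ?_
  rw [mul_left_comm, mul_assoc, ← Complex.exp_add, ← Complex.exp_add]
  have h0 : -Complex.I / 2 * (e z * σ f (D.T z.re g) : ℝ) + -(1 / 2) * Q (f + D.T z.re g) +
      (k z + 1 / 2 * (Q f + Q g)) = 0 := by
    rw [hk]
    push_cast
    ring
  rw [h0, Complex.exp_zero, mul_one]

end Quotient

/-! ### Ground state and KMS conditions on Weyl operators -/

section WeylDynamics

variable {L : Type u} [AddCommGroup L] [Module ℝ L] {σ : LinearMap.BilinForm ℝ L}
  {D : OneParticleDynamics σ}

theorem isEquilibriumState_of_weyl {ω : StateSpace (WeylAlgebra σ)}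
    (h : ∀ t f, ω.1 (weyl σ (D.T t f)) = ω.1 (weyl σ f)) :
    IsEquilibriumState (quasiFreeDynamics D) ω := by
  intro t
  refine weyl_induction (fun f => ?_) (fun a b ha hb => ?_) (fun c a ha => ?_) ?_
  · rw [quasiFreeDynamics_weyl, h]
  · rw [map_add, map_add, map_add, ha, hb]
  · rw [map_smul, map_smul, map_smul, ha]
  · exact isClosed_eq ((ω.1 : WeylAlgebra σ →L[ℂ] ℂ).continuous.comp
      (AddMonoidHomClass.continuous_of_bound ((quasiFreeDynamics D).evol t) 1 fun a => by
        simpa using norm_evol (quasiFreeDynamics D) t a))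
      (ω.1 : WeylAlgebra σ →L[ℂ] ℂ).continuous

theorem apply_weyl_mul_evol (ω : StateSpace (WeylAlgebra σ)) (t : ℝ) (f g : L) :
    ω.1 (weyl σ f * (quasiFreeDynamics D).evol t (weyl σ g)) =
      Complex.exp (-Complex.I / 2 * (1 * σ f (D.T t g) : ℝ)) * ω.1 (weyl σ (f + D.T t g)) := by
  rw [quasiFreeDynamics_weyl, weyl_mul, map_smul, smul_eq_mul, one_mul]

/-- Exchanging the two Weyl operators leaves the sum `f + T_t g` unchanged and only reverses the
sign of the phase. This is the sign `e` of `isBoundaryValue_quotient`. -/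
theorem kmsBoundary_weyl (hσ : σ.IsAlt) (ω : StateSpace (WeylAlgebra σ)) (f g : L) (z : ℂ) :
    kmsBoundary (quasiFreeDynamics D) ω (weyl σ f) (weyl σ g) z =
      Complex.exp (-Complex.I / 2 * ((if z.im = 0 then 1 else -1) * σ f (D.T z.re g) : ℝ)) *
        ω.1 (weyl σ (f + D.T z.re g)) := by
  rw [kmsBoundary]
  split_ifs
  · rw [apply_weyl_mul_evol]
  · rw [quasiFreeDynamics_weyl, weyl_mul, map_smul, smul_eq_mul, add_comm f, neg_one_mul,
      hσ.neg_eq]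

theorem isBoundaryValue_weyl_of_mem_groundStates {ω : StateSpace (WeylAlgebra σ)}
    (hω : ω ∈ groundStates (quasiFreeDynamics D)) (f g : L) :
    IsBoundaryValue openUpperHalfPlane fun z =>
      Complex.exp (-Complex.I / 2 * (1 * σ f (D.T z.re g) : ℝ)) *
        ω.1 (weyl σ (f + D.T z.re g)) :=
  (isBoundaryValue_of_mem_groundStates hω _ _).congr fun _ _ => apply_weyl_mul_evol ..

theorem isBoundaryValue_weyl_of_mem_kmsStates (hσ : σ.IsAlt) {β : ℝ} (hβ : 0 < β)
    {ω : StateSpace (WeylAlgebra σ)} (hω : ω ∈ kmsStates (quasiFreeDynamics D) β) (f g : L) :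
    IsBoundaryValue (openStrip β) fun z =>
      Complex.exp (-Complex.I / 2 * ((if z.im = 0 then 1 else -1) * σ f (D.T z.re g) : ℝ)) *
        ω.1 (weyl σ (f + D.T z.re g)) :=
  ((mem_kmsStates_iff hβ).1 hω _ _).congr fun _ _ => kmsBoundary_weyl hσ ..

/-- Functions which extend to the upper half plane are constant along orbits. -/
theorem apply_add_orbit_of_upperHalfPlane {q : L → ℂ} (hq : ∀ f, q (-f) = (starRingEnd ℂ) (q f))
    (h : ∀ f g, IsBoundaryValue openUpperHalfPlane fun z => q (f + D.T z.re g)) (f g : L) (t : ℝ) :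
    q (f + D.T t g) = q (f + g) := by
  have h1 := IsBoundaryValue.eq_of_upperHalfPlane (u := fun t => q (f + D.T t g))
    (v := fun t => q (-f + D.T t (-g))) (h f g) (h (-f) (-g))
    (fun t => by rw [← hq, neg_add, map_neg]) t 0
  rwa [D.T_zero] at h1

/-- In a classical ground state, the generating function is constant along orbits. -/
theorem apply_weyl_add_orbit_of_mem_groundStates
    {ρ : StateSpace (WeylAlgebra (0 : LinearMap.BilinForm ℝ L))}
    (hρ : ρ ∈ groundStates (quasiFreeDynamics D.classical)) (f g : L) (t : ℝ) :
    ρ.1 (weyl 0 (f + D.T t g)) = ρ.1 (weyl 0 (f + g)) := by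
  refine apply_add_orbit_of_upperHalfPlane (D := D) (q := fun f => ρ.1 (weyl 0 f))
    (apply_weyl_neg ρ) (fun f g => ?_) f g t
  refine (isBoundaryValue_weyl_of_mem_groundStates hρ f g).congr fun z _ => ?_
  simp [OneParticleDynamics.classical]

/-- The correlation functions of Weyl operators are constant in time, so their extensions are
constants; `f = 0` gives invariance of the state. -/
theorem mem_groundStates_classical {ρ : StateSpace (WeylAlgebra (0 : LinearMap.BilinForm ℝ L))}
    (h : ∀ f g t, ρ.1 (weyl 0 (f + D.T t g)) = ρ.1 (weyl 0 (f + g))) :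
    ρ ∈ groundStates (quasiFreeDynamics D.classical) := by
  refine mem_groundStates_of_dense_span (isEquilibriumState_of_weyl fun t f => ?_)
    (dense_span_weyl 0) ?_
  · have h1 := h 0 f t
    rwa [zero_add, zero_add] at h1
  · rintro _ ⟨f, rfl⟩ _ ⟨g, rfl⟩
    refine (IsBoundaryValue.const openUpperHalfPlane (ρ.1 (weyl 0 (f + g)))).congr fun z _ => ?_
    rw [apply_weyl_mul_evol, ← h f g z.re]
    simp [OneParticleDynamics.classical]

end WeylDynamics

/-! ### Averaging orbits -/

section Averaging

open Set Filter Topology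

variable {L : Type u} [AddCommGroup L] [Module ℝ L] {Q : QuadraticForm ℝ L}
  {σ : LinearMap.BilinForm ℝ L} {D : OneParticleDynamics σ}

/-- Links the invariant vectors found by averaging to the kernel of the generator, in terms of which
non-degeneracy is formulated. -/
theorem UnitaryGroup.generatorGraph_zero_of_invariant {H : Type v} [NormedAddCommGroup H]
    [InnerProductSpace ℂ H] (V : UnitaryGroup H) {η : H} (h : ∀ t, V.U t η = η) :
    V.GeneratorGraph η 0 := by
  simp only [GeneratorGraph, h, smul_zero]
  exact hasDerivAt_const _ _

/-- For a non-degenerate one-particle structure, orbits can be averaged to zero. -/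
theorem exists_mem_convexHull_of_oneParticle (hQ : Q.Dominates σ) {K : Type v}
    [NormedAddCommGroup K] [InnerProductSpace ℂ K] [CompleteSpace K] {P : OneParticleStructure σ K}
    (hP : P.IsNondegenerateEquilibrium D) (hPQ : ∀ f, ‖P.p (1 ⊗ₜ[ℝ] f)‖ ^ 2 = Q f) :
    (∀ t f, Q (D.T t f) = Q f) ∧
      ∀ f, ∀ ε > 0, ∃ y ∈ convexHull ℝ (range fun t => D.T t f), Q y < ε := by
  obtain ⟨O, hO, -, hker⟩ := hP
  have hOΦ (t : ℝ) (f : L) : O.U t (P.p (1 ⊗ₜ[ℝ] f)) = P.p (1 ⊗ₜ[ℝ] D.T t f) := by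
    rw [hO, LinearMap.baseChange_tmul]
    rfl
  have hQT (t : ℝ) (f : L) : Q (D.T t f) = Q f := by
    rw [← hPQ, ← hPQ, ← hOΦ, O.norm_U]
  refine ⟨hQT, fun f ε hε => ?_⟩
  -- Here `Φ` is linear with `‖Φ f‖² = Q f`, so the weight `1 + Q f` is harmless. The limit is an
  -- invariant vector, hence zero.
  obtain ⟨d, x, hx, hxd, η, hη, hηO⟩ := exists_tendsto_invariant hQ hQT
    (Φ := fun f => P.p (1 ⊗ₜ[ℝ] f)) (fun f g => by
      rw [← map_sub, ← TensorProduct.tmul_sub, hPQ]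
      exact le_mul_of_one_le_right (hQ.nonneg _) (by linarith [hQ.nonneg f]))
    (U := fun t ψ => O.U t ψ) (fun t => (O.U t).continuous) hOΦ f
  rw [hker η (O.generatorGraph_zero_of_invariant hηO)] at hη
  have h0 : Tendsto (fun n => Q (x n)) atTop (𝓝 0) := by
    simpa [hPQ] using hη.norm.pow 2
  obtain ⟨n, hn⟩ := (h0.eventually (gt_mem_nhds hε)).exists
  exact ⟨x n, hx n, hn⟩

theorem GNSTriple.norm_weyl_Ω (hσ : σ.IsAlt) {ω : StateSpace (WeylAlgebra σ)} (τ : GNSTriple ω)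
    (f : L) : ‖τ.π (weyl σ f) τ.Ω‖ = 1 := by
  have h : ‖τ.π (weyl σ f) τ.Ω‖ ^ 2 = 1 := by
    rw [← inner_self_eq_norm_sq (𝕜 := ℂ), τ.inner_π, star_weyl_mul_weyl, sub_self, map_smul,
      apply_weyl_zero, hσ f]
    simp
  nlinarith [norm_nonneg (τ.π (weyl σ f) τ.Ω)]

/-- The map `f ↦ W(f) Ω` is locally Hölder continuous in a quasi-free state. -/
theorem norm_weyl_sub_weyl_sq_le (hQ : Q.Dominates σ) (hσ : σ.IsAlt)
    {ω : StateSpace (WeylAlgebra σ)}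
    (hω : ∀ f, ω.1 (weyl σ f) = Complex.exp (-(1 / 2) * Q f)) (τ : GNSTriple ω) (f g : L) :
    ‖τ.π (weyl σ f) τ.Ω - τ.π (weyl σ g) τ.Ω‖ ^ 2 ≤ Q (f - g) * (1 + Q f) := by
  have hre : RCLike.re ⟪τ.π (weyl σ f) τ.Ω, τ.π (weyl σ g) τ.Ω⟫_ℂ =
      Real.exp (-(1 / 2) * Q (f - g)) * Real.cos (1 / 2 * σ f g) := by
    rw [τ.inner_π, star_weyl_mul_weyl, map_smul, hω, smul_eq_mul, ← Complex.exp_add,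
      RCLike.re_to_complex, Complex.exp_re, QuadraticMap.map_sub]
    congr 2 <;> simp
  rw [@norm_sub_sq ℂ, τ.norm_weyl_Ω hσ, τ.norm_weyl_Ω hσ, hre]
  have h1 := Real.add_one_le_exp (-(1 / 2) * Q (f - g))
  have h2 := Real.one_sub_sq_div_two_le_cos (x := 1 / 2 * σ f g)
  have h3 : Real.exp (-(1 / 2) * Q (f - g)) ≤ 1 := Real.exp_le_one_iff.2 (by
    linarith [hQ.nonneg (f - g)])
  -- As `σ f f = 0`, the phase `σ f g` is controlled by the difference `f - g`. With `1 - cos x ≤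
  -- x²/2` this yields the summand `Q f` in the weight, and `1 - exp(-x) ≤ x` yields the summand
  -- `1`.
  have h4 : σ f g ^ 2 ≤ 4 * (Q f * Q (f - g)) := by
    have h5 := hQ.sq_le f (f - g)
    rwa [map_sub, hσ f, zero_sub, neg_sq] at h5
  have h6 := mul_le_of_le_one_left (sub_nonneg.2 (Real.cos_le_one (1 / 2 * σ f g))) h3
  nlinarith

/-- For a non-degenerate ground state, orbits can be averaged to zero. -/
theorem exists_mem_convexHull_of_nondegenerate (hQ : Q.Dominates σ) (hσ : σ.IsAlt)
    (hQT : ∀ t f, Q (D.T t f) = Q f) {ω : StateSpace (WeylAlgebra σ)}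
    (hω : ∀ f, ω.1 (weyl σ f) = Complex.exp (-(1 / 2) * Q f))
    (hnd : IsNondegenerateGroundState (quasiFreeDynamics D) ω) (f : L) {ε : ℝ} (hε : 0 < ε) :
    ∃ y ∈ convexHull ℝ (range fun t => D.T t f), Q y < ε := by
  obtain ⟨-, τ, V, hV, -, -, hker⟩ := hnd
  obtain ⟨d, x, hx, hxd, η, hη, hηV⟩ := exists_tendsto_invariant hQ hQT
    (Φ := fun f => τ.π (weyl σ f) τ.Ω) (norm_weyl_sub_weyl_sq_le hQ hσ hω τ)
    (U := fun t ψ => V.U t ψ) (fun t => (V.U t).continuous) (fun t f => hV.U_π t _) f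
  obtain ⟨c, rfl⟩ := hker η (V.generatorGraph_zero_of_invariant hηV)
  -- The limit of the unit vectors `W(x n)Ω` is `c Ω`, so `|c| = 1`. The overlap with `Ω` gives `c =
  -- exp(-d/2)`, and together these force `d = 0`.
  have hc : ‖c‖ = 1 := by
    have h := hη.norm
    simp only [τ.norm_weyl_Ω hσ, norm_smul, τ.norm_Ω, mul_one] at h
    exact (tendsto_nhds_unique h tendsto_const_nhds)
  have hcd : Complex.exp (-(1 / 2) * d) = c := by
    have h := (tendsto_const_nhds (x := τ.Ω)).inner (𝕜 := ℂ) hη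
    simp only [← τ.state_eq, hω, inner_smul_right, inner_self_eq_norm_sq_to_K, τ.norm_Ω] at h
    have h' : Tendsto (fun n => Complex.exp (-(1 / 2) * Q (x n))) atTop
        (𝓝 (Complex.exp (-(1 / 2) * d))) := by
      have hcont : Continuous fun r : ℝ => Complex.exp (-(1 / 2) * r) := by fun_prop
      exact (hcont.tendsto d).comp hxd
    simpa using tendsto_nhds_unique h' h
  have hd : d = 0 := by
    have h1 : (-(1 / 2) * d : ℂ) = ((-(1 / 2) * d : ℝ) : ℂ) := by push_cast; ring
    rw [← hcd, h1, ← Complex.ofReal_exp, Complex.norm_real, Real.norm_of_nonneg (Real.exp_nonneg _),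
      Real.exp_eq_one_iff] at hc
    linarith
  rw [hd] at hxd
  obtain ⟨n, hn⟩ := (hxd.eventually (gt_mem_nhds hε)).exists
  exact ⟨x n, hx n, hn⟩

end Averaging

/-! ### The two parametrizations -/

section Main

open Set

variable {L : Type u} [AddCommGroup L] [Module ℝ L] {Q : QuadraticForm ℝ L}
  {σ : LinearMap.BilinForm ℝ L} {D : OneParticleDynamics σ}

/-- States whose Gaussian quotient is constant along orbits are images of classical ground states. -/
theorem exists_classical_groundState (hQ : Q.Dominates σ) {ω : StateSpace (WeylAlgebra σ)}
    (hinv : ∀ f g t, ω.1 (weyl σ (f + D.T t g)) * Complex.exp (1 / 2 * Q (f + D.T t g)) =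
      ω.1 (weyl σ (f + g)) * Complex.exp (1 / 2 * Q (f + g)))
    (hsmall : ∀ f, ∀ ε > 0, ∃ y ∈ convexHull ℝ (range fun t => D.T t f), Q y < ε) :
    ∃ ρ ∈ groundStates (quasiFreeDynamics D.classical), ∀ f,
      ω.1 (weyl σ f) = ρ.1 (weyl 0 f) * Complex.exp (-(1 / 2) * Q f) := by
  have hq (f : L) : ω.1 (weyl σ f) = ω.1 (weyl σ f) * Complex.exp (1 / 2 * Q f) *
      Complex.exp (-(1 / 2) * Q f) := by
    rw [mul_assoc, ← Complex.exp_add, neg_mul, add_neg_cancel, Complex.exp_zero, mul_one]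
  obtain ⟨ρ, hρ⟩ := exists_weylState (σ := (0 : LinearMap.BilinForm ℝ L)) (fun _ => rfl)
    (χ := fun f => ω.1 (weyl σ f) * Complex.exp (1 / 2 * Q f)) (by
      rw [apply_weyl_zero, QuadraticMap.map_zero]
      simp) (posSemidef_quotient hQ (posSemidef_weylKernel ω) hq hinv hsmall)
  refine ⟨ρ, mem_groundStates_classical fun f g t => ?_, fun f => ?_⟩
  · rw [hρ, hρ, hinv]
  · rw [hρ, ← hq]

/-- A Gaussian state parametrizes a set of states by the classical ground states, provided that the
set is described by boundary values on a suitable region. -/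
theorem exists_lambdaMap_restricts (hσ : σ.IsAlt) (hQ : Q.Dominates σ)
    (hQT : ∀ t f, Q (D.T t f) = Q f) {ω : StateSpace (WeylAlgebra σ)}
    (hω : ∀ f, ω.1 (weyl σ f) = Complex.exp (-(1 / 2) * Q f))
    (hsmall : ∀ f, ∀ ε > 0, ∃ y ∈ convexHull ℝ (range fun t => D.T t f), Q y < ε)
    {S : Set (StateSpace (WeylAlgebra σ))} (hωS : ω ∈ S) {R : Set ℂ} (hR : HasMaxPrinciple R)
    {e : ℂ → ℝ} (he : ∀ z, |e z| ≤ 1)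
    (hS : ∀ ω' ∈ S, ∀ f g, IsBoundaryValue R fun z =>
      Complex.exp (-Complex.I / 2 * (e z * σ f (D.T z.re g) : ℝ)) *
        ω'.1 (weyl σ (f + D.T z.re g)))
    (hS' : ∀ ω' : StateSpace (WeylAlgebra σ),
      (∀ t f, ω'.1 (weyl σ (D.T t f)) = ω'.1 (weyl σ f)) →
      (∀ f g, IsBoundaryValue R fun z =>
        Complex.exp (-Complex.I / 2 * (e z * σ f (D.T z.re g) : ℝ)) *
          ω'.1 (weyl σ (f + D.T z.re g))) → ω' ∈ S)
    (hconst : ∀ q : L → ℂ, (∀ f, q (-f) = (starRingEnd ℂ) (q f)) →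
      (∀ f g, IsBoundaryValue R fun z => q (f + D.T z.re g)) →
      ∀ f g t, q (f + D.T t g) = q (f + g)) :
    ∃ lam, IsLambdaMap ω lam ∧ (∀ lam', IsLambdaMap ω lam' → lam' = lam) ∧
      RestrictsToAffineHomeomorph lam (groundStates (quasiFreeDynamics D.classical)) S := by
  obtain ⟨lam, hlam, huniq, happly⟩ := exists_isLambdaMap hσ ω
  refine ⟨lam, hlam, huniq, restrictsToAffineHomeomorph_of_apply_weyl hlam happly
    (fun f => by rw [hω]; exact Complex.exp_ne_zero _) (fun ρ hρ => ?_) fun ω' hω' => ?_⟩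
  · have hρ' := apply_weyl_add_orbit_of_mem_groundStates hρ
    refine hS' _ (fun t f => ?_) fun f g => ?_
    · have h := hρ' 0 f t
      rw [zero_add, zero_add] at h
      rw [happly, happly, h, hω, hω, hQT]
    -- Since `ρ` is constant along the orbit, the correlation function is that of `ω` times a
    -- number.
    · refine ((hS ω hωS f g).const_mul (ρ.1 (weyl 0 (f + g)))).congr fun z _ => ?_
      rw [happly, hρ', mul_left_comm]
  · have hq (f : L) : ω'.1 (weyl σ f) * Complex.exp (1 / 2 * Q f) *
        Complex.exp (-(1 / 2) * Q f) = ω'.1 (weyl σ f) := by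
      rw [mul_assoc, ← Complex.exp_add, neg_mul, add_neg_cancel, Complex.exp_zero, mul_one]
    have h₀ := hS ω hωS
    have h := hS ω' hω'
    simp only [hω] at h₀
    simp only [hω]
    refine exists_classical_groundState hQ (hconst
      (fun f => ω'.1 (weyl σ f) * Complex.exp (1 / 2 * Q f)) (fun f => ?_)
      (isBoundaryValue_quotient
        (q := fun f => ω'.1 (weyl σ f) * Complex.exp (1 / 2 * Q f)) hR hQ hQT he h₀ fun f g => ?_)) hsmall
    · rw [apply_weyl_neg, QuadraticMap.map_neg, map_mul, ← Complex.exp_conj, map_mul, Complex.conj_ofReal,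
        map_div₀, map_one, map_ofNat]
    · simpa only [hq] using h f g

theorem mainTheorem8 {L : Type u} [AddCommGroup L] [Module ℝ L]
    (σ : LinearMap.BilinForm ℝ L) (hσ : σ.IsAlt) (D : OneParticleDynamics σ) :
    (∀ (β : ℝ), 0 < β →
      ∀ ωβ ∈ kmsStates (quasiFreeDynamics D) β,
      ∀ (ω₂ : LinearMap.BilinForm ℂ (Complexification L)), IsQuasiFreeWith ωβ ω₂ →
      ∀ (K : Type v) [NormedAddCommGroup K] [InnerProductSpace ℂ K] [CompleteSpace K]
        (P : OneParticleStructure σ K),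
        P.IsAssociatedWith ω₂ → P.IsNondegenerateEquilibrium D →
      ∃ lam, IsLambdaMap ωβ lam ∧ (∀ lam', IsLambdaMap ωβ lam' → lam' = lam) ∧
        RestrictsToAffineHomeomorph lam
          (groundStates (quasiFreeDynamics D.classical))
          (kmsStates (quasiFreeDynamics D) β)) ∧
    (∀ ω₀ ∈ groundStates (quasiFreeDynamics D), IsQuasiFree ω₀ →
      IsNondegenerateGroundState (quasiFreeDynamics D) ω₀ →
      HasStrongDerivatives D ω₀ →
      ∃ lam, IsLambdaMap ω₀ lam ∧ (∀ lam', IsLambdaMap ω₀ lam' → lam' = lam) ∧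
        RestrictsToAffineHomeomorph lam
          (groundStates (quasiFreeDynamics D.classical))
          (groundStates (quasiFreeDynamics D))) := by
  refine ⟨fun β hβ ω hω ω₂ hqf K _ _ _ P hP hnd => ?_, fun ω hω hqf hnd _ => ?_⟩
  · obtain ⟨Q, hQ, hQω₂, hωQ⟩ := hqf.exists_quadraticForm
    obtain ⟨hQT, hsmall⟩ := exists_mem_convexHull_of_oneParticle hQ hnd fun f => by
      have h := hP (1 ⊗ₜ[ℝ] f) (1 ⊗ₜ[ℝ] f)
      rw [conjC_tmul, map_one, hQω₂] at h
      rw [← inner_self_eq_norm_sq (𝕜 := ℂ), ← h]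
      rfl
    -- The sign `e` is `1` on the lower edge of the strip and `-1` on the upper one, where the
    -- product is taken in the opposite order.
    refine exists_lambdaMap_restricts hσ hQ hQT hωQ hsmall hω (hasMaxPrinciple_openStrip hβ)
      (e := fun z => if z.im = 0 then 1 else -1) (fun z => by split_ifs <;> simp)
      (fun ω' hω' => isBoundaryValue_weyl_of_mem_kmsStates hσ hβ hω') (fun ω' _ h => ?_)
      fun q _ h f g t => ?_
    · refine mem_kmsStates_of_dense_span hβ (dense_span_weyl σ) ?_
      rintro _ ⟨f, rfl⟩ _ ⟨g, rfl⟩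
      exact (h f g).congr fun z _ => (kmsBoundary_weyl hσ ..).symm
    -- `q (f + T_t g)` depends only on the real part of `z`, so both edges carry the same values and
    -- the extension is periodic.
    · have h1 := IsBoundaryValue.eq_of_openStrip hβ (u := fun t => q (f + D.T t g)) (h f g) t 0
      rwa [D.T_zero] at h1
  · obtain ⟨ω₂, hqf⟩ := hqf
    obtain ⟨Q, hQ, -, hωQ⟩ := hqf.exists_quadraticForm
    -- Invariance of the state gives equality of two real Gaussians, and the real exponential is
    -- injective.
    have hQT (t : ℝ) (f : L) : Q (D.T t f) = Q f := by
      have h := hω.1 t (weyl σ f)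
      rw [quasiFreeDynamics_weyl, hωQ, hωQ] at h
      have h1 (r : ℝ) : (-(1 / 2) * r : ℂ) = ((-(1 / 2) * r : ℝ) : ℂ) := by push_cast; ring
      rw [h1, h1, ← Complex.ofReal_exp, ← Complex.ofReal_exp, Complex.ofReal_inj,
        Real.exp_eq_exp] at h
      linarith
    refine exists_lambdaMap_restricts hσ hQ hQT hωQ
      (fun f _ hε => exists_mem_convexHull_of_nondegenerate hQ hσ hQT hωQ hnd f hε) hω
      hasMaxPrinciple_openUpperHalfPlane (e := fun _ => 1) (fun _ => by simp)
      (fun ω' hω' => isBoundaryValue_weyl_of_mem_groundStates hω') (fun ω' hT h => ?_)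
      fun q => apply_add_orbit_of_upperHalfPlane
    refine mem_groundStates_of_dense_span (isEquilibriumState_of_weyl hT) (dense_span_weyl σ) ?_
    rintro _ ⟨f, rfl⟩ _ ⟨g, rfl⟩
    exact (h f g).congr fun z _ => (apply_weyl_mul_evol ..).symm

end Main
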